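/- **Setting.** Let $M=(\mathcal S,\mathcal A,P,r)$ be a Markov decision process: $\mathcal S$ is a measurable space, $\mathcal A$ a finite nonempty set, $P$ a transition kernel and $r:\mathcal S\times\mathcal A\to[0,1]$ a measurable reward. For a stationary randomised policy $\pi$ put $J^\pi(s)=\liminf_{n\to\infty}\frac1n\mathbb E^\pi[\sum_{t=1}^n r(s_t,a_t)\mid s_1=s]$ and $J^*(s)=\sup_\pi J^\pi(s)$. Write $\mathrm{sp}(v)=\sup_{s,s'}|v(s)-v(s')|$ and $\|x\|_B=\sqrt{x^\top Bx}$. Assume: 1. (Bellman optimality equation) there are $J\in\mathbb R$, a bounded measurable $v^*:\mathcal S\to\mathbb R$ and $q^*:\mathcal S\times\mathcal A\to\mathbb R$ with $J+q^*(s,a)=r(s,a)+\int v^*\,dP(\cdot|s,a)$ and $v^*(s)=\max_a q^*(s,a)$ for all $(s,a)$; 2. (linear MDP) there are a measurable feature map $\varphi:\mathcal S\times\mathcal A\to\mathbb R^d$, a vector $\theta\in\mathbb R^d$ and finite positive measures $\mu=(\mu_1,\dots,\mu_d)$ on $\mathcal S$ with $r(s,a)=\langle\varphi(s,a),\theta\rangle$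 and $P(B|s,a)=\langle\varphi(s,a),\mu(B)\rangle$ for measurable $B$, and $\|\varphi(s,a)\|_2\le1$, $\|\theta\|_2\le\sqrt d$, $\|\mu(\mathcal S)\|_2\le\sqrt d$. **Algorithm ($\gamma$-LSCVI-UCB).** Inputs: $\gamma,\lambda,H,\beta$; the learner knows $\varphi$, $r$ and $T$. Start with $k=1$, $\Lambda_1=\bar\Lambda_0=\lambda I$ and $Q^1_u\equiv\frac1{1-\gamma}$ for all $u$. At time $t=1,\dots,T$ take an action $a_t\in\arg\max_a Q^k_t(s_t,a)$ (ties broken arbitrarily), observe $s_{t+1}\sim P(\cdot|s_t,a_t)$, and set $\bar\Lambda_t=\bar\Lambda_{t-1}+\varphi(s_t,a_t)\varphi(s_t,a_t)^\top$. If $2\det\Lambda_k<\det\bar\Lambda_t$, increase $k$ by one, set $t_k=t+1$, $\Lambda_k=\bar\Lambda_t$, $\tilde V^k_{T+1}=V^k_{T+1}\equiv\frac1{1-\gamma}$, and for $u=T,T-1,\dots,t_k$ compute, with $m_{u}=\inf_{s'}\tilde V^k_{u}(s')$, $$w^k_{u+1}=\Lambda_k^{-1}\sum_{\tau=1}^{t_k-1}\varphi(s_\tau,a_\tau)\bigl(V^k_{u+1}(s_{\tau+1})-m_{u+1}\bigr),$$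 $$Q^k_u=\min\Bigl\{r+\gamma\bigl(\langle\varphi,w^k_{u+1}\rangle+m_{u+1}+\beta\|\varphi\|_{\Lambda_k^{-1}}\bigr),\tfrac1{1-\gamma}\Bigr\},\quad \tilde V^k_u=\max_aQ^k_u(\cdot,a),\quad V^k_u=\min\{\tilde V^k_u,\,m_u+H\}.$$ **Theorem.** There are absolute constants $c_\beta>0$ and $C>0$ such that the following holds. (a) Let $M$ satisfy 1 and 2, let $T\ge2$ be an integer and $\delta\in(0,1)$, let $s_1$ be any initial state, and run $\gamma$-LSCVI-UCB with $\gamma=1-\sqrt{\log(T)/T}$, $\lambda=1$, $H=2\,\mathrm{sp}(v^*)$ and $\beta=2c_\beta\,\mathrm{sp}(v^*)\,d\sqrt{\log(dT/\delta)}$. Then with probability at least $1-\delta$ the regret $R_T=\sum_{t=1}^T(J^*(s_1)-r(s_t,a_t))$ satisfies $$R_T\le C\Bigl(\mathrm{sp}(v^*)\sqrt{d^3\,T\,\log(T)\,\log(dT/\delta)}+d\sqrt{T\log T}\Bigr).$$ (For $\mathrm{sp}(v^*)\ge1$ the second summand is at most a constant times the first, so $R_T=O\bigl(\mathrm{sp}(v^*)\sqrt{d^3T\log(T)\log(dT/\delta)}\bigr)$.)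 (b) Let $\mathcal S$ and $\mathcal A$ be finite with $S$ and $A$ elements, $d\ge1$, $T\ge2$, $\lambda=1$ and $\|\varphi\|_2\le1$. The algorithm (with any real inputs $\gamma,H,\beta$, and any states returned by the environment) is carried out by an explicit program which uses at most $C\,\log_2(T)\,d^3\,S\,A\,T^2$ steps, where an arithmetic operation on reals, a square root, a comparison, an access to a memory cell and the start of a round of a loop count as one step each. In particular its running time is polynomial in $d,S,A,T$. -/

import Mathlib

open MeasureTheory ProbabilityTheory
open scoped Matrix

noncomputable section

namespace GammaLSCVI

/-! ## Markov decision processes with the average-reward criterion -/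

/-- A Markov decision process with measurable state space `S`, action space `A`, transition kernel
`P` and a measurable deterministic reward with values in `[0, 1]`. -/
structure MDP (S A : Type*) [MeasurableSpace S] [MeasurableSpace A] where
  P : Kernel (S × A) S
  markov : IsMarkovKernel P
  r : S → A → ℝ
  measurable_r : Measurable (Function.uncurry r)
  r_mem : ∀ s a, r s a ∈ Set.Icc (0 : ℝ) 1

section AverageReward

variable {S A : Type*} [MeasurableSpace S] [MeasurableSpace A]

/-- The law of the state after `n` transitions, when the stationary (randomised) policy `π` is
followed from the initial state `s`. -/
def stateLaw (M : MDP S A) (π : Kernel S A) (s : S) : ℕ → Measure S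
  | 0 => Measure.dirac s
  | n + 1 => (stateLaw M π s n ⊗ₘ π).bind M.P

/-- The expected reward under `π`, started at `s`, collected after `n` transitions, that is, at
time step `n + 1`. -/
def expectedReward (M : MDP S A) (π : Kernel S A) (s : S) (n : ℕ) : ℝ :=
  ∫ p, M.r p.1 p.2 ∂(stateLaw M π s n ⊗ₘ π)

/-- The long-term average reward `J^π(s) = liminf_T (1 / T) E^π[∑_{t ≤ T} r(s_t, a_t) | s_1 = s]`. -/
def averageReward (M : MDP S A) (π : Kernel S A) (s : S) : ℝ :=
  Filter.liminf (fun T : ℕ => (1 / (T : ℝ)) * ∑ n ∈ Finset.range T, expectedReward M π s n)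
    Filter.atTop

/-- `J^*(s)`, the best long-term average reward of a stationary policy started at `s`. -/
def optimalGain (M : MDP S A) (s : S) : ℝ :=
  ⨆ π : {π : Kernel S A // IsMarkovKernel π}, averageReward M π.1 s

/-- The span `sp(v) = sup_{s, s'} |v(s) - v(s')|`. -/
def span (v : S → ℝ) : ℝ := ⨆ p : S × S, |v p.1 - v p.2|

/-- `(J, v, q)` solves the Bellman optimality equation of `M`; the function `v` is measurable and
bounded, so that its expectations and its span are defined. -/
structure SolvesBellman (M : MDP S A) (J : ℝ) (v : S → ℝ) (q : S → A → ℝ) : Prop where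
  measurable_v : Measurable v
  bounded_v : ∃ B : ℝ, ∀ s, |v s| ≤ B
  gain_add : ∀ s a, J + q s a = M.r s a + ∫ s', v s' ∂(M.P (s, a))
  v_eq_max : ∀ s, IsGreatest (Set.range (q s)) (v s)

/-- `M` is a linear MDP with feature map `φ`, reward parameter `θ` and vector of (finite, positive)
measures `μ`, under the usual norm bounds. -/
structure IsLinearMDP {d : ℕ} (M : MDP S A) (φ : S → A → EuclideanSpace ℝ (Fin d))
    (θ : EuclideanSpace ℝ (Fin d)) (μ : Fin d → Measure S) : Prop where
  measurable_feature : ∀ a, Measurable (fun s => φ s a)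
  finite_measure : ∀ i, IsFiniteMeasure (μ i)
  reward_eq : ∀ s a, M.r s a = inner ℝ (φ s a) θ
  transition_eq : ∀ s a, ∀ B : Set S, MeasurableSet B →
    (M.P (s, a)).real B = ∑ i, φ s a i * (μ i).real B
  norm_feature_le : ∀ s a, ‖φ s a‖ ≤ 1
  norm_theta_le : ‖θ‖ ≤ √(d : ℝ)
  norm_mass_le :
    ‖(WithLp.toLp 2 fun i => (μ i).real Set.univ : EuclideanSpace ℝ (Fin d))‖ ≤ √(d : ℝ)

/-- States `X 1, X 2, …, X (T + 1)` and actions `Y 1, …, Y T` are produced by the interaction of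
some learner with `M`: `F t` contains what is known once the action `Y t` has been chosen (the
history and, possibly, randomness used by the learner), and given `F t` the next state has the law
`P(· | X t, Y t)`. The initial state `X 1` is arbitrary. -/
structure IsInteraction {Ω : Type*} [mΩ : MeasurableSpace Ω] (M : MDP S A) (T : ℕ)
    (Pr : Measure Ω) (F : Filtration ℕ mΩ) (X : ℕ → Ω → S) (Y : ℕ → Ω → A) : Prop where
  measurable_state : ∀ t, 1 ≤ t → t ≤ T + 1 → Measurable[F t] (X t)
  measurable_action : ∀ t, 1 ≤ t → t ≤ T → Measurable[F t] (Y t)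
  next_state : ∀ t, 1 ≤ t → t ≤ T → ∀ B : Set S, MeasurableSet B →
    Pr[(X (t + 1) ⁻¹' B).indicator (fun _ => (1 : ℝ)) | F t]
      =ᵐ[Pr] fun ω => (M.P (X t ω, Y t ω)).real B

/-- The regret `R_T = ∑_{t = 1}^T (J^*(s_1) - r(s_t, a_t))` along a trajectory. -/
def regret (M : MDP S A) (T : ℕ) (s : ℕ → S) (a : ℕ → A) : ℝ :=
  ∑ t ∈ Finset.Icc 1 T, (optimalGain M (s 1) - M.r (s t) (a t))

end AverageReward

/-! ## The algorithm γ-LSCVI-UCB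

The algorithm sees the trajectory `s 1, s 2, …` (states) and `a 1, a 2, …` (actions). -/

/-- The inputs of the algorithm: discount factor, regularisation, target span, bonus factor. -/
structure Inputs where
  gamma : ℝ
  lam : ℝ
  H : ℝ
  beta : ℝ

section Algorithm

variable {S A : Type*} {d : ℕ}

/-- The norm `‖x‖_B = √(xᵀ B x)`. -/
def weightedNorm (B : Matrix (Fin d) (Fin d) ℝ) (x : EuclideanSpace ℝ (Fin d)) : ℝ :=
  √(x.ofLp ⬝ᵥ (B *ᵥ x.ofLp))

/-- A value function `Ṽ_u` together with its clipped version `V_u`. -/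
structure ValuePair (S : Type*) where
  tilde : S → ℝ
  clipped : S → ℝ

/-- `w_{u+1} = Λ⁻¹ ∑_{τ = 1}^n φ(s_τ, a_τ) (V_{u+1}(s_{τ+1}) - min_{s'} Ṽ_{u+1}(s'))`. -/
def regressionWeight (φ : S → A → EuclideanSpace ℝ (Fin d)) (s : ℕ → S) (a : ℕ → A)
    (Lam : Matrix (Fin d) (Fin d) ℝ) (n : ℕ) (V : ValuePair S) : Fin d → ℝ :=
  Lam⁻¹ *ᵥ ∑ τ ∈ Finset.Icc 1 n,
    (V.clipped (s (τ + 1)) - ⨅ x, V.tilde x) • (φ (s τ) (a τ)).ofLp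

/-- The function `Q_u` obtained from `Ṽ_{u+1}` and `V_{u+1}`. -/
def qBackup (φ : S → A → EuclideanSpace ℝ (Fin d)) (r : S → A → ℝ) (I : Inputs)
    (s : ℕ → S) (a : ℕ → A) (Lam : Matrix (Fin d) (Fin d) ℝ) (n : ℕ) (V : ValuePair S) :
    S → A → ℝ :=
  fun x b =>
    min (r x b + I.gamma * ((φ x b).ofLp ⬝ᵥ regressionWeight φ s a Lam n V
        + (⨅ y, V.tilde y) + I.beta * weightedNorm Lam⁻¹ (φ x b)))
      (1 / (1 - I.gamma))

/-- `Ṽ_u = max_a Q_u(·, a)` and `V_u = min (Ṽ_u, min_{s'} Ṽ_u(s') + H)`. -/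
def clippedValues (H : ℝ) (Q : S → A → ℝ) : ValuePair S where
  tilde := fun x => ⨆ b, Q x b
  clipped := fun x => min (⨆ b, Q x b) ((⨅ y, ⨆ b, Q y b) + H)

/-- The pair `(Ṽ_{T+1-j}, V_{T+1-j})`, after `j` value iterations with matrix `Lam` and the first
`n` transitions of the trajectory as data. -/
def valueIteration (φ : S → A → EuclideanSpace ℝ (Fin d)) (r : S → A → ℝ) (I : Inputs)
    (s : ℕ → S) (a : ℕ → A) (Lam : Matrix (Fin d) (Fin d) ℝ) (n : ℕ) : ℕ → ValuePair S
  | 0 => ⟨fun _ => 1 / (1 - I.gamma), fun _ => 1 / (1 - I.gamma)⟩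
  | j + 1 => clippedValues I.H
      (qBackup φ r I s a Lam n (valueIteration φ r I s a Lam n j))

/-- The planned action value function `Q_u`, for `u ≤ T`. -/
def plannedQ (φ : S → A → EuclideanSpace ℝ (Fin d)) (r : S → A → ℝ) (I : Inputs) (T : ℕ)
    (s : ℕ → S) (a : ℕ → A) (Lam : Matrix (Fin d) (Fin d) ℝ) (n : ℕ) (u : ℕ) : S → A → ℝ :=
  qBackup φ r I s a Lam n (valueIteration φ r I s a Lam n (T - u))

/-- The variables of the algorithm: episode index `k`, first step `t_k` of the episode, `Λ_k`,
`Λ̄_t`, and the action value functions `Q^k_u`. -/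
structure LearnerState (S A : Type*) (d : ℕ) where
  episode : ℕ
  start : ℕ
  Lam : Matrix (Fin d) (Fin d) ℝ
  LamBar : Matrix (Fin d) (Fin d) ℝ
  Q : ℕ → S → A → ℝ

open Classical in
/-- The variables of the algorithm at the end of time step `t` (`t = 0`: after initialisation). -/
def learnerState (φ : S → A → EuclideanSpace ℝ (Fin d)) (r : S → A → ℝ) (I : Inputs) (T : ℕ)
    (s : ℕ → S) (a : ℕ → A) : ℕ → LearnerState S A d
  | 0 => ⟨1, 1, I.lam • 1, I.lam • 1, fun _ _ _ => 1 / (1 - I.gamma)⟩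
  | t + 1 =>
    let σ := learnerState φ r I T s a t
    let x : Fin d → ℝ := (φ (s (t + 1)) (a (t + 1))).ofLp
    let LamBar' := σ.LamBar + Matrix.vecMulVec x x
    if 2 * σ.Lam.det < LamBar'.det then
      ⟨σ.episode + 1, t + 2, LamBar', LamBar', plannedQ φ r I T s a LamBar' (t + 1)⟩
    else
      ⟨σ.episode, σ.start, σ.Lam, LamBar', σ.Q⟩

/-- Along the trajectory, each of the actions `a_1, …, a_T` is one that the algorithm may take:
`a_t ∈ argmax_b Q^k_t(s_t, b)`, with ties broken in any way. -/
def FollowsAlgorithm (φ : S → A → EuclideanSpace ℝ (Fin d)) (r : S → A → ℝ) (I : Inputs) (T : ℕ)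
    (s : ℕ → S) (a : ℕ → A) : Prop :=
  ∀ t, 1 ≤ t → t ≤ T → ∀ b : A,
    (learnerState φ r I T s a (t - 1)).Q t (s t) b
      ≤ (learnerState φ r I T s a (t - 1)).Q t (s t) (a t)

end Algorithm

/-! ## Step counting

Computations over the reals with unit cost: an arithmetic operation, a square root, a comparison,
reading or writing one memory cell, and starting one round of a loop cost one step each. -/

/-- A value together with the number of steps spent on computing it. -/
structure Timed (α : Type) where
  val : α
  cost : ℕ

namespace Timed

instance : Monad Timed where
  pure x := ⟨x, 0⟩
  bind p f := ⟨(f p.val).val, p.cost + (f p.val).cost⟩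

/-- One step. -/
def tick : Timed Unit := ⟨(), 1⟩

def addR (x y : ℝ) : Timed ℝ := ⟨x + y, 1⟩
def subR (x y : ℝ) : Timed ℝ := ⟨x - y, 1⟩
def mulR (x y : ℝ) : Timed ℝ := ⟨x * y, 1⟩
def divR (x y : ℝ) : Timed ℝ := ⟨x / y, 1⟩
def minR (x y : ℝ) : Timed ℝ := ⟨min x y, 1⟩
def maxR (x y : ℝ) : Timed ℝ := ⟨max x y, 1⟩
def sqrtR (x : ℝ) : Timed ℝ := ⟨√x, 1⟩
open Classical in
def ltR (x y : ℝ) : Timed Bool := ⟨decide (x < y), 1⟩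

/-- Reading the entry `i` of an array. -/
def readAt {ι α : Type} (v : ι → α) (i : ι) : Timed α := ⟨v i, 1⟩

/-- Reading the entry `(i, j)` of a two-dimensional array. -/
def readAt₂ {ι κ α : Type} (v : ι → κ → α) (i : ι) (j : κ) : Timed α := ⟨v i j, 1⟩

/-- Overwriting the entry `i` of an array. -/
def writeAt {ι α : Type} [DecidableEq ι] (v : ι → α) (i : ι) (x : α) : Timed (ι → α) :=
  ⟨Function.update v i x, 1⟩

/-- Filling a new array of length `n`: all entries are computed, and each is written once. -/
def tabulate {α : Type} (n : ℕ) (f : Fin n → Timed α) : Timed (Fin n → α) :=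
  ⟨fun i => (f i).val, ∑ i, ((f i).cost + 1)⟩

/-- A loop over the list `l` with loop variable `σ`. -/
def loop {ι σ : Type} : List ι → σ → (σ → ι → Timed σ) → Timed σ
  | [], x, _ => pure x
  | i :: l, x, body => do
      tick
      let y ← body x i
      loop l y body

/-- The sum of the values `f i`, `i ∈ l`. -/
def sumLoop {ι : Type} (l : List ι) (f : ι → Timed ℝ) : Timed ℝ :=
  loop l 0 fun acc i => do
    let x ← f i
    addR acc x

/-- The largest entry of an array. -/
def maxLoop {n : ℕ} [NeZero n] (v : Fin n → ℝ) : Timed ℝ := do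
  let x ← readAt v 0
  loop (List.finRange n) x fun acc i => do
    let y ← readAt v i
    maxR acc y

/-- The smallest entry of an array. -/
def minLoop {n : ℕ} [NeZero n] (v : Fin n → ℝ) : Timed ℝ := do
  let x ← readAt v 0
  loop (List.finRange n) x fun acc i => do
    let y ← readAt v i
    minR acc y

/-- The index of a largest entry of an array. -/
def argmaxLoop {n : ℕ} [NeZero n] (v : Fin n → ℝ) : Timed (Fin n) :=
  loop (List.finRange n) 0 fun best i => do
    let x ← readAt v best
    let y ← readAt v i
    let c ← ltR x y
    pure (if c then i else best)

/-- The inner product of two vectors. -/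
def dotT {d : ℕ} (x y : Fin d → ℝ) : Timed ℝ :=
  sumLoop (List.finRange d) fun i => do
    let a ← readAt x i
    let b ← readAt y i
    mulR a b

/-- The product of a matrix and a vector. -/
def mulVecT {d : ℕ} (B : Matrix (Fin d) (Fin d) ℝ) (x : Fin d → ℝ) : Timed (Fin d → ℝ) :=
  tabulate d fun i => dotT (B i) x

end Timed

/-! ## A step-counted implementation of γ-LSCVI-UCB for finite state and action spaces

The reward and the features are given as tables. The inverse and the determinant of `Λ̄_t` are
kept in memory and updated by the rank-one formulas
`(B + x xᵀ)⁻¹ = B⁻¹ - (B⁻¹ x)(B⁻¹ x)ᵀ / (1 + xᵀ B⁻¹ x)` and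
`det (B + x xᵀ) = det B * (1 + xᵀ B⁻¹ x)`. -/

section Implementation

open Timed

variable {d nS nA : ℕ} [NeZero nS] [NeZero nA]

/-- The memory of the program. -/
structure Memory (d nS nA : ℕ) where
  lamInv : Matrix (Fin d) (Fin d) ℝ
  detLam : ℝ
  lamBarInv : Matrix (Fin d) (Fin d) ℝ
  detLamBar : ℝ
  Q : ℕ → Fin nS → Fin nA → ℝ
  acts : ℕ → Fin nA

/-- The memory used by the value iterations: `min_{s'} Ṽ(s')`, `V`, and the table of the `Q_u`. -/
structure PlanMemory (nS nA : ℕ) where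
  minV : ℝ
  V : Fin nS → ℝ
  Q : ℕ → Fin nS → Fin nA → ℝ

/-- Copying the feature vector of `(x, b)` entry by entry. -/
def fetchFeature (φ : Fin nS → Fin nA → EuclideanSpace ℝ (Fin d)) (x : Fin nS) (b : Fin nA) :
    Timed (Fin d → ℝ) :=
  tabulate d fun i => readAt (φ x b).ofLp i

/-- The regression coefficients. -/
def weightT (φ : Fin nS → Fin nA → EuclideanSpace ℝ (Fin d)) (s : ℕ → Fin nS) (a : ℕ → Fin nA)
    (lamInv : Matrix (Fin d) (Fin d) ℝ) (n : ℕ) (minV : ℝ) (V : Fin nS → ℝ) :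
    Timed (Fin d → ℝ) := do
  let b ← tabulate d fun i =>
    sumLoop ((List.range n).map (· + 1)) fun τ => do
      let x ← readAt s τ
      let c ← readAt a τ
      let f ← readAt (φ x c).ofLp i
      let x' ← readAt s (τ + 1)
      let y ← readAt V x'
      let z ← subR y minV
      mulR z f
  mulVecT lamInv b

/-- One entry `Q_u(x, b)`. -/
def qEntryT (φ : Fin nS → Fin nA → EuclideanSpace ℝ (Fin d)) (r : Fin nS → Fin nA → ℝ)
    (I : Inputs) (cap : ℝ) (lamInv : Matrix (Fin d) (Fin d) ℝ) (w : Fin d → ℝ) (minV : ℝ)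
    (x : Fin nS) (b : Fin nA) : Timed ℝ := do
  let f ← fetchFeature φ x b
  let p ← dotT f w
  let g ← mulVecT lamInv f
  let h ← dotT f g
  let nrm ← sqrtR h
  let bonus ← mulR I.beta nrm
  let y₁ ← addR p minV
  let y₂ ← addR y₁ bonus
  let y₃ ← mulR I.gamma y₂
  let rew ← readAt₂ r x b
  let y₄ ← addR rew y₃
  minR y₄ cap

/-- One value iteration, which computes `Q_u`, `Ṽ_u` and `V_u`. -/
def planStepT (φ : Fin nS → Fin nA → EuclideanSpace ℝ (Fin d)) (r : Fin nS → Fin nA → ℝ)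
    (I : Inputs) (cap : ℝ) (s : ℕ → Fin nS) (a : ℕ → Fin nA) (lamInv : Matrix (Fin d) (Fin d) ℝ)
    (n : ℕ) (m : PlanMemory nS nA) (u : ℕ) : Timed (PlanMemory nS nA) := do
  let w ← weightT φ s a lamInv n m.minV m.V
  let Qu ← tabulate nS fun x => tabulate nA fun b => qEntryT φ r I cap lamInv w m.minV x b
  let tab ← writeAt m.Q u Qu
  let tilde ← tabulate nS fun x => maxLoop (Qu x)
  let minV ← minLoop tilde
  let top ← addR minV I.H
  let V ← tabulate nS fun x => do
    let y ← readAt tilde x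
    minR y top
  pure ⟨minV, V, tab⟩

/-- The value iterations for `u = T, T - 1, …, n + 1`. -/
def planT (φ : Fin nS → Fin nA → EuclideanSpace ℝ (Fin d)) (r : Fin nS → Fin nA → ℝ)
    (I : Inputs) (T : ℕ) (s : ℕ → Fin nS) (a : ℕ → Fin nA) (lamInv : Matrix (Fin d) (Fin d) ℝ)
    (n : ℕ) (Q : ℕ → Fin nS → Fin nA → ℝ) : Timed (ℕ → Fin nS → Fin nA → ℝ) := do
  let c ← subR 1 I.gamma
  let cap ← divR 1 c
  let V₀ ← tabulate nS fun _ => pure cap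
  let m ← loop ((List.range (T - n)).map (T - ·)) ⟨cap, V₀, Q⟩
    (planStepT φ r I cap s a lamInv n)
  pure m.Q

/-- Initialisation. -/
def initT (I : Inputs) (T : ℕ) : Timed (Memory d nS nA) := do
  let c ← subR 1 I.gamma
  let cap ← divR 1 c
  let l ← divR 1 I.lam
  let B ← tabulate d fun i => tabulate d fun j => do
    tick
    pure (if i = j then l else 0)
  let D ← loop (List.finRange d) 1 fun acc _ => mulR acc I.lam
  let empty : ℕ → Fin nS → Fin nA → ℝ := fun _ _ _ => 0
  let Q ← loop ((List.range T).map (· + 1)) empty fun tab u => do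
    let Qu ← tabulate nS fun _ => tabulate nA fun _ => pure cap
    writeAt tab u Qu
  pure ⟨B, D, B, D, Q, fun _ => 0⟩

/-- Time step `t`: choose an action, observe the next state, update the matrices and, if the
determinant has doubled, plan again. -/
def stepT (φ : Fin nS → Fin nA → EuclideanSpace ℝ (Fin d)) (r : Fin nS → Fin nA → ℝ)
    (I : Inputs) (T : ℕ) (s : ℕ → Fin nS) (m : Memory d nS nA) (t : ℕ) :
    Timed (Memory d nS nA) := do
  let x ← readAt s t
  let row ← readAt₂ m.Q t x
  let b ← argmaxLoop row
  let acts ← writeAt m.acts t b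
  let f ← fetchFeature φ x b
  let g ← mulVecT m.lamBarInv f
  let h ← dotT f g
  let e ← addR 1 h
  let detBar ← mulR m.detLamBar e
  let inv ← tabulate d fun i => tabulate d fun j => do
    let gi ← readAt g i
    let gj ← readAt g j
    let y ← mulR gi gj
    let z ← divR y e
    let old ← readAt₂ m.lamBarInv i j
    subR old z
  let twice ← mulR 2 m.detLam
  let c ← ltR twice detBar
  if c then do
    let Q ← planT φ r I T s acts inv t m.Q
    pure ⟨inv, detBar, inv, detBar, Q, acts⟩
  else
    pure ⟨m.lamInv, m.detLam, inv, detBar, m.Q, acts⟩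

/-- The whole run of the program over `T` time steps, against the states `s 1, s 2, …` returned
by the environment (`s (t + 1)` is first read after `a t` has been chosen). The value is the
sequence of the chosen actions. -/
def runT (φ : Fin nS → Fin nA → EuclideanSpace ℝ (Fin d)) (r : Fin nS → Fin nA → ℝ)
    (I : Inputs) (T : ℕ) (s : ℕ → Fin nS) : Timed (ℕ → Fin nA) := do
  let m₀ ← initT I T
  let m ← loop ((List.range T).map (· + 1)) m₀ (stepT φ r I T s)
  pure m.acts

end Implementation

end GammaLSCVI

end

open MeasureTheory ProbabilityTheory
open scoped Matrix

noncomputable section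

namespace GammaLSCVI

/-! ## Rank-one updates of positive definite matrices -/

section LinearAlgebra

variable {d : ℕ}

/-! Regret. The Bellman equation gives `J* ≤ J` (`SolvesBellman.optimalGain_le`), so it suffices to
bound the sum of `J - r(s_t, a_t)`. The algorithm plans for a discounted problem, and the proof
compares its values with `J/(1-γ) + v - sup v`, a subsolution of the discounted Bellman equation.

If every regression error is at most the bonus plus a tiny `e` (`IsAccurate`), induction over the
value iterations shows that the clipped values dominate this subsolution up to `e/(1-γ)`
(`le_dataValue_clipped`); clipping at the minimum plus `H` is harmless because `sp(v) ≤ H`. Optimism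
and greediness then bound `J - r(s_t, a_t)` by `(1-γ) sp(v)`, a difference of planned values at
consecutive times, a martingale difference and twice the bonus (`planned_step_le`).

Summed over time (`regret_le`), the differences telescope inside an episode. Each of the `O(d log
T)` changes of episode costs `O(1/(1-γ) + sp(v))` (`sum_planValue_sub_le`). The martingale part is
controlled by Azuma-Hoeffding with range `H` (`IsInteraction.measure_sum_valueNoise_le`), and the
bonuses by the elliptical potential, where doubling of the determinant lets a stale matrix stand in
for the current one (`sum_bonus_le`). The choice `1-γ = √(log T / T)` balances `T(1-γ)` against `log
T/(1-γ)` (`regret_bound_le`).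

Accuracy is a uniform law of large numbers (`IsInteraction.measure_uniform_noise_le`). The computed
functions belong to a class with `d + 1 + d²` real parameters. For a fixed function and a fixed
direction `z`, an exponential supermartingale bounds `z · S - zᵀΛz/8`, where `S` is the noise
vector. A union bound over a grid of parameters and directions, followed by the choice of a grid
point near the maximiser `4Λ⁻¹S`, yields the self-normalised bound. The logarithm of the grid size
is of order `d² log(dT/δ)`, which explains the factor `d` in `β`. Since clipping confines the
functions to a range of length `H`, the noise scales with `sp(v)` and not with `1/(1-γ)`. When
`sp(v) ≥ √T` the claimed bound already exceeds `T`.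

Running time. The program keeps the inverse and the determinant up to date by rank-one formulas,
which are exact. A plan costs `O(d² S A T²)` steps, and the number of plans is bounded by the number
of determinant doublings (`stepT_spec`, `runT_spec`). -/

/-- The quadratic form `xᵀ B x`. -/
def quadForm (B : Matrix (Fin d) (Fin d) ℝ) (x : Fin d → ℝ) : ℝ := x ⬝ᵥ (B *ᵥ x)

theorem weightedNorm_eq_sqrt_quadForm (B : Matrix (Fin d) (Fin d) ℝ)
    (x : EuclideanSpace ℝ (Fin d)) : weightedNorm B x = √(quadForm B x.ofLp) := rfl

theorem dotProduct_mulVec_comm_of_isSymm {B : Matrix (Fin d) (Fin d) ℝ} (hB : B.IsHermitian)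
    (x y : Fin d → ℝ) : x ⬝ᵥ (B *ᵥ y) = y ⬝ᵥ (B *ᵥ x) := by
  have hB' : Bᵀ = B := by simpa using hB.eq
  rw [Matrix.dotProduct_mulVec, dotProduct_comm, ← Matrix.mulVec_transpose, hB']

theorem quadForm_nonneg {B : Matrix (Fin d) (Fin d) ℝ} (hB : B.PosSemidef) (x : Fin d → ℝ) :
    0 ≤ quadForm B x := by
  simpa [quadForm] using hB.dotProduct_mulVec_nonneg x

theorem quadForm_add {B : Matrix (Fin d) (Fin d) ℝ} (hB : B.IsHermitian) (x y : Fin d → ℝ) :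
    quadForm B (x + y) = quadForm B x + 2 * (x ⬝ᵥ (B *ᵥ y)) + quadForm B y := by
  simp only [quadForm, Matrix.mulVec_add, dotProduct_add, add_dotProduct]
  rw [dotProduct_mulVec_comm_of_isSymm hB y x]; ring

theorem quadForm_smul (B : Matrix (Fin d) (Fin d) ℝ) (c : ℝ) (x : Fin d → ℝ) :
    quadForm B (c • x) = c ^ 2 * quadForm B x := by
  simp only [quadForm, Matrix.mulVec_smul, dotProduct_smul, smul_dotProduct, smul_eq_mul]; ring

/-- Cauchy-Schwarz: the form at `x + t y` is a nonnegative quadratic polynomial in `t`, so its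
discriminant is nonpositive. Semidefiniteness is enough. -/
theorem sq_dotProduct_mulVec_le {B : Matrix (Fin d) (Fin d) ℝ} (hB : B.PosSemidef)
    (x y : Fin d → ℝ) : (x ⬝ᵥ (B *ᵥ y)) ^ 2 ≤ quadForm B x * quadForm B y := by
  have h : ∀ t : ℝ, 0 ≤ quadForm B y * (t * t) + (2 * (x ⬝ᵥ (B *ᵥ y))) * t + quadForm B x := by
    intro t
    have := quadForm_nonneg hB (x + t • y)
    rw [quadForm_add hB.isHermitian, quadForm_smul, Matrix.mulVec_smul, dotProduct_smul,
      smul_eq_mul] at this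
    linarith
  have := discrim_le_zero h
  rw [discrim] at this
  linarith

theorem abs_dotProduct_mulVec_le {B : Matrix (Fin d) (Fin d) ℝ} (hB : B.PosSemidef)
    (x y : Fin d → ℝ) : |x ⬝ᵥ (B *ᵥ y)| ≤ √(quadForm B x) * √(quadForm B y) := by
  rw [← Real.sqrt_mul (quadForm_nonneg hB x)]
  exact Real.abs_le_sqrt (sq_dotProduct_mulVec_le hB x y)

theorem sqrt_quadForm_add_le {B : Matrix (Fin d) (Fin d) ℝ} (hB : B.PosSemidef)
    (x y : Fin d → ℝ) : √(quadForm B (x + y)) ≤ √(quadForm B x) + √(quadForm B y) := by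
  apply Real.sqrt_le_iff.2 ⟨by positivity, ?_⟩
  rw [quadForm_add hB.isHermitian, add_sq, Real.sq_sqrt (quadForm_nonneg hB x),
    Real.sq_sqrt (quadForm_nonneg hB y)]
  have := (le_abs_self _).trans (abs_dotProduct_mulVec_le hB x y)
  linarith

theorem vecMulVec_mulVec_self (x y : Fin d → ℝ) :
    Matrix.vecMulVec x x *ᵥ y = (x ⬝ᵥ y) • x := by
  rw [Matrix.vecMulVec_mulVec]; ext i; simp [mul_comm]

theorem quadForm_add_vecMulVec (B : Matrix (Fin d) (Fin d) ℝ) (x y : Fin d → ℝ) :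
    quadForm (B + Matrix.vecMulVec x x) y = quadForm B y + (x ⬝ᵥ y) ^ 2 := by
  simp only [quadForm, Matrix.add_mulVec, dotProduct_add, vecMulVec_mulVec_self, dotProduct_smul,
    smul_eq_mul, dotProduct_comm y x]
  ring

theorem posSemidef_vecMulVec (x : Fin d → ℝ) : (Matrix.vecMulVec x x).PosSemidef := by
  simpa using Matrix.posSemidef_vecMulVec_self_star x

theorem one_add_quadForm_inv_pos {B : Matrix (Fin d) (Fin d) ℝ} (hB : B.PosDef)
    (x : Fin d → ℝ) : 0 < 1 + quadForm B⁻¹ x := by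
  have := quadForm_nonneg hB.inv.posSemidef x
  linarith

/-- The Sherman–Morrison formula. -/
theorem inv_add_vecMulVec {B : Matrix (Fin d) (Fin d) ℝ} (hB : B.PosDef) (x : Fin d → ℝ) :
    (B + Matrix.vecMulVec x x)⁻¹ =
      B⁻¹ - (1 + quadForm B⁻¹ x)⁻¹ • Matrix.vecMulVec (B⁻¹ *ᵥ x) (B⁻¹ *ᵥ x) := by
  have hu : IsUnit B.det := hB.det_pos.ne'.isUnit
  have hpos := one_add_quadForm_inv_pos hB x
  have hsym : x ᵥ* B⁻¹ = B⁻¹ *ᵥ x := by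
    have : (B⁻¹)ᵀ = B⁻¹ := by simpa using hB.inv.isHermitian.eq
    rw [← Matrix.mulVec_transpose, this]
  apply Matrix.inv_eq_right_inv
  -- Multiplying out, every rank-one term is a multiple of `x (B⁻¹x)ᵀ`, and the coefficients cancel.
  have h1 : B * Matrix.vecMulVec (B⁻¹ *ᵥ x) (B⁻¹ *ᵥ x) = Matrix.vecMulVec x (B⁻¹ *ᵥ x) := by
    rw [Matrix.mul_vecMulVec, Matrix.mulVec_mulVec, Matrix.mul_nonsing_inv _ hu,
      Matrix.one_mulVec]
  have h2 : Matrix.vecMulVec x x * B⁻¹ = Matrix.vecMulVec x (B⁻¹ *ᵥ x) := by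
    rw [Matrix.vecMulVec_mul, hsym]
  have h3 : Matrix.vecMulVec x x * Matrix.vecMulVec (B⁻¹ *ᵥ x) (B⁻¹ *ᵥ x)
      = quadForm B⁻¹ x • Matrix.vecMulVec x (B⁻¹ *ᵥ x) := by
    rw [Matrix.mul_vecMulVec, vecMulVec_mulVec_self, Matrix.smul_vecMulVec]; rfl
  rw [mul_sub, add_mul, Matrix.mul_nonsing_inv _ hu, h2, mul_smul_comm, add_mul, h1, h3]
  ext i j
  simp only [Matrix.sub_apply, Matrix.add_apply, Matrix.smul_apply, smul_eq_mul]
  field_simp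
  ring

theorem quadForm_inv_add_vecMulVec {B : Matrix (Fin d) (Fin d) ℝ} (hB : B.PosDef)
    (x y : Fin d → ℝ) : quadForm (B + Matrix.vecMulVec x x)⁻¹ y =
      quadForm B⁻¹ y - (y ⬝ᵥ (B⁻¹ *ᵥ x)) ^ 2 / (1 + quadForm B⁻¹ x) := by
  rw [inv_add_vecMulVec hB]
  simp only [quadForm, Matrix.sub_mulVec, Matrix.smul_mulVec, dotProduct_sub, dotProduct_smul,
    vecMulVec_mulVec_self, smul_eq_mul, dotProduct_comm (B⁻¹ *ᵥ x) y]
  ring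

theorem det_add_vecMulVec {B : Matrix (Fin d) (Fin d) ℝ} (hB : B.PosDef) (x : Fin d → ℝ) :
    (B + Matrix.vecMulVec x x).det = B.det * (1 + quadForm B⁻¹ x) := by
  have hu : IsUnit B.det := hB.det_pos.ne'.isUnit
  rw [Matrix.vecMulVec_eq Unit, Matrix.det_add_replicateCol_mul_replicateRow hu, quadForm]
  congr 2
  simp [Matrix.mul_apply, Matrix.mulVec, dotProduct, Finset.mul_sum, Finset.sum_mul]
  rw [Finset.sum_comm]
  simp [mul_assoc]

end LinearAlgebra

/-! ### Regularised Gram matrices and the elliptical potential. -/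

section Gram

variable {d : ℕ}

/-- The regularised Gram matrix `1 + ∑_{τ = 1}^n x_τ x_τᵀ`. -/
def gram (x : ℕ → Fin d → ℝ) : ℕ → Matrix (Fin d) (Fin d) ℝ
  | 0 => 1
  | n + 1 => gram x n + Matrix.vecMulVec (x (n + 1)) (x (n + 1))

theorem posDef_gram (x : ℕ → Fin d → ℝ) (n : ℕ) : (gram x n).PosDef := by
  induction n with
  | zero => exact Matrix.PosDef.one
  | succ n ih => exact ih.add_posSemidef (posSemidef_vecMulVec _)

theorem posSemidef_gram_inv (x : ℕ → Fin d → ℝ) (n : ℕ) : (gram x n)⁻¹.PosSemidef :=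
  (posDef_gram x n).inv.posSemidef

theorem quadForm_gram (x : ℕ → Fin d → ℝ) (n : ℕ) (y : Fin d → ℝ) :
    quadForm (gram x n) y = y ⬝ᵥ y + ∑ τ ∈ Finset.Icc 1 n, (x τ ⬝ᵥ y) ^ 2 := by
  induction n with
  | zero => simp [gram, quadForm]
  | succ n ih =>
    rw [gram, quadForm_add_vecMulVec, ih, Finset.sum_Icc_succ_top (by omega), add_assoc]

theorem gram_mulVec (x : ℕ → Fin d → ℝ) (n : ℕ) (y : Fin d → ℝ) :
    gram x n *ᵥ y = y + ∑ τ ∈ Finset.Icc 1 n, (x τ ⬝ᵥ y) • x τ := by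
  induction n with
  | zero => simp [gram]
  | succ n ih =>
    rw [gram, Matrix.add_mulVec, ih, vecMulVec_mulVec_self, Finset.sum_Icc_succ_top (by omega),
      add_assoc]

theorem det_gram_succ (x : ℕ → Fin d → ℝ) (n : ℕ) :
    (gram x (n + 1)).det = (gram x n).det * (1 + quadForm (gram x n)⁻¹ (x (n + 1))) :=
  det_add_vecMulVec (posDef_gram x n) _

theorem det_gram_pos (x : ℕ → Fin d → ℝ) (n : ℕ) : 0 < (gram x n).det := (posDef_gram x n).det_pos

theorem det_gram_zero (x : ℕ → Fin d → ℝ) : (gram x 0).det = 1 := by simp [gram]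

theorem det_gram_le_succ (x : ℕ → Fin d → ℝ) (n : ℕ) :
    (gram x n).det ≤ (gram x (n + 1)).det := by
  rw [det_gram_succ]
  have := quadForm_nonneg (posSemidef_gram_inv x n) (x (n + 1))
  nlinarith [det_gram_pos x n]

theorem one_le_det_gram (x : ℕ → Fin d → ℝ) (n : ℕ) : 1 ≤ (gram x n).det := by
  have := monotone_nat_of_le_succ (det_gram_le_succ x) (Nat.zero_le n)
  rwa [det_gram_zero] at this

theorem quadForm_gram_inv_succ_le (x : ℕ → Fin d → ℝ) (n : ℕ) (y : Fin d → ℝ) :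
    quadForm (gram x (n + 1))⁻¹ y ≤ quadForm (gram x n)⁻¹ y := by
  rw [gram, quadForm_inv_add_vecMulVec (posDef_gram x n)]
  have := one_add_quadForm_inv_pos (posDef_gram x n) (x (n + 1))
  have : 0 ≤ (y ⬝ᵥ ((gram x n)⁻¹ *ᵥ x (n + 1))) ^ 2 / (1 + quadForm (gram x n)⁻¹ (x (n + 1))) := by
    positivity
  linarith

theorem quadForm_gram_inv_le (x : ℕ → Fin d → ℝ) (n : ℕ) (y : Fin d → ℝ) :
    quadForm (gram x n)⁻¹ y ≤ y ⬝ᵥ y := by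
  have := antitone_nat_of_succ_le (f := fun n => quadForm (gram x n)⁻¹ y)
    (fun n => quadForm_gram_inv_succ_le x n y) (Nat.zero_le n)
  simpa [gram, quadForm] using this

/-- `det(Λ) ‖y‖²_{Λ⁻¹}` does not decrease under rank-one updates of `Λ`. -/
theorem det_mul_quadForm_le_succ (x : ℕ → Fin d → ℝ) (y : Fin d → ℝ) (n : ℕ) :
    (gram x n).det * quadForm (gram x n)⁻¹ y ≤
      (gram x (n + 1)).det * quadForm (gram x (n + 1))⁻¹ y := by
  have h := one_add_quadForm_inv_pos (posDef_gram x n) (x (n + 1))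
  have hc := sq_dotProduct_mulVec_le (posSemidef_gram_inv x n) y (x (n + 1))
  -- After division by `det Λ` and with `q = ‖x‖²_{Λ⁻¹}`, the claim is `Y ≤ (1 + q) Y - (yᵀΛ⁻¹x)²`,
  -- where `Y = ‖y‖²_{Λ⁻¹}`: this is Cauchy-Schwarz.
  rw [det_gram_succ, gram, quadForm_inv_add_vecMulVec (posDef_gram x n), mul_assoc]
  refine mul_le_mul_of_nonneg_left ?_ (det_gram_pos x n).le
  rw [mul_sub, mul_div_cancel₀ _ h.ne']
  nlinarith

theorem det_mul_quadForm_mono (x : ℕ → Fin d → ℝ) (y : Fin d → ℝ) {m n : ℕ} (h : m ≤ n) :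
    (gram x m).det * quadForm (gram x m)⁻¹ y ≤ (gram x n).det * quadForm (gram x n)⁻¹ y :=
  monotone_nat_of_le_succ (det_mul_quadForm_le_succ x y) h

/-- Within an episode the bonus uses the matrix from its beginning; the doubling rule makes this
cost only a factor `2` compared with the current matrix. -/
theorem quadForm_inv_le_two_mul {x : ℕ → Fin d → ℝ} {m n : ℕ} (h : m ≤ n)
    (hdet : (gram x n).det ≤ 2 * (gram x m).det) (y : Fin d → ℝ) :
    quadForm (gram x m)⁻¹ y ≤ 2 * quadForm (gram x n)⁻¹ y := by
  have h1 := det_mul_quadForm_mono x y h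
  have h2 := mul_le_mul_of_nonneg_right hdet (quadForm_nonneg (posSemidef_gram_inv x n) y)
  have h3 := det_gram_pos x m
  nlinarith

/-- The monotone quantity `det(Λ) ‖x‖²_{Λ⁻¹}` equals `x · x` at time `0`, and it is exactly the
increment of the determinant. -/
theorem dotProduct_self_le_det_gram_sub (x : ℕ → Fin d → ℝ) (n : ℕ) :
    (gram x n).det + x (n + 1) ⬝ᵥ x (n + 1) ≤ (gram x (n + 1)).det := by
  have := det_mul_quadForm_mono x (x (n + 1)) (Nat.zero_le n)
  rw [det_gram_zero, one_mul] at this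
  have h0 : quadForm (gram x 0)⁻¹ (x (n + 1)) = x (n + 1) ⬝ᵥ x (n + 1) := by simp [gram, quadForm]
  rw [h0] at this
  rw [det_gram_succ, mul_add, mul_one]
  linarith

theorem one_add_mul_le_det_gram {x : ℕ → Fin d → ℝ} {c : ℝ} (n : ℕ)
    (hc : ∀ τ, 1 ≤ τ → τ ≤ n → c ≤ x τ ⬝ᵥ x τ) : 1 + n * c ≤ (gram x n).det := by
  induction n with
  | zero => simp [gram]
  | succ n ih =>
    have h1 := ih fun τ h1 h2 => hc τ h1 (by omega)
    have h2 := dotProduct_self_le_det_gram_sub x n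
    have h3 := hc (n + 1) (by omega) le_rfl
    push_cast
    linarith

/-- Each rank-one term is at most the identity. This bounds the eigenvalues, and later also the
error of rounding a direction to the grid. -/
theorem quadForm_gram_le {x : ℕ → Fin d → ℝ} {n : ℕ}
    (hx : ∀ τ, 1 ≤ τ → τ ≤ n → x τ ⬝ᵥ x τ ≤ 1) (y : Fin d → ℝ) :
    quadForm (gram x n) y ≤ (1 + n) * (y ⬝ᵥ y) := by
  rw [quadForm_gram, add_mul, one_mul]
  gcongr
  calc ∑ τ ∈ Finset.Icc 1 n, (x τ ⬝ᵥ y) ^ 2 ≤ ∑ τ ∈ Finset.Icc 1 n, y ⬝ᵥ y := by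
        refine Finset.sum_le_sum fun τ hτ => ?_
        rw [Finset.mem_Icc] at hτ
        have h1 : (x τ ⬝ᵥ y) ^ 2 ≤ (x τ ⬝ᵥ x τ) * (y ⬝ᵥ y) := by
          simpa [quadForm] using
            sq_dotProduct_mulVec_le (B := (1 : Matrix (Fin d) (Fin d) ℝ)) Matrix.PosSemidef.one
              (x τ) y
        have h2 : 0 ≤ y ⬝ᵥ y := by
          simpa [quadForm] using
            quadForm_nonneg (B := (1 : Matrix (Fin d) (Fin d) ℝ)) Matrix.PosSemidef.one y
        nlinarith [hx τ hτ.1 hτ.2]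
    _ = n * (y ⬝ᵥ y) := by simp

/-- The determinant is the product of `d` eigenvalues, each of them a value of the quadratic form at
a unit eigenvector. -/
theorem det_gram_le {x : ℕ → Fin d → ℝ} {n : ℕ}
    (hx : ∀ τ, 1 ≤ τ → τ ≤ n → x τ ⬝ᵥ x τ ≤ 1) : (gram x n).det ≤ (1 + n : ℝ) ^ d := by
  have hH := (posDef_gram x n).isHermitian
  rw [hH.det_eq_prod_eigenvalues]
  have h : ∀ i, hH.eigenvalues i ≤ 1 + n := by
    intro i
    have h1 := hH.eigenvalues_eq i
    have h2 := quadForm_gram_le hx (hH.eigenvectorBasis i).ofLp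
    have h3 : (hH.eigenvectorBasis i).ofLp ⬝ᵥ (hH.eigenvectorBasis i).ofLp = 1 := by
      have := hH.eigenvectorBasis.orthonormal.1 i
      rw [← sq_eq_sq₀ (norm_nonneg _) zero_le_one, EuclideanSpace.real_norm_sq_eq] at this
      simpa [dotProduct, sq] using this
    rw [h3, mul_one] at h2
    rw [h1]
    simpa [quadForm] using h2
  calc ∏ i, ((hH.eigenvalues i : ℝ) : ℝ) ≤ ∏ _i : Fin d, (1 + n : ℝ) :=
        Finset.prod_le_prod (fun i _ => ((posDef_gram x n).eigenvalues_pos i).le) fun i _ => h i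
    _ = (1 + n : ℝ) ^ d := by simp

theorem half_le_log_one_add {y : ℝ} (h0 : 0 ≤ y) (h1 : y ≤ 1) : y ≤ 2 * Real.log (1 + y) := by
  have := Real.one_sub_inv_le_log_of_pos (show 0 < 1 + y by linarith)
  have h2 : y / 2 ≤ 1 - (1 + y)⁻¹ := by
    have : 1 - (1 + y)⁻¹ = y / (1 + y) := by field_simp; ring
    rw [this]
    exact div_le_div_of_nonneg_left h0 (by linarith) (by linarith)
  linarith

/-- The elliptical potential lemma. -/
theorem sum_quadForm_gram_inv_le {x : ℕ → Fin d → ℝ} {n : ℕ}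
    (hx : ∀ τ, 1 ≤ τ → τ ≤ n → x τ ⬝ᵥ x τ ≤ 1) :
    ∑ τ ∈ Finset.Icc 1 n, quadForm (gram x (τ - 1))⁻¹ (x τ) ≤ 2 * Real.log (gram x n).det := by
  induction n with
  | zero => simp [gram]
  | succ n ih =>
    rw [Finset.sum_Icc_succ_top (by omega), det_gram_succ, Real.log_mul (det_gram_pos x n).ne'
      (one_add_quadForm_inv_pos (posDef_gram x n) _).ne', Nat.add_sub_cancel]
    have h1 := ih fun τ h1 h2 => hx τ h1 (by omega)
    -- The increment of the log-determinant is `log (1 + q)`, and `q ≤ 1` because `Λ ≥ 1` and the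
    -- features have norm at most one.
    have h2 := half_le_log_one_add (quadForm_nonneg (posSemidef_gram_inv x n) (x (n + 1)))
      ((quadForm_gram_inv_le x n _).trans (hx (n + 1) (by omega) le_rfl))
    linarith

end Gram

/-! ## The episodes of the algorithm -/

section Episodes

variable {S A : Type*} {d : ℕ}

/-- The sequence of the features seen along a trajectory. -/
def featureSeq (φ : S → A → EuclideanSpace ℝ (Fin d)) (s : ℕ → S) (a : ℕ → A) (t : ℕ) :
    Fin d → ℝ := (φ (s t) (a t)).ofLp

theorem dotProduct_self_eq_norm_sq (x : EuclideanSpace ℝ (Fin d)) :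
    x.ofLp ⬝ᵥ x.ofLp = ‖x‖ ^ 2 := by
  rw [EuclideanSpace.real_norm_sq_eq]; simp [dotProduct, sq]

theorem featureSeq_dotProduct_le {φ : S → A → EuclideanSpace ℝ (Fin d)}
    (hφ : ∀ x b, ‖φ x b‖ ≤ 1) (s : ℕ → S) (a : ℕ → A) (t : ℕ) :
    featureSeq φ s a t ⬝ᵥ featureSeq φ s a t ≤ 1 := by
  rw [featureSeq, dotProduct_self_eq_norm_sq]
  exact pow_le_one₀ (norm_nonneg _) (hφ _ _)

/-- What is known about the variables of the algorithm at the end of time step `t`. -/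
structure EpisodeInvariant (φ : S → A → EuclideanSpace ℝ (Fin d)) (r : S → A → ℝ) (I : Inputs)
    (T : ℕ) (s : ℕ → S) (a : ℕ → A) (t : ℕ) (σ : LearnerState S A d) : Prop where
  one_le_start : 1 ≤ σ.start
  start_le : σ.start ≤ t + 1
  one_le_episode : 1 ≤ σ.episode
  lamBar_eq : σ.LamBar = gram (featureSeq φ s a) t
  lam_eq : σ.Lam = gram (featureSeq φ s a) (σ.start - 1)
  det_le : (gram (featureSeq φ s a) t).det ≤ 2 * (gram (featureSeq φ s a) (σ.start - 1)).det
  two_pow_le : (2 : ℝ) ^ (σ.episode - 1) ≤ (gram (featureSeq φ s a) (σ.start - 1)).det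
  start_eq_one_iff : σ.start = 1 ↔ σ.episode = 1
  Q_eq_cap : σ.start = 1 → σ.Q = fun _ _ _ => 1 / (1 - I.gamma)
  Q_eq_planned : σ.start ≠ 1 →
    σ.Q = plannedQ φ r I T s a (gram (featureSeq φ s a) (σ.start - 1)) (σ.start - 1)

theorem episodeInvariant (φ : S → A → EuclideanSpace ℝ (Fin d)) (r : S → A → ℝ) {I : Inputs}
    (hI : I.lam = 1) (T : ℕ) (s : ℕ → S) (a : ℕ → A) (t : ℕ) :
    EpisodeInvariant φ r I T s a t (learnerState φ r I T s a t) := by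
  induction t with
  | zero =>
    constructor <;> simp [learnerState, gram, hI]
  | succ t ih =>
    have hL : (learnerState φ r I T s a t).LamBar +
        Matrix.vecMulVec (φ (s (t + 1)) (a (t + 1))).ofLp (φ (s (t + 1)) (a (t + 1))).ofLp =
          gram (featureSeq φ s a) (t + 1) := by rw [ih.lamBar_eq]; rfl
    rw [learnerState]
    simp only [hL]
    have h1 := one_le_det_gram (featureSeq φ s a) (t + 1)
    split_ifs with h
    · rw [ih.lam_eq] at h
      have h2 := ih.two_pow_le
      have h3 := ih.one_le_episode
      constructor <;> simp
      · linarith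
      -- The test that opens an episode supplies one more factor `2`. Writing the index as `e + 1`
      -- removes the truncated subtraction.
      · obtain ⟨e, he⟩ := Nat.exists_eq_add_of_le' h3
        rw [he] at h2 ⊢
        rw [pow_succ]
        simp only [Nat.add_sub_cancel] at h2
        linarith
      · omega
    · rw [ih.lam_eq] at h
      exact ⟨ih.one_le_start, ih.start_le.trans (by omega), ih.one_le_episode, rfl, ih.lam_eq,
        not_lt.1 h, ih.two_pow_le, ih.start_eq_one_iff, ih.Q_eq_cap, ih.Q_eq_planned⟩

/-- The number of episodes is logarithmic. -/
theorem episode_sub_one_le {φ : S → A → EuclideanSpace ℝ (Fin d)} (hφ : ∀ x b, ‖φ x b‖ ≤ 1)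
    (r : S → A → ℝ) {I : Inputs} (hI : I.lam = 1) (T : ℕ) (s : ℕ → S) (a : ℕ → A) (t : ℕ) :
    (((learnerState φ r I T s a t).episode - 1 : ℕ) : ℝ) ≤ d * Real.logb 2 (1 + t) := by
  have ih := episodeInvariant φ r hI T s a t
  -- Each change of episode has at least doubled the determinant, which grows only polynomially.
  have h1 := ih.two_pow_le.trans (det_gram_le (n := (learnerState φ r I T s a t).start - 1)
    fun τ _ _ => featureSeq_dotProduct_le hφ s a τ)
  have h2 : (((learnerState φ r I T s a t).start - 1 : ℕ) : ℝ) ≤ t := by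
    exact_mod_cast Nat.sub_le_iff_le_add.2 ih.start_le
  have h3 : (2 : ℝ) ^ ((learnerState φ r I T s a t).episode - 1) ≤ (1 + t : ℝ) ^ d :=
    h1.trans (by gcongr)
  have h4 := Real.logb_le_logb_of_le (b := 2) one_lt_two (by positivity) h3
  rw [Real.logb_pow, Real.logb_pow, Real.logb_self_eq_one one_lt_two, mul_one] at h4
  exact h4

theorem episode_le_succ (φ : S → A → EuclideanSpace ℝ (Fin d)) (r : S → A → ℝ) (I : Inputs)
    (T : ℕ) (s : ℕ → S) (a : ℕ → A) (t : ℕ) :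
    (learnerState φ r I T s a t).episode ≤ (learnerState φ r I T s a (t + 1)).episode := by
  rw [learnerState]
  dsimp only
  split_ifs <;> simp

/-- For the telescoping sum of planned values: either the plan persists, or the break is paid for by
an increment of the episode index. -/
theorem start_eq_or_episode_lt (φ : S → A → EuclideanSpace ℝ (Fin d)) (r : S → A → ℝ) (I : Inputs)
    (T : ℕ) (s : ℕ → S) (a : ℕ → A) (t : ℕ) :
    (learnerState φ r I T s a (t + 1)).start = (learnerState φ r I T s a t).start ∨
      (learnerState φ r I T s a t).episode + 1 = (learnerState φ r I T s a (t + 1)).episode := by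
  rw [learnerState]
  dsimp only
  split_ifs <;> simp

end Episodes

/-! ## Values and costs of step-counted computations -/

namespace Timed

section Basic

variable {α β : Type}

@[simp] theorem val_bind (p : Timed α) (f : α → Timed β) : (p >>= f).val = (f p.val).val := rfl
@[simp] theorem cost_bind (p : Timed α) (f : α → Timed β) :
    (p >>= f).cost = p.cost + (f p.val).cost := rfl
@[simp] theorem val_pure (x : α) : (pure x : Timed α).val = x := rfl
@[simp] theorem cost_pure (x : α) : (pure x : Timed α).cost = 0 := rfl
@[simp] theorem val_addR (x y : ℝ) : (addR x y).val = x + y := rfl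
@[simp] theorem cost_addR (x y : ℝ) : (addR x y).cost = 1 := rfl
@[simp] theorem val_subR (x y : ℝ) : (subR x y).val = x - y := rfl
@[simp] theorem cost_subR (x y : ℝ) : (subR x y).cost = 1 := rfl
@[simp] theorem val_mulR (x y : ℝ) : (mulR x y).val = x * y := rfl
@[simp] theorem cost_mulR (x y : ℝ) : (mulR x y).cost = 1 := rfl
@[simp] theorem val_divR (x y : ℝ) : (divR x y).val = x / y := rfl
@[simp] theorem cost_divR (x y : ℝ) : (divR x y).cost = 1 := rfl
@[simp] theorem val_minR (x y : ℝ) : (minR x y).val = min x y := rfl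
@[simp] theorem cost_minR (x y : ℝ) : (minR x y).cost = 1 := rfl
@[simp] theorem val_maxR (x y : ℝ) : (maxR x y).val = max x y := rfl
@[simp] theorem cost_maxR (x y : ℝ) : (maxR x y).cost = 1 := rfl
@[simp] theorem val_sqrtR (x : ℝ) : (sqrtR x).val = √x := rfl
@[simp] theorem cost_sqrtR (x : ℝ) : (sqrtR x).cost = 1 := rfl
open Classical in
@[simp] theorem val_ltR (x y : ℝ) : (ltR x y).val = decide (x < y) := rfl
@[simp] theorem cost_ltR (x y : ℝ) : (ltR x y).cost = 1 := rfl
@[simp] theorem cost_tick : tick.cost = 1 := rfl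
@[simp] theorem val_readAt {ι : Type} (v : ι → α) (i : ι) : (readAt v i).val = v i := rfl
@[simp] theorem cost_readAt {ι : Type} (v : ι → α) (i : ι) : (readAt v i).cost = 1 := rfl
@[simp] theorem val_readAt₂ {ι κ : Type} (v : ι → κ → α) (i : ι) (j : κ) :
    (readAt₂ v i j).val = v i j := rfl
@[simp] theorem cost_readAt₂ {ι κ : Type} (v : ι → κ → α) (i : ι) (j : κ) :
    (readAt₂ v i j).cost = 1 := rfl
@[simp] theorem val_readAt₂_matrix {ι κ : Type} (v : Matrix ι κ α) (i : ι) (j : κ) :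
    (readAt₂ v i j).val = v i j := rfl
@[simp] theorem cost_readAt₂_matrix {ι κ : Type} (v : Matrix ι κ α) (i : ι) (j : κ) :
    (readAt₂ v i j).cost = 1 := rfl
@[simp] theorem val_writeAt {ι : Type} [DecidableEq ι] (v : ι → α) (i : ι) (x : α) :
    (writeAt v i x).val = Function.update v i x := rfl
@[simp] theorem cost_writeAt {ι : Type} [DecidableEq ι] (v : ι → α) (i : ι) (x : α) :
    (writeAt v i x).cost = 1 := rfl
@[simp] theorem val_tabulate (n : ℕ) (f : Fin n → Timed α) :
    (tabulate n f).val = fun i => (f i).val := rfl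
theorem cost_tabulate (n : ℕ) (f : Fin n → Timed α) :
    (tabulate n f).cost = ∑ i, ((f i).cost + 1) := rfl

theorem cost_tabulate_le {n : ℕ} {f : Fin n → Timed α} {c : ℕ} (h : ∀ i, (f i).cost ≤ c) :
    (tabulate n f).cost ≤ n * (c + 1) := by
  rw [cost_tabulate]
  calc ∑ i, ((f i).cost + 1) ≤ ∑ _i : Fin n, (c + 1) :=
        Finset.sum_le_sum fun i _ => by have := h i; omega
    _ = n * (c + 1) := by simp

end Basic

/-! ### Loops, extrema and inner products. -/

section Loops

variable {ι σ : Type}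

theorem val_loop (l : List ι) (x : σ) (body : σ → ι → Timed σ) :
    (loop l x body).val = l.foldl (fun x i => (body x i).val) x := by
  induction l generalizing x with
  | nil => rfl
  | cons i l ih => exact ih _

theorem loop_append (l l' : List ι) (x : σ) (body : σ → ι → Timed σ) :
    (loop (l ++ l') x body).val = (loop l' (loop l x body).val body).val ∧
    (loop (l ++ l') x body).cost =
      (loop l x body).cost + (loop l' (loop l x body).val body).cost := by
  induction l generalizing x with
  | nil => simp [loop]
  | cons i l ih =>
    refine ⟨(ih _).1, ?_⟩
    simp only [List.cons_append, loop, cost_bind, val_bind, (ih _).2]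
    omega

theorem cost_loop_singleton (i : ι) (x : σ) (body : σ → ι → Timed σ) :
    (loop [i] x body).cost = 1 + (body x i).cost := by
  simp [loop]

theorem val_loop_singleton (i : ι) (x : σ) (body : σ → ι → Timed σ) :
    (loop [i] x body).val = (body x i).val := by
  simp [loop]

/-- The cost of the body is assumed bounded for every value of the loop variable, so no loop
invariant is needed. -/
theorem cost_loop_le {l : List ι} {x : σ} {body : σ → ι → Timed σ} {c : ℕ}
    (h : ∀ x i, (body x i).cost ≤ c) : (loop l x body).cost ≤ l.length * (c + 1) := by
  induction l generalizing x with
  | nil => simp [loop]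
  | cons i l ih =>
    simp only [loop, cost_bind, cost_tick, List.length_cons]
    have h1 := h x i
    have h2 := ih (x := (body x i).val)
    nlinarith

theorem val_sumLoop (l : List ι) (f : ι → Timed ℝ) :
    (sumLoop l f).val = (l.map fun i => (f i).val).sum := by
  rw [sumLoop, val_loop]
  simp only [val_bind, val_addR]
  rw [List.sum_eq_foldl, List.foldl_map]

theorem cost_sumLoop_le {l : List ι} {f : ι → Timed ℝ} {c : ℕ} (h : ∀ i, (f i).cost ≤ c) :
    (sumLoop l f).cost ≤ l.length * (c + 2) := by
  refine cost_loop_le (c := c + 1) fun x i => ?_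
  have := h i
  simpa using this

theorem foldl_max_eq {n : ℕ} (v : Fin n → ℝ) (l : List (Fin n)) (x : ℝ) :
    IsGreatest ({x} ∪ {y | ∃ i ∈ l, v i = y}) (l.foldl (fun acc i => max acc (v i)) x) := by
  induction l generalizing x with
  | nil => simp
  | cons i l ih =>
    obtain ⟨h1, h2⟩ := ih (max x (v i))
    simp only [List.foldl_cons]
    refine ⟨?_, ?_⟩
    · rcases h1 with h1 | ⟨j, hj, h1⟩
      · rw [Set.mem_singleton_iff.1 h1]
        rcases max_choice x (v i) with h | h <;> rw [h]
        · exact Or.inl rfl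
        · exact Or.inr ⟨i, by simp, rfl⟩
      · exact Or.inr ⟨j, by simp [hj], h1⟩
    · have hx := h2 (Or.inl rfl)
      rintro y (rfl | ⟨j, hj, rfl⟩)
      · exact (le_max_left _ _).trans hx
      · rcases List.mem_cons.1 hj with rfl | hj
        · exact (le_max_right _ _).trans hx
        · exact h2 (Or.inr ⟨j, hj, rfl⟩)

theorem val_maxLoop {n : ℕ} [NeZero n] (v : Fin n → ℝ) : (maxLoop v).val = ⨆ i, v i := by
  rw [maxLoop, val_bind, val_loop]
  simp only [val_bind, val_maxR, val_readAt]
  obtain ⟨h1, h2⟩ := foldl_max_eq v (List.finRange n) (v 0)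
  apply le_antisymm
  · rcases h1 with h1 | ⟨j, -, h1⟩
    · rw [Set.mem_singleton_iff.1 h1]; exact le_ciSup (Set.finite_range v).bddAbove 0
    · rw [← h1]; exact le_ciSup (Set.finite_range v).bddAbove j
  · exact ciSup_le fun i => h2 (Or.inr ⟨i, by simp, rfl⟩)

theorem foldl_min_eq_neg_foldl_max {n : ℕ} (v : Fin n → ℝ) (l : List (Fin n)) (x : ℝ) :
    l.foldl (fun acc i => min acc (v i)) x
      = -l.foldl (fun acc i => max acc (-v i)) (-x) := by
  induction l generalizing x with
  | nil => simp
  | cons i l ih => simp only [List.foldl_cons, ih, max_neg_neg]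

theorem val_minLoop {n : ℕ} [NeZero n] (v : Fin n → ℝ) : (minLoop v).val = ⨅ i, v i := by
  have h := val_maxLoop fun i => -v i
  rw [maxLoop, val_bind, val_loop] at h
  simp only [val_bind, val_maxR, val_readAt] at h
  rw [minLoop, val_bind, val_loop]
  simp only [val_bind, val_minR, val_readAt]
  -- The infimum of a set of reals is by definition minus the supremum of the negated set, so the
  -- minimum reduces to the maximum of the negated array.
  rw [foldl_min_eq_neg_foldl_max, h, iInf, Real.sInf_def, iSup]
  congr 2
  ext y
  simp [neg_eq_iff_eq_neg]

theorem cost_maxLoop_le {n : ℕ} [NeZero n] (v : Fin n → ℝ) : (maxLoop v).cost ≤ 1 + n * 3 := by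
  have := cost_loop_le (l := List.finRange n) (x := v 0) (c := 2) (body := fun acc i => do
    let y ← readAt v i
    maxR acc y) (by simp)
  simpa [maxLoop] using this

theorem cost_minLoop_le {n : ℕ} [NeZero n] (v : Fin n → ℝ) : (minLoop v).cost ≤ 1 + n * 3 := by
  have := cost_loop_le (l := List.finRange n) (x := v 0) (c := 2) (body := fun acc i => do
    let y ← readAt v i
    minR acc y) (by simp)
  simpa [minLoop] using this

theorem le_val_argmaxLoop {n : ℕ} [NeZero n] (v : Fin n → ℝ) (i : Fin n) :
    v i ≤ v (argmaxLoop v).val := by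
  rw [argmaxLoop, val_loop]
  simp only [val_bind, val_ltR, val_readAt, val_pure]
  -- The induction needs an arbitrary current candidate `b`: the final index beats both `b` and all
  -- entries still to be visited.
  have h : ∀ (l : List (Fin n)) (b : Fin n), ∀ j, (j = b ∨ j ∈ l) →
      v j ≤ v (l.foldl (fun x i => if decide (v x < v i) then i else x) b) := by
    intro l
    induction l with
    | nil => simp
    | cons k l ih =>
      intro b j hj
      simp only [List.foldl_cons]
      have key : v j ≤ v (if decide (v b < v k) = true then k else b) ∨ j ∈ l := by
        rcases hj with rfl | hj
        · left; split_ifs with h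
          · simpa using (of_decide_eq_true h).le
          · exact le_rfl
        · rcases List.mem_cons.1 hj with rfl | hj
          · left; split_ifs with h
            · exact le_rfl
            · simpa using h
          · exact Or.inr hj
      rcases key with key | key
      · exact key.trans (ih _ _ (Or.inl rfl))
      · exact ih _ _ (Or.inr key)
  exact h _ _ i (Or.inr (by simp))

theorem cost_argmaxLoop_le {n : ℕ} [NeZero n] (v : Fin n → ℝ) :
    (argmaxLoop v).cost ≤ n * 4 := by
  have := cost_loop_le (l := List.finRange n) (x := (0 : Fin n)) (c := 3) (body := fun best i => do
    let x ← readAt v best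
    let y ← readAt v i
    let c ← ltR x y
    pure (if c then i else best)) (by simp)
  simpa [argmaxLoop] using this

theorem val_dotT {d : ℕ} (x y : Fin d → ℝ) : (dotT x y).val = x ⬝ᵥ y := by
  rw [dotT, val_sumLoop]
  simp [dotProduct, List.sum_ofFn, ← List.ofFn_eq_map]

theorem cost_dotT_le {d : ℕ} (x y : Fin d → ℝ) : (dotT x y).cost ≤ 5 * d := by
  have := cost_sumLoop_le (l := List.finRange d) (c := 3) (f := fun i => do
    let a ← readAt x i
    let b ← readAt y i
    mulR a b) (by simp)
  rw [List.length_finRange] at this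
  rw [dotT]
  linarith

theorem val_mulVecT {d : ℕ} (B : Matrix (Fin d) (Fin d) ℝ) (x : Fin d → ℝ) :
    (mulVecT B x).val = B *ᵥ x := by
  ext i
  simp [mulVecT, val_dotT, Matrix.mulVec]

theorem cost_mulVecT_le {d : ℕ} (B : Matrix (Fin d) (Fin d) ℝ) (x : Fin d → ℝ) :
    (mulVecT B x).cost ≤ d * (5 * d + 1) :=
  cost_tabulate_le fun i => cost_dotT_le (B i) x

end Loops

end Timed

/-! ## Dependence of the algorithm on the past only -/

section Congr

variable {S A : Type*} {d : ℕ}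

theorem regressionWeight_congr (φ : S → A → EuclideanSpace ℝ (Fin d)) (s : ℕ → S) {a a' : ℕ → A}
    (Lam : Matrix (Fin d) (Fin d) ℝ) {n : ℕ} (h : ∀ τ, 1 ≤ τ → τ ≤ n → a τ = a' τ)
    (V : ValuePair S) :
    regressionWeight φ s a Lam n V = regressionWeight φ s a' Lam n V := by
  rw [regressionWeight, regressionWeight]
  congr 1
  refine Finset.sum_congr rfl fun τ hτ => ?_
  rw [Finset.mem_Icc] at hτ
  rw [h τ hτ.1 hτ.2]

theorem valueIteration_congr (φ : S → A → EuclideanSpace ℝ (Fin d)) (r : S → A → ℝ) (I : Inputs)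
    (s : ℕ → S) {a a' : ℕ → A} (Lam : Matrix (Fin d) (Fin d) ℝ) {n : ℕ}
    (h : ∀ τ, 1 ≤ τ → τ ≤ n → a τ = a' τ) (j : ℕ) :
    valueIteration φ r I s a Lam n j = valueIteration φ r I s a' Lam n j := by
  induction j with
  | zero => rfl
  | succ j ih =>
    rw [valueIteration, valueIteration, ih]
    unfold qBackup
    rw [regressionWeight_congr φ s Lam h]

theorem plannedQ_congr (φ : S → A → EuclideanSpace ℝ (Fin d)) (r : S → A → ℝ) (I : Inputs) (T : ℕ)
    (s : ℕ → S) {a a' : ℕ → A} (Lam : Matrix (Fin d) (Fin d) ℝ) {n : ℕ}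
    (h : ∀ τ, 1 ≤ τ → τ ≤ n → a τ = a' τ) :
    plannedQ φ r I T s a Lam n = plannedQ φ r I T s a' Lam n := by
  funext u
  rw [plannedQ, plannedQ, valueIteration_congr φ r I s Lam h]
  unfold qBackup
  rw [regressionWeight_congr φ s Lam h]

/-- The algorithm is specified on a whole action sequence, while the program builds this sequence
step by step. Entries not yet chosen must be irrelevant for the two to be compared. -/
theorem learnerState_congr (φ : S → A → EuclideanSpace ℝ (Fin d)) (r : S → A → ℝ) (I : Inputs)
    (T : ℕ) (s : ℕ → S) {a a' : ℕ → A} {t : ℕ} (h : ∀ τ, 1 ≤ τ → τ ≤ t → a τ = a' τ) :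
    learnerState φ r I T s a t = learnerState φ r I T s a' t := by
  induction t with
  | zero => rfl
  | succ t ih =>
    rw [learnerState, learnerState, ih fun τ h1 h2 => h τ h1 (by omega),
      h (t + 1) (by omega) le_rfl, plannedQ_congr φ r I T s _ h]

end Congr

/-! ## The program computes the algorithm, in polynomial time -/

section Implementation

open Timed

variable {d nS nA : ℕ} [NeZero nS] [NeZero nA]
variable (φ : Fin nS → Fin nA → EuclideanSpace ℝ (Fin d)) (r : Fin nS → Fin nA → ℝ) (I : Inputs)
variable (T : ℕ) (s : ℕ → Fin nS) (a : ℕ → Fin nA)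

omit [NeZero nS] [NeZero nA] in
theorem val_fetchFeature (x : Fin nS) (b : Fin nA) :
    (fetchFeature φ x b).val = (φ x b).ofLp := rfl

omit [NeZero nS] [NeZero nA] in
theorem cost_fetchFeature_le (x : Fin nS) (b : Fin nA) : (fetchFeature φ x b).cost ≤ d * 2 :=
  cost_tabulate_le fun _ => le_rfl

omit [NeZero nS] [NeZero nA] in
theorem sum_map_range_succ (n : ℕ) (f : ℕ → ℝ) :
    (((List.range n).map (· + 1)).map f).sum = ∑ τ ∈ Finset.Icc 1 n, f τ := by
  induction n with
  | zero => simp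
  | succ n ih => simpa [List.range_succ, Finset.sum_Icc_succ_top] using ih

omit [NeZero nS] [NeZero nA] in
theorem val_weightT (lamInv : Matrix (Fin d) (Fin d) ℝ) (Lam : Matrix (Fin d) (Fin d) ℝ)
    (hL : lamInv = Lam⁻¹) (n : ℕ) (V : ValuePair (Fin nS)) :
    (weightT φ s a lamInv n (⨅ x, V.tilde x) V.clipped).val = regressionWeight φ s a Lam n V := by
  rw [weightT, val_bind, val_mulVecT, regressionWeight, hL]
  congr 1
  ext i
  rw [val_tabulate]
  beta_reduce
  rw [val_sumLoop, sum_map_range_succ]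
  simp

omit [NeZero nS] [NeZero nA] in
theorem cost_weightT_le (lamInv : Matrix (Fin d) (Fin d) ℝ) (n : ℕ) (m : ℝ) (V : Fin nS → ℝ) :
    (weightT φ s a lamInv n m V).cost ≤ d * (9 * n + 1) + d * (5 * d + 1) := by
  rw [weightT, cost_bind]
  refine add_le_add (cost_tabulate_le fun i => ?_) (cost_mulVecT_le _ _)
  refine (cost_sumLoop_le (c := 7) fun τ => by simp).trans ?_
  simp [mul_comm]

omit [NeZero nS] [NeZero nA] in
theorem val_qEntryT (Lam : Matrix (Fin d) (Fin d) ℝ) (w : Fin d → ℝ) (m cap : ℝ)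
    (x : Fin nS) (b : Fin nA) :
    (qEntryT φ r I cap Lam w m x b).val =
      min (r x b + I.gamma * ((φ x b).ofLp ⬝ᵥ w + m + I.beta * weightedNorm Lam (φ x b))) cap := by
  simp [qEntryT, val_dotT, val_mulVecT, val_fetchFeature, weightedNorm]

omit [NeZero nS] [NeZero nA] in
theorem cost_qEntryT_le (Lam : Matrix (Fin d) (Fin d) ℝ) (w : Fin d → ℝ) (m cap : ℝ)
    (x : Fin nS) (b : Fin nA) :
    (qEntryT φ r I cap Lam w m x b).cost ≤ 5 * d * d + 13 * d + 8 := by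
  have h1 := cost_fetchFeature_le φ x b
  have h2 := cost_dotT_le (fetchFeature φ x b).val w
  have h3 := cost_mulVecT_le Lam (fetchFeature φ x b).val
  have h4 := cost_dotT_le (fetchFeature φ x b).val (mulVecT Lam (fetchFeature φ x b).val).val
  simp only [qEntryT, cost_bind, cost_sqrtR, cost_mulR, cost_addR, cost_readAt₂, cost_minR]
  nlinarith

/-- The contents of the planning memory when `V` has been computed. -/
def PlanMemory.Represents (m : PlanMemory nS nA) (V : ValuePair (Fin nS)) : Prop :=
  m.minV = ⨅ x, V.tilde x ∧ m.V = V.clipped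

theorem planStepT_val (Lam : Matrix (Fin d) (Fin d) ℝ) (n : ℕ) (m : PlanMemory nS nA) (u : ℕ)
    (V : ValuePair (Fin nS)) (hm : m.Represents V) :
    (planStepT φ r I (1 / (1 - I.gamma)) s a Lam⁻¹ n m u).val.Represents
        (clippedValues I.H (qBackup φ r I s a Lam n V)) ∧
      (planStepT φ r I (1 / (1 - I.gamma)) s a Lam⁻¹ n m u).val.Q =
        Function.update m.Q u (qBackup φ r I s a Lam n V) := by
  obtain ⟨h1, h2⟩ := hm
  have hQ : ∀ x b, (qEntryT φ r I (1 / (1 - I.gamma)) Lam⁻¹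
      (weightT φ s a Lam⁻¹ n m.minV m.V).val m.minV x b).val = qBackup φ r I s a Lam n V x b := by
    intro x b
    rw [val_qEntryT, h1, h2, val_weightT φ s a _ Lam rfl, qBackup]
  simp only [planStepT, PlanMemory.Represents, val_bind, val_tabulate, val_writeAt, val_minLoop,
    val_maxLoop, val_addR, val_pure, hQ, clippedValues, val_readAt, val_minR]
  simp

theorem cost_planStepT_le (hd : 1 ≤ d) (hT : 1 ≤ T) (Lam : Matrix (Fin d) (Fin d) ℝ) {n : ℕ}
    (hn : n ≤ T) (m : PlanMemory nS nA) (u : ℕ) (cap : ℝ) :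
    (planStepT φ r I cap s a Lam n m u).cost ≤ 64 * (d * d * nS * nA * T) := by
  have hS : 1 ≤ nS := NeZero.one_le
  have hA : 1 ≤ nA := NeZero.one_le
  simp only [planStepT, cost_bind, cost_writeAt, cost_addR, cost_pure]
  have h1 := cost_weightT_le φ s a Lam n m.minV m.V
  -- Intermediate results are abstracted, because only their costs matter. At the end each summand
  -- is absorbed into the monomial `d² nS nA T`, all of whose factors are at least one.
  generalize weightT φ s a Lam n m.minV m.V = W at h1 ⊢
  have h2 : (tabulate nS fun x => tabulate nA fun b =>
      qEntryT φ r I cap Lam W.val m.minV x b).cost ≤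
        nS * (nA * (5 * d * d + 13 * d + 8 + 1) + 1) :=
    cost_tabulate_le fun x => cost_tabulate_le fun b => cost_qEntryT_le _ _ _ _ _ _ _ _ _
  generalize (tabulate nS fun x => tabulate nA fun b =>
      qEntryT φ r I cap Lam W.val m.minV x b) = Qu at h2 ⊢
  have h3 : (tabulate nS fun x => maxLoop (Qu.val x)).cost ≤ nS * (1 + nA * 3 + 1) :=
    cost_tabulate_le fun x => cost_maxLoop_le _
  generalize (tabulate nS fun x => maxLoop (Qu.val x)) = M at h3 ⊢
  have h4 := cost_minLoop_le M.val
  generalize minLoop M.val = N at h4 ⊢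
  have h5 : (tabulate nS fun x => do
      let y ← readAt M.val x
      minR y (addR N.val I.H).val).cost ≤ nS * (2 + 1) :=
    cost_tabulate_le fun x => by simp
  have e0 : d * d * nS * nA ≤ d * d * nS * nA * T := Nat.le_mul_of_pos_right _ hT
  have e1 : nS ≤ nS * nA := Nat.le_mul_of_pos_right _ hA
  have e2 : nS * nA ≤ d * (nS * nA) := Nat.le_mul_of_pos_left _ hd
  have e3 : d * (nS * nA) ≤ d * (d * (nS * nA)) := Nat.le_mul_of_pos_left _ hd
  have e4 : d * T ≤ d * T * (d * nS * nA) :=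
    Nat.le_mul_of_pos_right _ (by positivity)
  have e5 : d * d ≤ d * d * (nS * nA) := Nat.le_mul_of_pos_right _ (by positivity)
  have e6 : d ≤ d * d := Nat.le_mul_of_pos_right _ hd
  have e7 : d * n ≤ d * T := Nat.mul_le_mul_left _ hn
  have e8 : 1 ≤ nS := hS
  nlinarith

/-- The value iterations fill in the table of the action value functions. -/
theorem planT_loop (Lam : Matrix (Fin d) (Fin d) ℝ) (n : ℕ) (m₀ : PlanMemory nS nA)
    (hm : m₀.Represents (valueIteration φ r I s a Lam n 0)) (j : ℕ) (hj : j ≤ T) :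
    let m := (loop ((List.range j).map (T - ·)) m₀
      (planStepT φ r I (1 / (1 - I.gamma)) s a Lam⁻¹ n)).val
    m.Represents (valueIteration φ r I s a Lam n j) ∧
      ∀ u, T < u + j → u ≤ T → m.Q u = plannedQ φ r I T s a Lam n u := by
  induction j with
  | zero => exact ⟨hm, fun u h1 h2 => by omega⟩
  | succ j ih =>
    obtain ⟨h1, h2⟩ := ih (by omega)
    dsimp only at h1 h2 ⊢
    rw [List.range_succ, List.map_append, List.map_singleton, (loop_append _ _ _ _).1,
      val_loop_singleton]
    obtain ⟨h3, h4⟩ := planStepT_val φ r I s a Lam n _ (T - j) _ h1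
    refine ⟨h3, fun u hu hu' => ?_⟩
    rw [h4]
    -- Round `j` writes the entry `T - j`; the larger entries were written before and stay.
    by_cases hju : u = T - j
    · subst hju
      rw [Function.update_self, plannedQ, show T - (T - j) = j by omega]
    · rw [Function.update_of_ne hju]
      exact h2 u (by omega) hu'

/-- Entries with `u ≤ n` keep their old content, which is harmless since those time steps are over.
-/
theorem val_planT (Lam : Matrix (Fin d) (Fin d) ℝ) (n : ℕ) (Q : ℕ → Fin nS → Fin nA → ℝ)
    (u : ℕ) (h1 : n < u) (h2 : u ≤ T) :
    (planT φ r I T s a Lam⁻¹ n Q).val u = plannedQ φ r I T s a Lam n u := by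
  simp only [planT, val_bind, val_subR, val_divR, val_tabulate, val_pure]
  refine (planT_loop φ r I T s a Lam n _ ⟨?_, rfl⟩ (T - n) (by omega)).2 u (by omega) h2
  simp [valueIteration]

theorem cost_planT_le (hd : 1 ≤ d) (hT : 1 ≤ T) (Lam : Matrix (Fin d) (Fin d) ℝ) {n : ℕ}
    (hn : n ≤ T) (Q : ℕ → Fin nS → Fin nA → ℝ) :
    (planT φ r I T s a Lam n Q).cost ≤ 68 * (d * d * nS * nA * T * T) := by
  have hS : 1 ≤ nS := NeZero.one_le
  have hA : 1 ≤ nA := NeZero.one_le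
  simp only [planT, cost_bind, cost_subR, cost_divR, cost_pure, val_subR, val_divR]
  have h1 : (tabulate nS fun _ => (pure (1 / (1 - I.gamma)) : Timed ℝ)).cost ≤ nS * (0 + 1) :=
    cost_tabulate_le fun _ => le_rfl
  have h2 := cost_loop_le (l := (List.range (T - n)).map (T - ·))
    (x := (⟨1 / (1 - I.gamma), (tabulate nS fun _ => (pure (1 / (1 - I.gamma)) : Timed ℝ)).val, Q⟩ :
      PlanMemory nS nA))
    (fun m u => cost_planStepT_le φ r I T s a hd hT Lam hn m u (1 / (1 - I.gamma)))
  rw [List.length_map, List.length_range] at h2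
  have h3 := h2.trans (Nat.mul_le_mul_right _ (Nat.sub_le T n))
  have e1 : nS ≤ nS * (d * d * nA * T * T) := Nat.le_mul_of_pos_right _ (by positivity)
  have e2 : T ≤ T * (d * d * nS * nA * T) := Nat.le_mul_of_pos_right _ (by positivity)
  nlinarith

/-- The contents of the memory at the end of time step `t`. -/
structure Memory.Represents (m : Memory d nS nA) (t : ℕ) : Prop where
  lamInv : m.lamInv = (learnerState φ r I T s m.acts t).Lam⁻¹
  detLam : m.detLam = (learnerState φ r I T s m.acts t).Lam.det
  lamBarInv : m.lamBarInv = (learnerState φ r I T s m.acts t).LamBar⁻¹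
  detLamBar : m.detLamBar = (learnerState φ r I T s m.acts t).LamBar.det
  Q : ∀ u, t < u → u ≤ T → m.Q u = (learnerState φ r I T s m.acts t).Q u
  follows : ∀ τ, 1 ≤ τ → τ ≤ t → ∀ b, (learnerState φ r I T s m.acts (τ - 1)).Q τ (s τ) b ≤
    (learnerState φ r I T s m.acts (τ - 1)).Q τ (s τ) (m.acts τ)

theorem foldl_update_eq {α : Type} (f : α) (g : ℕ → α) (n : ℕ) (u : ℕ) (h1 : 1 ≤ u) (h2 : u ≤ n) :
    ((List.range n).map (· + 1)).foldl (fun tab i => Function.update tab i f) g u = f := by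
  induction n with
  | zero => omega
  | succ n ih =>
    rw [List.range_succ, List.map_append, List.foldl_append]
    simp only [List.map_cons, List.map_nil, List.foldl_cons, List.foldl_nil]
    by_cases h : u = n + 1
    · subst h; simp
    · rw [Function.update_of_ne h]
      exact ih (by omega)

omit [NeZero nS] in
theorem initT_represents (hI : I.lam = 1) :
    ((initT I T : Timed (Memory d nS nA)).val).Represents φ r I T s 0 := by
  have hB : (fun i j : Fin d => (if i = j then (1 : ℝ) else 0)) = (1 : Matrix (Fin d) (Fin d) ℝ) := by
    ext i j; simp [Matrix.one_apply]
  have hD : ∀ l : List (Fin d), l.foldl (fun (x : ℝ) _ => x) 1 = 1 := by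
    intro l; induction l with
    | nil => rfl
    | cons i l ih => simp [ih]
  constructor
  · simp [initT, learnerState, hI, hB]
  · simp [initT, learnerState, hI, val_loop, hD]
  · simp [initT, learnerState, hI, hB]
  · simp [initT, learnerState, hI, val_loop, hD]
  · intro u h1 h2
    simp only [initT, learnerState, val_bind, val_pure, val_loop, val_writeAt, val_tabulate]
    rw [foldl_update_eq _ _ T u (by omega) h2]
    simp
  · intro τ h1 h2
    omega

theorem cost_initT_le (hd : 1 ≤ d) (hT : 1 ≤ T) :
    (initT I T : Timed (Memory d nS nA)).cost ≤ 12 * (d * d * nS * nA * T) := by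
  have hS : 1 ≤ nS := NeZero.one_le
  have hA : 1 ≤ nA := NeZero.one_le
  simp only [initT, cost_bind, cost_pure, cost_subR, cost_divR]
  have h1 : (tabulate d fun i => tabulate d fun j => do
      tick
      pure (if i = j then (divR 1 I.lam).val else 0)).cost ≤ d * (d * (1 + 1) + 1) :=
    cost_tabulate_le fun i => cost_tabulate_le fun j => by simp
  have h2 : (loop (List.finRange d) 1 fun acc _ => mulR acc I.lam).cost ≤
      (List.finRange d).length * (1 + 1) := cost_loop_le fun x i => by simp
  have h3 : (loop ((List.range T).map (· + 1)) (fun _ _ _ => 0 : ℕ → Fin nS → Fin nA → ℝ)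
      fun tab u => do
        let Qu ← tabulate nS fun _ => tabulate nA fun _ => pure (divR 1 (subR 1 I.gamma).val).val
        writeAt tab u Qu).cost ≤
      ((List.range T).map (· + 1)).length * (nS * (nA * (0 + 1) + 1) + 1 + 1) := by
    refine cost_loop_le fun x i => ?_
    rw [cost_bind]
    exact add_le_add (cost_tabulate_le fun x => cost_tabulate_le fun b => le_rfl) le_rfl
  rw [List.length_finRange] at h2
  rw [List.length_map, List.length_range] at h3
  have e1 : d * d ≤ d * d * (nS * nA * T) := Nat.le_mul_of_pos_right _ (by positivity)
  have e2 : d ≤ d * d := Nat.le_mul_of_pos_right _ hd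
  have e3 : T * nS * nA ≤ T * nS * nA * (d * d) := Nat.le_mul_of_pos_right _ (by positivity)
  have e4 : T * nS ≤ T * nS * nA := Nat.le_mul_of_pos_right _ hA
  have e5 : T ≤ T * nS := Nat.le_mul_of_pos_right _ hS
  nlinarith

/-- Amortised accounting: the cost of planning is charged to the increase of the episode index, so
that summation over the run telescopes to the number of plans. -/
theorem stepT_spec (hI : I.lam = 1) (hd : 1 ≤ d) {t : ℕ} (ht : t < T) {m : Memory d nS nA}
    (hm : m.Represents φ r I T s t) :
    let p := stepT φ r I T s m (t + 1)
    p.val.Represents φ r I T s (t + 1) ∧ (∀ τ, τ ≤ t → p.val.acts τ = m.acts τ) ∧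
      p.cost ≤ 40 * (d * d * nA) +
        ((learnerState φ r I T s p.val.acts (t + 1)).episode -
          (learnerState φ r I T s p.val.acts t).episode) * (68 * (d * d * nS * nA * T * T)) := by
  have hA : 1 ≤ nA := NeZero.one_le
  set b := (argmaxLoop (m.Q (t + 1) (s (t + 1)))).val with hb
  set acts := Function.update m.acts (t + 1) b with hacts
  set x : Fin d → ℝ := (φ (s (t + 1)) b).ofLp with hx
  have hagree : ∀ τ, τ ≤ t → acts τ = m.acts τ := fun τ hτ =>
    Function.update_of_ne (by omega) _ _
  have hself : acts (t + 1) = b := Function.update_self _ _ _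
  have hσ : ∀ τ, τ ≤ t → learnerState φ r I T s acts τ = learnerState φ r I T s m.acts τ :=
    fun τ hτ => learnerState_congr φ r I T s fun τ' _ h => hagree τ' (by omega)
  have hinv := episodeInvariant φ r hI T s acts t
  set σ := learnerState φ r I T s acts t with hσdef
  -- With `lam = 1` the matrix is a Gram matrix, hence positive definite; this makes the rank-one
  -- updates of the inverse and the determinant exact.
  have hposBar : σ.LamBar.PosDef := by rw [hinv.lamBar_eq]; exact posDef_gram _ _
  have hlb : m.lamBarInv = σ.LamBar⁻¹ := by rw [hm.lamBarInv, ← hσ t le_rfl]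
  have hdb : m.detLamBar = σ.LamBar.det := by rw [hm.detLamBar, ← hσ t le_rfl]
  have hl : m.lamInv = σ.Lam⁻¹ := by rw [hm.lamInv, ← hσ t le_rfl]
  have hdl : m.detLam = σ.Lam.det := by rw [hm.detLam, ← hσ t le_rfl]
  have hQ : ∀ u, t < u → u ≤ T → m.Q u = σ.Q u := fun u h1 h2 => by
    rw [hm.Q u h1 h2, ← hσ t le_rfl]
  have hinvnew : (fun i j => m.lamBarInv i j - (m.lamBarInv *ᵥ x) i * (m.lamBarInv *ᵥ x) j /
      (1 + x ⬝ᵥ (m.lamBarInv *ᵥ x))) = (σ.LamBar + Matrix.vecMulVec x x)⁻¹ := by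
    rw [inv_add_vecMulVec hposBar, hlb]
    ext i j
    simp [Matrix.vecMulVec_apply, quadForm, div_eq_inv_mul]
  have hdetnew : m.detLamBar * (1 + x ⬝ᵥ (m.lamBarInv *ᵥ x)) =
      (σ.LamBar + Matrix.vecMulVec x x).det := by
    rw [det_add_vecMulVec hposBar, hlb, hdb]; rfl
  have hfollow : ∀ τ, 1 ≤ τ → τ ≤ t + 1 → ∀ c, (learnerState φ r I T s acts (τ - 1)).Q τ (s τ) c ≤
      (learnerState φ r I T s acts (τ - 1)).Q τ (s τ) (acts τ) := by
    intro τ h1 h2 c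
    by_cases h : τ = t + 1
    · subst h
      rw [Nat.add_sub_cancel, hself, ← hσdef, ← hQ (t + 1) (by omega) (by omega)]
      exact le_val_argmaxLoop _ _
    · rw [hσ (τ - 1) (by omega), hagree τ (by omega)]
      exact hm.follows τ h1 (by omega) c
  have hstep : learnerState φ r I T s acts (t + 1) =
      if 2 * σ.Lam.det < (σ.LamBar + Matrix.vecMulVec x x).det then
        ⟨σ.episode + 1, t + 2, σ.LamBar + Matrix.vecMulVec x x, σ.LamBar + Matrix.vecMulVec x x,
          plannedQ φ r I T s acts (σ.LamBar + Matrix.vecMulVec x x) (t + 1)⟩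
      else ⟨σ.episode, σ.start, σ.Lam, σ.LamBar + Matrix.vecMulVec x x, σ.Q⟩ := by
    rw [learnerState]; simp only [hself]; rfl
  have c1 := cost_argmaxLoop_le (m.Q (t + 1) (s (t + 1)))
  have c2 := cost_fetchFeature_le φ (s (t + 1)) b
  have c3 := cost_mulVecT_le m.lamBarInv x
  have c4 := cost_dotT_le x (m.lamBarInv *ᵥ x)
  have c5 : ∀ e : ℝ, (tabulate d fun i => tabulate d fun j => do
      let gi ← readAt (m.lamBarInv *ᵥ x) i
      let gj ← readAt (m.lamBarInv *ᵥ x) j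
      let y ← mulR gi gj
      let z ← divR y e
      let old ← readAt₂ m.lamBarInv i j
      subR old z).cost ≤ d * (d * (6 + 1) + 1) := fun e =>
    cost_tabulate_le fun i => cost_tabulate_le fun j => by simp
  have c5' := c5 (1 + x ⬝ᵥ (m.lamBarInv *ᵥ x))
  rw [show d * (5 * d + 1) = 5 * (d * d) + d by ring] at c3
  rw [show d * (d * (6 + 1) + 1) = 7 * (d * d) + d by ring] at c5'
  have e1 : d ≤ d * d := Nat.le_mul_of_pos_right _ hd
  have e2 : d * d ≤ d * d * nA := Nat.le_mul_of_pos_right _ hA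
  have e3 : nA ≤ d * d * nA := Nat.le_mul_of_pos_left _ (by positivity)
  have c6 := cost_planT_le φ r I T s acts hd (by omega)
    (σ.LamBar + Matrix.vecMulVec x x)⁻¹ (n := t + 1) (by omega) m.Q
  simp only [stepT, val_bind, cost_bind, val_readAt, cost_readAt, val_readAt₂, cost_readAt₂,
    val_readAt₂_matrix, val_writeAt, cost_writeAt, val_fetchFeature, val_mulVecT, val_dotT, val_addR, cost_addR,
    val_mulR, cost_mulR, val_tabulate, val_ltR, cost_ltR, ← hb, ← hx, ← hacts, hdetnew, hinvnew,
    val_divR, val_subR, decide_eq_true_eq, hdl]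
  by_cases h : 2 * σ.Lam.det < (σ.LamBar + Matrix.vecMulVec x x).det
  · rw [if_pos h] at hstep
    simp only [if_pos h, val_bind, val_pure, cost_bind, cost_pure]
    refine ⟨⟨?_, ?_, ?_, ?_, ?_, hfollow⟩, hagree, ?_⟩
    · rw [hstep]
    · rw [hstep]
    · rw [hstep]
    · rw [hstep]
    · intro u h1 h2
      rw [hstep]
      exact val_planT φ r I T s acts _ _ _ u h1 h2
    · rw [hstep, ← hσdef]
      simp only [Nat.add_sub_cancel_left, one_mul]
      linarith
  · rw [if_neg h] at hstep
    simp only [if_neg h, val_pure, cost_pure]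
    refine ⟨⟨?_, ?_, ?_, ?_, ?_, hfollow⟩, hagree, ?_⟩
    · rw [hstep]; exact hl
    · rw [hstep]
    · rw [hstep]
    · rw [hstep]
    · intro u h1 h2
      rw [hstep]
      exact hQ u (by omega) h2
    · rw [hstep, ← hσdef]
      simp only [Nat.sub_self, zero_mul]
      linarith

theorem runT_loop_spec (hI : I.lam = 1) (hd : 1 ≤ d) {t : ℕ} (ht : t ≤ T) :
    let p := loop ((List.range t).map (· + 1)) (initT I T : Timed (Memory d nS nA)).val
      (stepT φ r I T s)
    p.val.Represents φ r I T s t ∧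
      p.cost ≤ t * (1 + 40 * (d * d * nA)) +
        ((learnerState φ r I T s p.val.acts t).episode - 1) *
          (68 * (d * d * nS * nA * T * T)) := by
  induction t with
  | zero => exact ⟨initT_represents φ r I T s hI, by simp [loop]⟩
  | succ t ih =>
    obtain ⟨h1, h2⟩ := ih (by omega)
    dsimp only at h1 h2 ⊢
    rw [List.range_succ, List.map_append, List.map_singleton, (loop_append _ _ _ _).1,
      (loop_append _ _ _ _).2, val_loop_singleton, cost_loop_singleton]
    set m := (loop ((List.range t).map (· + 1)) (initT I T : Timed (Memory d nS nA)).val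
      (stepT φ r I T s)).val
    obtain ⟨h3, h4, h5⟩ := stepT_spec φ r I T s hI hd (by omega) h1
    refine ⟨h3, ?_⟩
    set p := stepT φ r I T s m (t + 1)
    have h6 : learnerState φ r I T s p.val.acts t = learnerState φ r I T s m.acts t :=
      learnerState_congr φ r I T s fun τ _ h => h4 τ h
    rw [← h6] at h2
    have h7 := (episodeInvariant φ r hI T s p.val.acts t).one_le_episode
    have h8 := episode_le_succ φ r I T s p.val.acts t
    set e := (learnerState φ r I T s p.val.acts t).episode
    set e' := (learnerState φ r I T s p.val.acts (t + 1)).episode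
    -- The truncated differences add up because `1 ≤ e ≤ e'`.
    have h9 : e' - 1 = (e - 1) + (e' - e) := by omega
    rw [h9, add_mul, add_mul]
    linarith

theorem runT_spec (hI : I.lam = 1) (hd : 1 ≤ d) (hT : 2 ≤ T) (hφ : ∀ x b, ‖φ x b‖ ≤ 1) :
    FollowsAlgorithm φ r I T s (runT φ r I T s).val ∧
      ((runT φ r I T s).cost : ℝ) ≤ 200 * (Real.logb 2 T * d ^ 3 * nS * nA * T ^ 2) := by
  have hS : 1 ≤ nS := NeZero.one_le
  have hA : 1 ≤ nA := NeZero.one_le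
  obtain ⟨h1, h2⟩ := runT_loop_spec φ r I T s hI hd le_rfl
  simp only [runT, val_bind, val_pure, cost_bind, cost_pure, add_zero]
  refine ⟨h1.follows, ?_⟩
  have h3 := cost_initT_le (d := d) (nS := nS) (nA := nA) I T hd (by omega)
  set p := loop ((List.range T).map (· + 1)) (initT I T : Timed (Memory d nS nA)).val
    (stepT φ r I T s)
  have h4 := episode_sub_one_le hφ r hI T s p.val.acts T
  set e := (learnerState φ r I T s p.val.acts T).episode - 1
  have hT' : (2 : ℝ) ≤ T := by exact_mod_cast hT
  have hd' : (1 : ℝ) ≤ d := by exact_mod_cast hd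
  have hS' : (1 : ℝ) ≤ nS := by exact_mod_cast hS
  have hA' : (1 : ℝ) ≤ nA := by exact_mod_cast hA
  have hlog1 : 1 ≤ Real.logb 2 T := by
    rw [Real.le_logb_iff_rpow_le one_lt_two (by positivity)]; simpa using hT'
  have hlog2 : Real.logb 2 (1 + T) ≤ 2 * Real.logb 2 T := by
    have := Real.logb_le_logb_of_le (b := 2) one_lt_two (by positivity)
      (show (1 + T : ℝ) ≤ (T : ℝ) ^ 2 by nlinarith)
    rwa [Real.logb_pow] at this
  have h2' : ((initT I T : Timed (Memory d nS nA)).cost + p.cost : ℝ) ≤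
      12 * (d * d * nS * nA * T) + (T * (1 + 40 * (d * d * nA)) +
        e * (68 * (d * d * nS * nA * T * T))) := by
    exact_mod_cast add_le_add h3 h2
  push_cast
  refine h2'.trans ?_
  set ℓ := Real.logb 2 (T : ℝ)
  have he : (e : ℝ) ≤ d * (2 * ℓ) := h4.trans (by gcongr)
  set N : ℝ := d * d * nS * nA * T * T
  have hN : 0 ≤ N := by positivity
  have g1 : (d * d * nS * nA * T : ℝ) ≤ N := le_mul_of_one_le_right (by positivity) (by linarith)
  have g2 : (T * (d * d * nA) : ℝ) ≤ N := by
    calc (T * (d * d * nA) : ℝ) = d * d * 1 * nA * T * 1 := by ring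
      _ ≤ N := by simp only [N]; gcongr; linarith
  have g3 : (T : ℝ) ≤ N := by
    calc (T : ℝ) = T * (1 * 1 * 1) := by ring
      _ ≤ T * (d * d * nA) := by gcongr
      _ ≤ N := g2
  -- Initialisation and the single steps contribute `12 + 41` multiples of `N`, and the plans
  -- contribute `2 · 68` multiples of `N d ℓ`: altogether at most `189 N d ℓ`.
  have g4 : N ≤ N * (d * ℓ) := le_mul_of_one_le_right hN (by nlinarith)
  have g5 : (e : ℝ) * (68 * N) ≤ d * (2 * ℓ) * (68 * N) := by gcongr
  have g6 : ℓ * d ^ 3 * nS * nA * T ^ 2 = N * (d * ℓ) := by simp only [N]; ring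
  rw [g6]
  nlinarith

end Implementation

/-! ## Exponential supermartingales of an interaction -/

section Interaction

/-- The sample space `Ω` with the σ-algebra of the events known at time `t`. -/
def Past {Ω : Type*} {mΩ : MeasurableSpace Ω} (_F : Filtration ℕ mΩ) (_t : ℕ) : Type _ := Ω

/-- Carrying `F t` as an instance on a synonym lets kernels and product spaces over the past be
formed as usual. -/
instance {Ω : Type*} {mΩ : MeasurableSpace Ω} (F : Filtration ℕ mΩ) (t : ℕ) :
    MeasurableSpace (Past F t) := F t

/-- The identity map from `Ω` to the sample space with the events known at time `t`. -/
def toPast {Ω : Type*} {mΩ : MeasurableSpace Ω} (F : Filtration ℕ mΩ) (t : ℕ) (ω : Ω) :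
    Past F t := ω

/-- The identity map, which forgets the events after time `t`. -/
def restrictPast {Ω : Type*} {mΩ : MeasurableSpace Ω} (F : Filtration ℕ mΩ) (t u : ℕ)
    (ω : Past F u) : Past F t := ω

theorem measurable_toPast {Ω : Type*} {mΩ : MeasurableSpace Ω} (F : Filtration ℕ mΩ) (t : ℕ) :
    Measurable (toPast F t) := fun s hs => F.le t s hs

theorem measurable_restrictPast {Ω : Type*} {mΩ : MeasurableSpace Ω} (F : Filtration ℕ mΩ)
    {t u : ℕ} (h : t ≤ u) : Measurable (restrictPast F t u) :=
  fun s hs => F.mono h s hs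

/-- Finite measures on a product are determined by measurable rectangles, so the conditional law may
be given set by set, without regularity of the spaces. -/
theorem map_prodMk_eq_compProd {Ω Ω' S : Type*} [MeasurableSpace Ω] [MeasurableSpace Ω']
    [MeasurableSpace S] (Pr : Measure Ω) [IsFiniteMeasure Pr] {Z : Ω → Ω'} {X : Ω → S}
    (hZ : Measurable Z) (hX : Measurable X) (κ : Kernel Ω' S) [IsMarkovKernel κ]
    (h : ∀ A B, MeasurableSet A → MeasurableSet B →
      Pr (Z ⁻¹' A ∩ X ⁻¹' B) = ∫⁻ ω in Z ⁻¹' A, κ (Z ω) B ∂Pr) :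
    Pr.map (fun ω => (Z ω, X ω)) = (Pr.map Z) ⊗ₘ κ := by
  have : IsFiniteMeasure (Pr.map fun ω => (Z ω, X ω)) := Measure.isFiniteMeasure_map _ _
  refine Measure.ext_prod fun {A B} hA hB => ?_
  rw [Measure.map_apply (hZ.prodMk hX) (hA.prod hB), Measure.compProd_apply_prod hA hB,
    setLIntegral_map hA (Kernel.measurable_coe κ hB) hZ, ← h A B hA hB]
  rfl

variable {S A Ω : Type*} [MeasurableSpace S] [MeasurableSpace A] [mΩ : MeasurableSpace Ω]
variable {M : MDP S A} {T : ℕ} {Pr : Measure Ω} {F : Filtration ℕ mΩ}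
variable {X : ℕ → Ω → S} {Y : ℕ → Ω → A}

theorem IsInteraction.measurable_pair (h : IsInteraction M T Pr F X Y) {t : ℕ} (h1 : 1 ≤ t)
    (h2 : t ≤ T) : Measurable (fun ω : Past F t => (X t ω, Y t ω)) :=
  Measurable.prodMk (h.measurable_state t h1 (by omega)) (h.measurable_action t h1 h2)

/-- The law of the next state given the past, as a kernel. -/
def IsInteraction.kernel (h : IsInteraction M T Pr F X Y) {t : ℕ} (h1 : 1 ≤ t) (h2 : t ≤ T) :
    Kernel (Past F t) S := M.P.comap _ (h.measurable_pair h1 h2)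

theorem IsInteraction.isMarkovKernel_kernel (h : IsInteraction M T Pr F X Y) {t : ℕ} (h1 : 1 ≤ t)
    (h2 : t ≤ T) : IsMarkovKernel (h.kernel h1 h2) := by
  have := M.markov
  unfold IsInteraction.kernel
  infer_instance

theorem IsInteraction.measurable_next (h : IsInteraction M T Pr F X Y) {t : ℕ} (h2 : t ≤ T) :
    Measurable (X (t + 1)) :=
  (h.measurable_state (t + 1) (by omega) (by omega)).mono (F.le _) le_rfl

/-- The conditional expectation of the indicator of the next state, integrated over an event of the
past. -/
theorem IsInteraction.measure_inter_next [IsProbabilityMeasure Pr]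
    (h : IsInteraction M T Pr F X Y) {t : ℕ} (h1 : 1 ≤ t) (h2 : t ≤ T) {A' : Set Ω} {B : Set S}
    (hA : MeasurableSet[F t] A') (hB : MeasurableSet B) :
    Pr (A' ∩ X (t + 1) ⁻¹' B) = ∫⁻ ω in A', M.P (X t ω, Y t ω) B ∂Pr := by
  have := M.markov
  have hX := h.measurable_next h2
  have hAΩ : MeasurableSet A' := F.le t A' hA
  have e1 := setIntegral_condExp (μ := Pr) (F.le t)
    (f := (X (t + 1) ⁻¹' B).indicator fun _ => (1 : ℝ))
    ((integrable_const (1 : ℝ)).indicator (hX hB)) hA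
  rw [setIntegral_congr_ae hAΩ ((h.next_state t h1 h2 B hB).mono fun x hx _ => hx)] at e1
  have e2 : ∫ ω in A', (X (t + 1) ⁻¹' B).indicator (fun _ => (1 : ℝ)) ω ∂Pr =
      Pr.real (A' ∩ X (t + 1) ⁻¹' B) := by
    rw [setIntegral_indicator (hX hB)]; simp [Measure.real]
  rw [e2] at e1
  have hm : Measurable fun ω : Ω => M.P (X t ω, Y t ω) B :=
    ((Kernel.measurable_coe M.P hB).comp (h.measurable_pair h1 h2)).comp (measurable_toPast F t)
  have e3 : ∫ ω in A', (M.P (X t ω, Y t ω)).real B ∂Pr =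
      (∫⁻ ω in A', M.P (X t ω, Y t ω) B ∂Pr).toReal :=
    integral_toReal hm.aemeasurable (ae_of_all _ fun ω => measure_lt_top _ _)
  rw [e3] at e1
  have hfin : ∫⁻ ω in A', M.P (X t ω, Y t ω) B ∂Pr ≠ ⊤ := by
    refine ne_top_of_le_ne_top (measure_ne_top Pr A') ?_
    calc ∫⁻ ω in A', M.P (X t ω, Y t ω) B ∂Pr ≤ ∫⁻ _ω in A', 1 ∂Pr :=
          lintegral_mono fun ω => prob_le_one
      _ = Pr A' := by simp
  exact ((ENNReal.toReal_eq_toReal_iff' hfin (measure_ne_top _ _)).1 e1).symm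

/-- Freezing the past: the joint law of past and next state is a composition with the transition
kernel, so functions of both can be integrated in the next state first. -/
theorem IsInteraction.lintegral_next [IsProbabilityMeasure Pr]
    (h : IsInteraction M T Pr F X Y) {t : ℕ} (h1 : 1 ≤ t)
    (h2 : t ≤ T) {G : Past F t × S → ENNReal} (hG : Measurable G) :
    ∫⁻ ω, G (ω, X (t + 1) ω) ∂Pr = ∫⁻ ω, ∫⁻ s', G (ω, s') ∂(M.P (X t ω, Y t ω)) ∂Pr := by
  have := M.markov
  have := h.isMarkovKernel_kernel h1 h2
  have hX := h.measurable_next h2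
  have hZ := measurable_toPast F t
  have key := map_prodMk_eq_compProd Pr hZ hX (h.kernel h1 h2) fun A' B hA hB =>
    h.measure_inter_next h1 h2 hA hB
  change ∫⁻ ω, G (toPast F t ω, X (t + 1) ω) ∂Pr = _
  rw [← lintegral_map (μ := Pr) (g := fun ω => (toPast F t ω, X (t + 1) ω)) hG
    (hZ.prodMk hX), key, Measure.lintegral_compProd hG,
    lintegral_map hG.lintegral_kernel_prod_right' hZ]
  rfl

/-- Hoeffding's lemma. -/
theorem lintegral_exp_sub_integral_le {μ : Measure S} [IsProbabilityMeasure μ] {g : S → ℝ}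
    (hg : Measurable g) {l c : ℝ} (h : ∀ x, g x ∈ Set.Icc l (l + c)) :
    ∫⁻ x, ENNReal.ofReal (Real.exp (g x - ∫ y, g y ∂μ - c ^ 2 / 8)) ∂μ ≤ 1 := by
  -- The variance proxy is `(c/2)²`, and half of it is the compensator `c²/8`.
  have hs := hasSubgaussianMGF_of_mem_Icc (μ := μ) hg.aemeasurable (ae_of_all _ h)
  have h1 := hs.mgf_le 1
  have h2 := hs.integrable_exp_mul 1
  simp only [one_mul] at h2
  rw [← ofReal_integral_eq_lintegral_ofReal]
  · rw [ENNReal.ofReal_le_one]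
    simp only [Real.exp_sub _ (c ^ 2 / 8), integral_div]
    rw [div_le_one (Real.exp_pos _)]
    simp only [mgf, one_mul] at h1
    refine h1.trans (Real.exp_le_exp.2 (le_of_eq ?_))
    simp [div_pow]; ring
  · simp only [Real.exp_sub _ (c ^ 2 / 8)]
    exact h2.div_const _
  · exact ae_of_all _ fun x => (Real.exp_pos _).le

/-- The deviation of a function of the next state from its conditional mean. -/
def deviation (M : MDP S A) (X : ℕ → Ω → S) (Y : ℕ → Ω → A) (G : ℕ → Ω → S → ℝ) (t : ℕ) (ω : Ω) :
    ℝ :=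
  G t ω (X (t + 1) ω) - ∫ s', G t ω s' ∂(M.P (X t ω, Y t ω))

theorem IsInteraction.measurable_integral_past (h : IsInteraction M T Pr F X Y) {t : ℕ}
    (h1 : 1 ≤ t) (h2 : t ≤ T) {G : Past F t → S → ℝ} (hG : Measurable (Function.uncurry G)) :
    Measurable fun ω : Past F t => ∫ s', G ω s' ∂(M.P (X t ω, Y t ω)) := by
  have := h.isMarkovKernel_kernel h1 h2
  exact (hG.stronglyMeasurable.integral_kernel_prod_right (κ := h.kernel h1 h2)).measurable

theorem IsInteraction.measurable_deviation (h : IsInteraction M T Pr F X Y) {t u : ℕ}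
    (h1 : 1 ≤ t) (h2 : t < u) (h3 : u ≤ T + 1) {G : ℕ → Ω → S → ℝ}
    (hG : Measurable fun p : Past F t × S => G t p.1 p.2) :
    Measurable fun ω : Past F u => deviation M X Y G t ω := by
  have hp := measurable_restrictPast F h2.le
  have hX : Measurable fun ω : Past F u => X (t + 1) ω :=
    (h.measurable_state (t + 1) (by omega) (by omega)).mono (F.mono (by omega)) le_rfl
  exact (hG.comp (hp.prodMk hX)).sub
    ((h.measurable_integral_past h1 (by omega) (G := fun ω => G t ω) hG).comp hp)

/-- Azuma–Hoeffding in exponential form, with predictable ranges. -/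
theorem IsInteraction.lintegral_exp_sum_le [IsProbabilityMeasure Pr]
    (h : IsInteraction M T Pr F X Y) {G : ℕ → Ω → S → ℝ}
    {l c : ℕ → Ω → ℝ} {n : ℕ} (hn : n ≤ T)
    (hG : ∀ t, 1 ≤ t → t ≤ n → Measurable fun p : Past F t × S => G t p.1 p.2)
    (hc : ∀ t, 1 ≤ t → t ≤ n → Measurable fun ω : Past F t => c t ω)
    (hb : ∀ t, 1 ≤ t → t ≤ n → ∀ ω s', G t ω s' ∈ Set.Icc (l t ω) (l t ω + c t ω)) :
    ∫⁻ ω, ENNReal.ofReal (Real.exp (∑ t ∈ Finset.Icc 1 n,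
      (deviation M X Y G t ω - c t ω ^ 2 / 8))) ∂Pr ≤ 1 := by
  induction n with
  | zero => simp
  | succ n ih =>
    have := M.markov
    refine le_trans ?_ (ih (by omega) (fun t h1 h2 => hG t h1 (by omega))
      (fun t h1 h2 => hc t h1 (by omega)) fun t h1 h2 => hb t h1 (by omega))
    have hW : Measurable fun ω : Past F (n + 1) => ∑ t ∈ Finset.Icc 1 n,
        (deviation M X Y G t ω - c t ω ^ 2 / 8) := by
      refine Finset.measurable_sum _ fun t ht => ?_
      rw [Finset.mem_Icc] at ht
      exact (h.measurable_deviation ht.1 (by omega) (by omega) (hG t ht.1 (by omega))).sub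
        ((((hc t ht.1 (by omega)).comp (measurable_restrictPast F (by omega))).pow_const 2).div_const 8)
    have hGn := hG (n + 1) (by omega) le_rfl
    have hmeas : Measurable fun p : Past F (n + 1) × S => ENNReal.ofReal (Real.exp
        (G (n + 1) p.1 p.2 - ∫ s', G (n + 1) p.1 s' ∂(M.P (X (n + 1) p.1, Y (n + 1) p.1)) -
          c (n + 1) p.1 ^ 2 / 8)) := by
      refine (Real.measurable_exp.comp ((hGn.sub ?_).sub ?_)).ennreal_ofReal
      · exact (h.measurable_integral_past (by omega) hn (G := fun ω => G (n + 1) ω) hGn).comp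
          measurable_fst
      · exact (((hc (n + 1) (by omega) le_rfl).comp measurable_fst).pow_const 2).div_const 8
    have hW' : Measurable fun p : Past F (n + 1) × S => ENNReal.ofReal (Real.exp
        (∑ t ∈ Finset.Icc 1 n, (deviation M X Y G t p.1 - c t p.1 ^ 2 / 8))) :=
      (Real.measurable_exp.comp (hW.comp measurable_fst)).ennreal_ofReal
    -- The first `n` factors are known at time `n + 1`, so they count as past; the last factor has
    -- conditional mean at most one by Hoeffding's lemma.
    have e := h.lintegral_next (t := n + 1) (by omega) hn (hW'.mul hmeas)
    simp only [Pi.mul_apply] at e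
    calc ∫⁻ ω, ENNReal.ofReal (Real.exp (∑ t ∈ Finset.Icc 1 (n + 1),
          (deviation M X Y G t ω - c t ω ^ 2 / 8))) ∂Pr
        = ∫⁻ ω, ENNReal.ofReal (Real.exp (∑ t ∈ Finset.Icc 1 n,
            (deviation M X Y G t ω - c t ω ^ 2 / 8))) *
          ENNReal.ofReal (Real.exp (G (n + 1) ω (X (n + 1 + 1) ω) -
            ∫ s', G (n + 1) ω s' ∂(M.P (X (n + 1) ω, Y (n + 1) ω)) - c (n + 1) ω ^ 2 / 8)) ∂Pr := by
          refine lintegral_congr fun ω => ?_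
          rw [Finset.sum_Icc_succ_top (by omega), Real.exp_add,
            ENNReal.ofReal_mul (Real.exp_pos _).le]
          rfl
      _ = _ := e
      _ ≤ ∫⁻ ω, ENNReal.ofReal (Real.exp (∑ t ∈ Finset.Icc 1 n,
            (deviation M X Y G t ω - c t ω ^ 2 / 8))) ∂Pr := by
          refine lintegral_mono fun ω => ?_
          have hω : Measurable fun s' => ENNReal.ofReal (Real.exp (G (n + 1) ω s' -
              ∫ s', G (n + 1) ω s' ∂(M.P (X (n + 1) ω, Y (n + 1) ω)) - c (n + 1) ω ^ 2 / 8)) :=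
            hmeas.comp (measurable_prodMk_left (x := toPast F (n + 1) ω))
          refine (lintegral_const_mul _ hω).le.trans ?_
          refine mul_le_of_le_one_right' ?_
          exact lintegral_exp_sub_integral_le
            (hGn.comp (measurable_prodMk_left (x := toPast F (n + 1) ω)))
            (hb (n + 1) (by omega) le_rfl ω)

/-- The probability that an exponential supermartingale is large. -/
theorem IsInteraction.measure_sum_gt_le [IsProbabilityMeasure Pr]
    (h : IsInteraction M T Pr F X Y) {G : ℕ → Ω → S → ℝ}
    {l c : ℕ → Ω → ℝ} {n : ℕ} (hn : n ≤ T)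
    (hG : ∀ t, 1 ≤ t → t ≤ n → Measurable fun p : Past F t × S => G t p.1 p.2)
    (hc : ∀ t, 1 ≤ t → t ≤ n → Measurable fun ω : Past F t => c t ω)
    (hb : ∀ t, 1 ≤ t → t ≤ n → ∀ ω s', G t ω s' ∈ Set.Icc (l t ω) (l t ω + c t ω))
    {p : ℝ} (hp : 0 < p) :
    Pr {ω | Real.log (1 / p) ≤ ∑ t ∈ Finset.Icc 1 n, (deviation M X Y G t ω - c t ω ^ 2 / 8)} ≤
      ENNReal.ofReal p := by
  have h1 := h.lintegral_exp_sum_le hn hG hc hb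
  have hm : Measurable fun ω => ∑ t ∈ Finset.Icc 1 n,
      (deviation M X Y G t ω - c t ω ^ 2 / 8) := by
    refine Finset.measurable_sum _ fun t ht => ?_
    rw [Finset.mem_Icc] at ht
    exact ((h.measurable_deviation (u := t + 1) ht.1 (by omega) (by omega)
      (hG t ht.1 ht.2)).comp (measurable_toPast F _)).sub
      ((((hc t ht.1 ht.2).comp (measurable_toPast F _)).pow_const 2).div_const 8)
  -- Markov's inequality at level `1/p` for an exponential of mean at most one.
  have h2 := mul_meas_ge_le_lintegral (μ := Pr) (Real.measurable_exp.comp hm).ennreal_ofReal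
    (ENNReal.ofReal (1 / p))
  have h3 := h2.trans h1
  have hset : {ω | Real.log (1 / p) ≤ ∑ t ∈ Finset.Icc 1 n,
      (deviation M X Y G t ω - c t ω ^ 2 / 8)} ⊆ {ω | ENNReal.ofReal (1 / p) ≤ ENNReal.ofReal
        ((Real.exp ∘ fun ω => ∑ t ∈ Finset.Icc 1 n,
          (deviation M X Y G t ω - c t ω ^ 2 / 8)) ω)} := by
    intro ω hω
    refine ENNReal.ofReal_le_ofReal ?_
    exact (Real.log_le_iff_le_exp (by positivity)).1 hω
  refine (measure_mono hset).trans ?_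
  rw [one_div, ENNReal.ofReal_inv_of_pos hp] at h3 ⊢
  have h4 : ENNReal.ofReal p * ((ENNReal.ofReal p)⁻¹ * _) ≤ ENNReal.ofReal p * 1 :=
    mul_le_mul_right h3 _
  rwa [← mul_assoc, ENNReal.mul_inv_cancel (by simpa using hp) ENNReal.ofReal_ne_top, one_mul,
    mul_one] at h4

end Interaction

/-! ## Markov decision processes that satisfy the Bellman optimality equation -/

section MDPFacts

variable {S A : Type*} [MeasurableSpace S] [MeasurableSpace A]

theorem integrable_of_abs_le {α : Type*} [MeasurableSpace α] {μ : Measure α} [IsFiniteMeasure μ]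
    {g : α → ℝ} (hg : Measurable g) {B : ℝ} (hB : ∀ x, |g x| ≤ B) : Integrable g μ :=
  Integrable.of_bound hg.aestronglyMeasurable B (ae_of_all _ hB)

theorem integral_mem_Icc {α : Type*} [MeasurableSpace α] {μ : Measure α} [IsProbabilityMeasure μ]
    {g : α → ℝ} (hg : Measurable g) {l u : ℝ} (h : ∀ x, g x ∈ Set.Icc l u) :
    ∫ x, g x ∂μ ∈ Set.Icc l u := by
  have hi : Integrable g μ := Integrable.of_mem_Icc l u hg.aemeasurable (ae_of_all _ h)
  constructor
  · simpa using integral_mono (integrable_const l) hi fun x => (h x).1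
  · simpa using integral_mono hi (integrable_const u) fun x => (h x).2

theorem isProbabilityMeasure_stateLaw (M : MDP S A) (π : Kernel S A) [IsMarkovKernel π] (s : S)
    (n : ℕ) : IsProbabilityMeasure (stateLaw M π s n) := by
  have := M.markov
  induction n with
  | zero => exact Measure.dirac.isProbabilityMeasure
  | succ n ih =>
    rw [stateLaw]
    infer_instance

variable {M : MDP S A} {J : ℝ} {v : S → ℝ} {q : S → A → ℝ}

theorem SolvesBellman.reward_add_le (h : SolvesBellman M J v q) (s : S) (a : A) :
    M.r s a + ∫ s', v s' ∂(M.P (s, a)) ≤ J + v s := by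
  rw [← h.gain_add]
  linarith [(h.v_eq_max s).2 ⟨a, rfl⟩]

theorem SolvesBellman.exists_reward_add_eq (h : SolvesBellman M J v q) (s : S) :
    ∃ a, M.r s a + ∫ s', v s' ∂(M.P (s, a)) = J + v s := by
  obtain ⟨a, ha⟩ := (h.v_eq_max s).1
  exact ⟨a, by rw [← h.gain_add, ha]⟩

theorem SolvesBellman.bddAbove_range (h : SolvesBellman M J v q) : BddAbove (Set.range v) := by
  obtain ⟨B, hB⟩ := h.bounded_v
  exact ⟨B, by rintro _ ⟨s, rfl⟩; exact (abs_le.1 (hB s)).2⟩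

theorem SolvesBellman.bddBelow_range (h : SolvesBellman M J v q) : BddBelow (Set.range v) := by
  obtain ⟨B, hB⟩ := h.bounded_v
  exact ⟨-B, by rintro _ ⟨s, rfl⟩; exact (abs_le.1 (hB s)).1⟩

theorem SolvesBellman.mem_Icc (h : SolvesBellman M J v q) (s : S) :
    v s ∈ Set.Icc (⨅ x, v x) (⨆ x, v x) :=
  ⟨ciInf_le h.bddBelow_range s, le_ciSup h.bddAbove_range s⟩

/-- With a nonnegative reward, the Bellman inequality bounds every `v s` from below by `inf v - J`;
taking the infimum gives the sign of `J`. -/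
theorem SolvesBellman.gain_nonneg (h : SolvesBellman M J v q) [Nonempty S] [Nonempty A] :
    0 ≤ J := by
  have := M.markov
  have h1 : (⨅ x, v x) - J ≤ ⨅ x, v x := by
    refine le_ciInf fun s => ?_
    have h2 := h.reward_add_le s (Classical.arbitrary A)
    have h3 := (integral_mem_Icc (μ := M.P (s, Classical.arbitrary A)) h.measurable_v h.mem_Icc).1
    have h4 := (M.r_mem s (Classical.arbitrary A)).1
    linarith
  linarith

theorem SolvesBellman.gain_le_one (h : SolvesBellman M J v q) [Nonempty S] : J ≤ 1 := by
  have := M.markov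
  have h1 : ⨆ x, v x ≤ 1 + (⨆ x, v x) - J := by
    refine ciSup_le fun s => ?_
    obtain ⟨a, h2⟩ := h.exists_reward_add_eq s
    have h3 := (integral_mem_Icc (μ := M.P (s, a)) h.measurable_v h.mem_Icc).2
    have h4 := (M.r_mem s a).2
    linarith
  linarith

theorem SolvesBellman.bddAbove_span (h : SolvesBellman M J v q) :
    BddAbove (Set.range fun p : S × S => |v p.1 - v p.2|) := by
  obtain ⟨B, hB⟩ := h.bounded_v
  refine ⟨B + B, ?_⟩
  rintro _ ⟨p, rfl⟩
  exact (abs_sub _ _).trans (add_le_add (hB _) (hB _))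

theorem SolvesBellman.sub_le_span (h : SolvesBellman M J v q) (s s' : S) :
    v s - v s' ≤ span v :=
  (le_abs_self _).trans (le_ciSup h.bddAbove_span (s, s'))

omit [MeasurableSpace S] in
theorem span_nonneg (v : S → ℝ) : 0 ≤ span v := Real.iSup_nonneg fun _ => abs_nonneg _

theorem SolvesBellman.iSup_sub_le_span (h : SolvesBellman M J v q) [Nonempty S] (s : S) :
    (⨆ x, v x) - v s ≤ span v := by
  have : ⨆ x, v x ≤ v s + span v := ciSup_le fun x => by linarith [h.sub_le_span x s]
  linarith

/-- The Bellman inequality integrated over the law of state and action. The integral of `v` after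
one transition is its integral under the next state law, so these bounds telescope. -/
theorem SolvesBellman.expectedReward_le (h : SolvesBellman M J v q) (π : Kernel S A)
    [IsMarkovKernel π] (s : S) (n : ℕ) :
    expectedReward M π s n ≤
      J + ∫ x, v x ∂(stateLaw M π s n) - ∫ x, v x ∂(stateLaw M π s (n + 1)) := by
  have := M.markov
  have := isProbabilityMeasure_stateLaw M π s n
  obtain ⟨B, hB⟩ := h.bounded_v
  have hv : ∀ (μ : Measure S) [IsProbabilityMeasure μ], Integrable v μ := fun μ _ =>
    integrable_of_abs_le h.measurable_v hB
  have hi1 : Integrable (fun p : S × A => M.r p.1 p.2) (stateLaw M π s n ⊗ₘ π) :=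
    integrable_of_abs_le (B := 1) M.measurable_r fun p =>
      abs_le.2 ⟨by linarith [(M.r_mem p.1 p.2).1], (M.r_mem p.1 p.2).2⟩
  have hi2 : Integrable (fun p : S × A => v p.1) (stateLaw M π s n ⊗ₘ π) :=
    integrable_of_abs_le (h.measurable_v.comp measurable_fst) fun p => hB p.1
  have hm3 : Measurable fun p : S × A => ∫ s', v s' ∂(M.P p) :=
    (h.measurable_v.stronglyMeasurable.integral_kernel (κ := M.P)).measurable
  have hi3 : Integrable (fun p : S × A => ∫ s', v s' ∂(M.P p)) (stateLaw M π s n ⊗ₘ π) := by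
    refine integrable_of_abs_le (B := B) hm3 fun p => abs_le.2 ?_
    exact integral_mem_Icc h.measurable_v fun x => abs_le.1 (hB x)
  have e1 : ∫ x, v x ∂(stateLaw M π s (n + 1)) =
      ∫ p, ∫ s', v s' ∂(M.P p) ∂(stateLaw M π s n ⊗ₘ π) := by
    rw [stateLaw]
    have hp : IsProbabilityMeasure ((stateLaw M π s n ⊗ₘ π).bind M.P) := inferInstance
    have e := Kernel.integral_comp (κ := Kernel.const Unit (stateLaw M π s n ⊗ₘ π)) (η := M.P)
      (a := ()) (f := v) (by rw [Kernel.comp_apply, Kernel.const_apply]; exact hv _)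
    rwa [Kernel.comp_apply, Kernel.const_apply] at e
  have e2 : ∫ p, v p.1 ∂(stateLaw M π s n ⊗ₘ π) = ∫ x, v x ∂(stateLaw M π s n) := by
    conv_rhs => rw [← Measure.fst_compProd (stateLaw M π s n) π, Measure.fst]
    rw [integral_map measurable_fst.aemeasurable h.measurable_v.aestronglyMeasurable]
  have key : ∫ p, (M.r p.1 p.2 + ∫ s', v s' ∂(M.P p)) ∂(stateLaw M π s n ⊗ₘ π) ≤
      ∫ p, (J + v p.1) ∂(stateLaw M π s n ⊗ₘ π) :=
    integral_mono (hi1.add hi3) ((integrable_const J).add hi2) fun p => h.reward_add_le p.1 p.2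
  rw [integral_add hi1 hi3, integral_add (integrable_const J) hi2, e2, ← e1] at key
  simp only [integral_const, probReal_univ, smul_eq_mul, one_mul] at key
  rw [expectedReward]
  linarith

theorem SolvesBellman.averageReward_le (h : SolvesBellman M J v q) (π : Kernel S A)
    [IsMarkovKernel π] (s : S) : averageReward M π s ≤ J := by
  have := M.markov
  obtain ⟨B, hB⟩ := h.bounded_v
  have hsum : ∀ T : ℕ, ∑ n ∈ Finset.range T, expectedReward M π s n ≤ T * J + 2 * B := by
    intro T
    have h1 : ∀ T : ℕ, ∑ n ∈ Finset.range T, expectedReward M π s n ≤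
        T * J + (∫ x, v x ∂(stateLaw M π s 0) - ∫ x, v x ∂(stateLaw M π s T)) := by
      intro T
      induction T with
      | zero => simp
      | succ T ih =>
        rw [Finset.sum_range_succ]
        have := h.expectedReward_le π s T
        push_cast
        linarith
    have h2 : ∀ n, ∫ x, v x ∂(stateLaw M π s n) ∈ Set.Icc (-B) B := fun n => by
      have := isProbabilityMeasure_stateLaw M π s n
      exact integral_mem_Icc h.measurable_v fun x => abs_le.1 (hB x)
    linarith [h1 T, (h2 0).2, (h2 T).1]
  have hnonneg : ∀ T : ℕ, 0 ≤ (1 / (T : ℝ)) * ∑ n ∈ Finset.range T, expectedReward M π s n :=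
    fun T => mul_nonneg (by positivity) (Finset.sum_nonneg fun n _ =>
      integral_nonneg fun p => (M.r_mem p.1 p.2).1)
  -- The averages are bounded below by zero, so the lower limit is a genuine one; any eventual lower
  -- bound is then compared with the limit of `J + 2B/T`.
  refine Filter.liminf_le_of_le ⟨0, by simpa using ⟨0, fun b _ => by simpa using hnonneg b⟩⟩
    fun b hb => ?_
  have hlim : Filter.Tendsto (fun T : ℕ => J + 2 * B / (T : ℝ)) Filter.atTop (nhds (J + 0)) :=
    tendsto_const_nhds.add (tendsto_const_div_atTop_nhds_zero_nat _)
  rw [add_zero] at hlim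
  refine ge_of_tendsto hlim ?_
  filter_upwards [hb, Filter.eventually_gt_atTop 0] with T hT hT0
  have hT' : (0 : ℝ) < T := by exact_mod_cast hT0
  refine hT.trans ?_
  rw [one_div, inv_mul_le_iff₀ hT']
  have := hsum T
  field_simp
  linarith

theorem SolvesBellman.optimalGain_le (h : SolvesBellman M J v q) [Nonempty S] [Nonempty A]
    (s : S) : optimalGain M s ≤ J :=
  -- The sign of `J` is required because a supremum over an empty family of reals is zero.
  Real.iSup_le (fun π => by have := π.2; exact h.averageReward_le π.1 s) h.gain_nonneg

end MDPFacts

/-! ## Linear Markov decision processes -/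

section LinearMDP

variable {S A : Type*} [MeasurableSpace S] [MeasurableSpace A] {d : ℕ} {M : MDP S A}
variable {φ : S → A → EuclideanSpace ℝ (Fin d)} {θ : EuclideanSpace ℝ (Fin d)}
variable {μ : Fin d → Measure S}

/-- The vector of the integrals of `g` with respect to `μ 1, …, μ d`. -/
def integralVector (μ : Fin d → Measure S) (g : S → ℝ) : Fin d → ℝ := fun i => ∫ x, g x ∂(μ i)

/-- The features may be negative, so the transition law is a signed combination of the `μ i`. Moving
the negative parts to the other side gives an identity of positive measures, which can be
integrated. -/
theorem IsLinearMDP.integral_eq (h : IsLinearMDP M φ θ μ) (s : S) (a : A) {g : S → ℝ}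
    (hg : Measurable g) {B : ℝ} (hB : ∀ x, |g x| ≤ B) :
    ∫ x, g x ∂(M.P (s, a)) = (φ s a).ofLp ⬝ᵥ integralVector μ g := by
  have := M.markov
  have := h.finite_measure
  have hi : ∀ (ν : Measure S) [IsFiniteMeasure ν], Integrable g ν := fun ν _ =>
    integrable_of_abs_le hg hB
  have hm : M.P (s, a) + ∑ i, Real.toNNReal (-φ s a i) • μ i =
      ∑ i, Real.toNNReal (φ s a i) • μ i := by
    ext C hC
    have hne : ∀ c : Fin d → NNReal, (∑ i, c i • μ i) C ≠ ⊤ := fun c => measure_ne_top _ _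
    rw [Measure.add_apply, ← ENNReal.toReal_eq_toReal_iff' (by finiteness) (hne _),
      ENNReal.toReal_add (measure_ne_top _ _) (hne _)]
    have hsum : ∀ c : Fin d → NNReal, ((∑ i, c i • μ i) C).toReal =
        ∑ i, (c i : ℝ) * (μ i).real C := by
      intro c
      rw [Measure.coe_finsetSum, Finset.sum_apply, ENNReal.toReal_sum fun i _ => by
        finiteness]
      refine Finset.sum_congr rfl fun i _ => ?_
      rw [Measure.smul_apply, ENNReal.smul_def, smul_eq_mul, ENNReal.toReal_mul]
      rfl
    rw [hsum, hsum]
    change (M.P (s, a)).real C + _ = _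
    rw [h.transition_eq s a C hC, ← Finset.sum_add_distrib]
    refine Finset.sum_congr rfl fun i _ => ?_
    rw [← add_mul]
    congr 1
    rw [Real.coe_toNNReal', Real.coe_toNNReal']
    have := max_zero_sub_max_neg_zero_eq_self (φ s a i)
    linarith
  have hint : ∀ c : Fin d → NNReal, ∫ x, g x ∂(∑ i, c i • μ i) =
      ∑ i, (c i : ℝ) * ∫ x, g x ∂(μ i) := by
    intro c
    rw [integral_finsetSum_measure fun i _ => hi _]
    refine Finset.sum_congr rfl fun i _ => ?_
    rw [integral_smul_nnreal_measure]; rfl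
  have e := congrArg (fun ν => ∫ x, g x ∂ν) hm
  simp only at e
  rw [integral_add_measure (hi _) (hi _), hint, hint] at e
  rw [eq_sub_of_add_eq e, ← Finset.sum_sub_distrib, dotProduct]
  refine Finset.sum_congr rfl fun i _ => ?_
  rw [← sub_mul, integralVector]
  congr 1
  rw [Real.coe_toNNReal', Real.coe_toNNReal']
  exact max_zero_sub_max_neg_zero_eq_self (φ s a i)

theorem IsLinearMDP.integralVector_dotProduct_self_le (h : IsLinearMDP M φ θ μ) {g : S → ℝ}
    {B : ℝ} (hB : ∀ x, |g x| ≤ B) :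
    integralVector μ g ⬝ᵥ integralVector μ g ≤ B ^ 2 * d := by
  have := h.finite_measure
  have h1 : ∀ i, |integralVector μ g i| ≤ B * (μ i).real Set.univ := fun i => by
    simpa [integralVector] using norm_integral_le_of_norm_le_const (μ := μ i) (f := g) (C := B) (ae_of_all _ hB)
  have h2 : ∑ i, (μ i).real Set.univ ^ 2 ≤ d := by
    have h3 := h.norm_mass_le
    have h4 := pow_le_pow_left₀ (norm_nonneg _) h3 2
    rw [EuclideanSpace.real_norm_sq_eq, Real.sq_sqrt (by positivity)] at h4
    exact h4
  calc integralVector μ g ⬝ᵥ integralVector μ g = ∑ i, |integralVector μ g i| ^ 2 := by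
        simp [dotProduct, sq]
    _ ≤ ∑ i, (B * (μ i).real Set.univ) ^ 2 := by gcongr with i; exact h1 i
    _ = B ^ 2 * ∑ i, (μ i).real Set.univ ^ 2 := by simp only [mul_pow, Finset.mul_sum]
    _ ≤ B ^ 2 * d := by gcongr

/-- Total mass one is `⟨φ, μ(S)⟩`, and the mass vector has norm at most `√d`; so features cannot be
short. This makes the first episode end early. -/
theorem IsLinearMDP.one_le_mul_dotProduct_self (h : IsLinearMDP M φ θ μ) (s : S) (a : A) :
    1 ≤ d * ((φ s a).ofLp ⬝ᵥ (φ s a).ofLp) := by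
  have := M.markov
  have h1 := h.integral_eq s a (g := fun _ => 1) measurable_const (B := 1) (by simp)
  simp only [integral_const, probReal_univ, smul_eq_mul, mul_one] at h1
  have h2 := h.integralVector_dotProduct_self_le (g := fun _ => 1) (B := 1) (by simp)
  have h3 := sq_dotProduct_mulVec_le (B := (1 : Matrix (Fin d) (Fin d) ℝ)) Matrix.PosSemidef.one
    (φ s a).ofLp (integralVector μ fun _ => 1)
  simp only [quadForm, Matrix.one_mulVec] at h3
  rw [← h1] at h3
  have h4 : 0 ≤ (φ s a).ofLp ⬝ᵥ (φ s a).ofLp := by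
    rw [dotProduct_self_eq_norm_sq]; positivity
  nlinarith

theorem IsLinearMDP.one_le_dim (h : IsLinearMDP M φ θ μ) [Nonempty S] [Nonempty A] : 1 ≤ d := by
  have h1 := h.one_le_mul_dotProduct_self (Classical.arbitrary S) (Classical.arbitrary A)
  rcases Nat.eq_zero_or_pos d with hd | hd
  · have : (d : ℝ) = 0 := by exact_mod_cast hd
    rw [this, zero_mul] at h1
    linarith
  · exact hd

end LinearMDP

/-! ## The class of value functions computed by the algorithm -/

/-- All real arguments are allowed, since the matrix of a grid parameter need not be semidefinite
and its quadratic form may be negative. -/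
theorem abs_sqrt_sub_sqrt_le (x y : ℝ) : |√x - √y| ≤ √|x - y| := by
  have key : ∀ x y : ℝ, √x - √y ≤ √|x - y| := by
    intro x y
    rcases le_total x 0 with hx | hx
    · rw [Real.sqrt_eq_zero_of_nonpos hx]
      linarith [Real.sqrt_nonneg y, Real.sqrt_nonneg |x - y|]
    rcases le_total y 0 with hy | hy
    · rw [Real.sqrt_eq_zero_of_nonpos hy, sub_zero]
      exact Real.sqrt_le_sqrt (by rw [abs_of_nonneg (by linarith)]; linarith)
    rw [sub_le_iff_le_add]
    refine Real.sqrt_le_iff.2 ⟨by positivity, ?_⟩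
    have h1 := Real.sq_sqrt hy
    have h2 := Real.sq_sqrt (abs_nonneg (x - y))
    have h3 := mul_nonneg (Real.sqrt_nonneg y) (Real.sqrt_nonneg |x - y|)
    have h4 := le_abs_self (x - y)
    nlinarith
  rw [abs_le]
  constructor
  · have := key y x
    rw [abs_sub_comm] at this
    linarith
  · exact key x y

theorem abs_iInf_sub_iInf_le {α : Type*} [Nonempty α] {f g : α → ℝ} {e : ℝ}
    (hf : BddBelow (Set.range f)) (hg : BddBelow (Set.range g)) (h : ∀ x, |f x - g x| ≤ e) :
    |(⨅ x, f x) - ⨅ x, g x| ≤ e := by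
  have key : ∀ f g : α → ℝ, BddBelow (Set.range f) → (∀ x, |f x - g x| ≤ e) →
      (⨅ x, f x) - e ≤ ⨅ x, g x := fun f g hf h => le_ciInf fun x => by
    have := (abs_le.1 (h x)).2
    linarith [ciInf_le hf x]
  rw [abs_le]
  have h1 := key f g hf h
  have h2 := key g f hg fun x => by rw [abs_sub_comm]; exact h x
  constructor <;> linarith

theorem abs_iSup_sub_iSup_le {α : Type*} [Nonempty α] [Finite α] {f g : α → ℝ} {e : ℝ}
    (h : ∀ x, |f x - g x| ≤ e) : |(⨆ x, f x) - ⨆ x, g x| ≤ e := by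
  have key : ∀ f g : α → ℝ, (∀ x, |f x - g x| ≤ e) → (⨆ x, f x) ≤ (⨆ x, g x) + e :=
    fun f g h => ciSup_le fun x => by
      have := (abs_le.1 (h x)).2
      linarith [le_ciSup (Set.finite_range g).bddAbove x]
  rw [abs_le]
  have h1 := key f g h
  have h2 := key g f fun x => by rw [abs_sub_comm]; exact h x
  constructor <;> linarith

/-- The coordinates of the parameter `(w, m, B)` of a value function. -/
abbrev ValueIndex (d : ℕ) : Type := Fin d ⊕ Unit ⊕ (Fin d × Fin d)

section ValueClass

variable {S A : Type*} {d : ℕ}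

/-- The parameter with the components `w`, `m`, `B`. -/
def valueParam (w : Fin d → ℝ) (m : ℝ) (B : Matrix (Fin d) (Fin d) ℝ) : ValueIndex d → ℝ :=
  Sum.elim w (Sum.elim (fun _ => m) fun ij => B ij.1 ij.2)

/-- The matrix component of a parameter. -/
def paramMatrix (p : ValueIndex d → ℝ) : Matrix (Fin d) (Fin d) ℝ :=
  Matrix.of fun i j => p (Sum.inr (Sum.inr (i, j)))

/-- The action value function with parameter `(w, m, B)`. -/
def classQ (φ : S → A → EuclideanSpace ℝ (Fin d)) (r : S → A → ℝ) (I : Inputs)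
    (p : ValueIndex d → ℝ) (x : S) (b : A) : ℝ :=
  min (r x b + I.gamma * ((φ x b).ofLp ⬝ᵥ (fun i => p (Sum.inl i)) + p (Sum.inr (Sum.inl ()))
    + I.beta * weightedNorm (paramMatrix p) (φ x b))) (1 / (1 - I.gamma))

/-- The maximum over the actions of `classQ`. -/
def classTilde (φ : S → A → EuclideanSpace ℝ (Fin d)) (r : S → A → ℝ) (I : Inputs)
    (p : ValueIndex d → ℝ) (x : S) : ℝ := ⨆ b, classQ φ r I p x b

/-- The clipped value function, minus the infimum of the unclipped one. -/
def spread (H : ℝ) (f : S → ℝ) (x : S) : ℝ := min (f x) ((⨅ y, f y) + H) - ⨅ y, f y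

theorem spread_mem_Icc {H : ℝ} (hH : 0 ≤ H) {f : S → ℝ} (hf : BddBelow (Set.range f)) (x : S) :
    spread H f x ∈ Set.Icc 0 H := by
  have := ciInf_le hf x
  unfold spread
  constructor
  · rw [sub_nonneg]; exact le_min this (by linarith)
  · linarith [min_le_right (f x) ((⨅ y, f y) + H)]

/-- The clipped function and the subtracted infimum each move by at most `e`. -/
theorem abs_spread_sub_le {H e : ℝ} {f g : S → ℝ} (hf : BddBelow (Set.range f))
    (hg : BddBelow (Set.range g)) (h : ∀ x, |f x - g x| ≤ e) (x : S) :
    |spread H f x - spread H g x| ≤ 2 * e := by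
  have : Nonempty S := ⟨x⟩
  have h1 := abs_iInf_sub_iInf_le hf hg h
  have h2 := abs_min_sub_min_le_max (f x) ((⨅ y, f y) + H) (g x) ((⨅ y, g y) + H)
  have h3 : max |f x - g x| |(⨅ y, f y) + H - ((⨅ y, g y) + H)| ≤ e :=
    max_le (h x) (by rw [add_sub_add_right_eq_sub]; exact h1)
  have h4 := abs_le.1 (h2.trans h3)
  have h5 := abs_le.1 h1
  unfold spread
  rw [abs_le]
  constructor <;> linarith [h4.1, h4.2, h5.1, h5.2]

theorem abs_apply_le_one {x : EuclideanSpace ℝ (Fin d)} (hx : ‖x‖ ≤ 1) (i : Fin d) :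
    |x.ofLp i| ≤ 1 := (PiLp.norm_apply_le x i).trans hx

theorem abs_dotProduct_le {x y : Fin d → ℝ} {e : ℝ} (hx : ∀ i, |x i| ≤ 1) (hy : ∀ i, |y i| ≤ e) :
    |x ⬝ᵥ y| ≤ d * e := by
  calc |x ⬝ᵥ y| ≤ ∑ i, |x i * y i| := Finset.abs_sum_le_sum_abs _ _
    _ ≤ ∑ _i : Fin d, e := Finset.sum_le_sum fun i _ => by
        rw [abs_mul]
        nlinarith [hx i, hy i, abs_nonneg (x i), abs_nonneg (y i)]
    _ = d * e := by simp

theorem abs_quadForm_sub_le {B B' : Matrix (Fin d) (Fin d) ℝ} {x : Fin d → ℝ} {e : ℝ}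
    (hx : ∀ i, |x i| ≤ 1) (hB : ∀ i j, |B i j - B' i j| ≤ e) :
    |quadForm B x - quadForm B' x| ≤ d * (d * e) := by
  have h1 : quadForm B x - quadForm B' x = x ⬝ᵥ ((B - B') *ᵥ x) := by
    rw [Matrix.sub_mulVec, dotProduct_sub]; rfl
  rw [h1]
  refine abs_dotProduct_le hx fun i => ?_
  rw [Matrix.mulVec, dotProduct_comm]
  exact abs_dotProduct_le hx fun j => hB i j

/-- The inputs have the signs which make the value functions well-behaved. -/
structure Inputs.Admissible (I : Inputs) : Prop where
  gamma_nonneg : 0 ≤ I.gamma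
  gamma_lt_one : I.gamma < 1
  H_nonneg : 0 ≤ I.H
  beta_nonneg : 0 ≤ I.beta

/-- The modulus of continuity of the value functions in their parameter. -/
def valueModulus (d : ℕ) (I : Inputs) (e : ℝ) : ℝ := d * e + e + I.beta * (d * √e)

variable {φ : S → A → EuclideanSpace ℝ (Fin d)} {r : S → A → ℝ} {I : Inputs}

theorem Inputs.Admissible.cap_pos (hI : I.Admissible) : 0 < 1 / (1 - I.gamma) :=
  one_div_pos.2 (by linarith [hI.gamma_lt_one])

/-- The weight and the offset enter linearly, but the matrix enters under a square root: hence the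
`√e` in the modulus. -/
theorem abs_classQ_sub_le (hI : I.Admissible) (hφ : ∀ x b, ‖φ x b‖ ≤ 1)
    {p p' : ValueIndex d → ℝ} {e : ℝ} (he : 0 ≤ e) (h : ∀ i, |p i - p' i| ≤ e) (x : S) (b : A) :
    |classQ φ r I p x b - classQ φ r I p' x b| ≤ valueModulus d I e := by
  have hx := abs_apply_le_one (hφ x b)
  have h1 : |(φ x b).ofLp ⬝ᵥ (fun i => p (Sum.inl i)) - (φ x b).ofLp ⬝ᵥ fun i => p' (Sum.inl i)|
      ≤ d * e := by
    rw [← dotProduct_sub]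
    exact abs_dotProduct_le hx fun i => h _
  have h2 := h (Sum.inr (Sum.inl ()))
  have h3 : |weightedNorm (paramMatrix p) (φ x b) - weightedNorm (paramMatrix p') (φ x b)| ≤
      d * √e := by
    refine (abs_sqrt_sub_sqrt_le _ _).trans ?_
    have h4 := abs_quadForm_sub_le (B := paramMatrix p) (B' := paramMatrix p') hx
      fun i j => h (Sum.inr (Sum.inr (i, j)))
    calc √|_| ≤ √(d * (d * e)) := Real.sqrt_le_sqrt h4
      _ = d * √e := by
        rw [← mul_assoc, Real.sqrt_mul (by positivity), Real.sqrt_mul_self (by positivity)]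
  refine (abs_min_sub_min_le_max _ _ _ _).trans (max_le ?_ ?_)
  · rw [add_sub_add_left_eq_sub, ← mul_sub, abs_mul, abs_of_nonneg hI.gamma_nonneg]
    refine (mul_le_of_le_one_left (abs_nonneg _) hI.gamma_lt_one.le).trans ?_
    have h5 : |I.beta * weightedNorm (paramMatrix p) (φ x b) -
        I.beta * weightedNorm (paramMatrix p') (φ x b)| ≤ I.beta * (d * √e) := by
      rw [← mul_sub, abs_mul, abs_of_nonneg hI.beta_nonneg]
      exact mul_le_mul_of_nonneg_left h3 hI.beta_nonneg
    unfold valueModulus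
    rw [abs_le] at *
    constructor <;> linarith [h1.1, h1.2, h2.1, h2.2, h5.1, h5.2]
  · rw [sub_self, abs_zero]
    have := hI.beta_nonneg
    unfold valueModulus
    positivity

theorem classTilde_le (I : Inputs) [Nonempty A] (p : ValueIndex d → ℝ) (x : S) :
    classTilde φ r I p x ≤ 1 / (1 - I.gamma) := ciSup_le fun _ => min_le_right _ _

/-- Reward and bonus are nonnegative, and since `m - N ≤ 0` a factor `γ < 1` only raises it.
Iterating this controls the minima of the computed values. -/
theorem le_classTilde (hI : I.Admissible)
    (hr : ∀ x b, r x b ∈ Set.Icc (0 : ℝ) 1) [Nonempty A] [Finite A] {p : ValueIndex d → ℝ}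
    {N m : ℝ} (hN : ∀ x b, |(φ x b).ofLp ⬝ᵥ fun i => p (Sum.inl i)| ≤ N) (hN0 : 0 ≤ N)
    (hm0 : m ≤ 0) (hm : m ≤ p (Sum.inr (Sum.inl ()))) (x : S) :
    m - N ≤ classTilde φ r I p x := by
  have b := Classical.arbitrary A
  refine le_trans ?_ (le_ciSup (f := fun b => classQ φ r I p x b) (Set.finite_range _).bddAbove b)
  refine le_min ?_ (by linarith [hI.cap_pos])
  have h1 := (abs_le.1 (hN x b)).1
  have h2 := mul_nonneg hI.beta_nonneg (Real.sqrt_nonneg (quadForm (paramMatrix p) (φ x b).ofLp))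
  rw [← weightedNorm_eq_sqrt_quadForm] at h2
  have h3 : I.gamma * (m - N) ≤ I.gamma * ((φ x b).ofLp ⬝ᵥ (fun i => p (Sum.inl i))
      + p (Sum.inr (Sum.inl ())) + I.beta * weightedNorm (paramMatrix p) (φ x b)) :=
    mul_le_mul_of_nonneg_left (by linarith) hI.gamma_nonneg
  have h4 : m - N ≤ I.gamma * (m - N) := by nlinarith [hI.gamma_lt_one]
  linarith [(hr x b).1]

theorem bddBelow_classTilde (hI : I.Admissible) (hφ : ∀ x b, ‖φ x b‖ ≤ 1)
    (hr : ∀ x b, r x b ∈ Set.Icc (0 : ℝ) 1) [Nonempty A] [Finite A] (p : ValueIndex d → ℝ) :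
    BddBelow (Set.range (classTilde φ r I p)) := by
  refine ⟨min 0 (p (Sum.inr (Sum.inl ()))) - d * ∑ i : Fin d, |p (Sum.inl i)|, ?_⟩
  rintro _ ⟨x, rfl⟩
  refine le_classTilde hI hr (fun x b => ?_) (by positivity) (min_le_left _ _)
    (min_le_right _ _) x
  exact abs_dotProduct_le (abs_apply_le_one (hφ x b)) fun i =>
    Finset.single_le_sum (f := fun i : Fin d => |p (Sum.inl i)|) (fun _ _ => abs_nonneg _)
      (Finset.mem_univ i)

theorem abs_classTilde_sub_le (hI : I.Admissible) (hφ : ∀ x b, ‖φ x b‖ ≤ 1) [Nonempty A]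
    [Finite A] {p p' : ValueIndex d → ℝ} {e : ℝ} (he : 0 ≤ e) (h : ∀ i, |p i - p' i| ≤ e) (x : S) :
    |classTilde φ r I p x - classTilde φ r I p' x| ≤ valueModulus d I e :=
  abs_iSup_sub_iSup_le fun b => abs_classQ_sub_le hI hφ he h x b

/-- An infimum over an uncountable state space need not depend measurably on the data. Here it
depends continuously on finitely many real parameters, and measurability follows from theirs. -/
theorem continuous_iInf_classTilde (hI : I.Admissible) (hφ : ∀ x b, ‖φ x b‖ ≤ 1)
    (hr : ∀ x b, r x b ∈ Set.Icc (0 : ℝ) 1) [Nonempty S] [Nonempty A] [Finite A] :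
    Continuous fun p : ValueIndex d → ℝ => ⨅ x, classTilde φ r I p x := by
  rw [continuous_iff_continuousAt]
  intro p₀
  rw [ContinuousAt, tendsto_iff_dist_tendsto_zero]
  have h0 : valueModulus d I (dist p₀ p₀) = 0 := by simp [valueModulus]
  have hlim : Filter.Tendsto (fun p => valueModulus d I (dist p p₀)) (nhds p₀) (nhds 0) := by
    rw [← h0]
    have : Continuous fun p : ValueIndex d → ℝ => valueModulus d I (dist p p₀) := by
      unfold valueModulus
      fun_prop
    exact this.tendsto p₀
  refine squeeze_zero (fun _ => dist_nonneg) (fun p => ?_) hlim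
  rw [Real.dist_eq]
  exact abs_iInf_sub_iInf_le (bddBelow_classTilde hI hφ hr p) (bddBelow_classTilde hI hφ hr p₀)
    fun x => abs_classTilde_sub_le hI hφ dist_nonneg (fun i => by
      rw [← Real.dist_eq]; exact dist_le_pi_dist p p₀ i) x

end ValueClass

/-! ## Measurability of the computed functions -/

section Measurability

variable {S A Ω : Type*} [MeasurableSpace S] [MeasurableSpace A] [MeasurableSpace Ω] {d : ℕ}
variable {φ : S → A → EuclideanSpace ℝ (Fin d)} {r : S → A → ℝ} {I : Inputs}

theorem measurable_feature_comp [Finite A] [MeasurableSingletonClass A]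
    (hφ : ∀ b, Measurable fun x => φ x b) {X : Ω → S} {Y : Ω → A} (hX : Measurable X)
    (hY : Measurable Y) (i : Fin d) : Measurable fun ω => (φ (X ω) (Y ω)).ofLp i := by
  have h : Measurable fun q : S × A => (φ q.1 q.2).ofLp i :=
    measurable_from_prod_countable_left fun b =>
      ((EuclideanSpace.proj (𝕜 := ℝ) i).continuous.measurable).comp (hφ b)
  exact h.comp (hX.prodMk hY)

theorem measurable_dotProduct {x y : Ω → Fin d → ℝ} (hx : ∀ i, Measurable fun ω => x ω i)
    (hy : ∀ i, Measurable fun ω => y ω i) : Measurable fun ω => x ω ⬝ᵥ y ω :=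
  Finset.measurable_sum _ fun i _ => (hx i).mul (hy i)

theorem measurable_mulVec {B : Ω → Matrix (Fin d) (Fin d) ℝ} {x : Ω → Fin d → ℝ}
    (hB : ∀ i j, Measurable fun ω => B ω i j) (hx : ∀ i, Measurable fun ω => x ω i) (i : Fin d) :
    Measurable fun ω => (B ω *ᵥ x ω) i := measurable_dotProduct (hB i) hx

theorem measurable_quadForm {B : Ω → Matrix (Fin d) (Fin d) ℝ} {x : Ω → Fin d → ℝ}
    (hB : ∀ i j, Measurable fun ω => B ω i j) (hx : ∀ i, Measurable fun ω => x ω i) :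
    Measurable fun ω => quadForm (B ω) (x ω) :=
  measurable_dotProduct hx fun i => measurable_mulVec hB hx i

/-- The rank-one recursion expresses the inverse by arithmetic operations on the features. -/
theorem measurable_gram_inv {x : ℕ → Ω → Fin d → ℝ} {n : ℕ}
    (hx : ∀ τ, 1 ≤ τ → τ ≤ n → ∀ i, Measurable fun ω => x τ ω i) (i j : Fin d) :
    Measurable fun ω => (gram (fun τ => x τ ω) n)⁻¹ i j := by
  induction n generalizing i j with
  | zero => simp [gram]
  | succ n ih =>
    have ih' := ih fun τ h1 h2 => hx τ h1 (by omega)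
    have hn := hx (n + 1) (by omega) le_rfl
    simp only [gram, inv_add_vecMulVec (posDef_gram _ n), Matrix.sub_apply, Matrix.smul_apply,
      Matrix.vecMulVec_apply, smul_eq_mul]
    exact (ih' i j).sub ((((measurable_quadForm ih' hn).const_add 1).inv).mul
      ((measurable_mulVec ih' hn i).mul (measurable_mulVec ih' hn j)))

theorem measurable_gram_det {x : ℕ → Ω → Fin d → ℝ} {n : ℕ}
    (hx : ∀ τ, 1 ≤ τ → τ ≤ n → ∀ i, Measurable fun ω => x τ ω i) :
    Measurable fun ω => (gram (fun τ => x τ ω) n).det := by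
  induction n with
  | zero => simp [gram]
  | succ n ih =>
    have hx' : ∀ τ, 1 ≤ τ → τ ≤ n → ∀ i, Measurable fun ω => x τ ω i :=
      fun τ h1 h2 => hx τ h1 (by omega)
    simp only [det_gram_succ]
    exact (ih hx').mul ((measurable_quadForm (measurable_gram_inv hx')
      (hx (n + 1) (by omega) le_rfl)).const_add 1)

omit [MeasurableSpace A] in
theorem measurable_classTilde [Finite A] (hφ : ∀ b, Measurable fun x => φ x b)
    (hr : ∀ b, Measurable fun x => r x b) {p : Ω → ValueIndex d → ℝ} {X : Ω → S}
    (hp : Measurable p) (hX : Measurable X) :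
    Measurable fun ω => classTilde φ r I (p ω) (X ω) := by
  have hp' : ∀ i, Measurable fun ω => p ω i := fun i => (measurable_pi_apply i).comp hp
  refine Measurable.iSup fun b => Measurable.min ?_ measurable_const
  have hφ' : ∀ i, Measurable fun ω => (φ (X ω) b).ofLp i := fun i =>
    ((EuclideanSpace.proj (𝕜 := ℝ) i).continuous.measurable).comp ((hφ b).comp hX)
  refine ((hr b).comp hX).add ((((measurable_dotProduct hφ' fun i => hp' _).add (hp' _)).add
    (Measurable.const_mul ?_ _)).const_mul _)
  exact (measurable_quadForm (fun i j => hp' _) hφ').sqrt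

omit [MeasurableSpace A] in
theorem measurable_classTilde_right [Finite A] (hφ : ∀ b, Measurable fun x => φ x b)
    (hr : ∀ b, Measurable fun x => r x b) (p : ValueIndex d → ℝ) :
    Measurable (classTilde φ r I p) :=
  measurable_classTilde hφ hr (p := fun _ : S => p) measurable_const measurable_id

/-- The history enters each iterate only through the parameter `(w, m, Λ⁻¹)`, which is measurable by
the previous iterate; joint measurability with the state allows evaluation at random states. -/
theorem measurable_valueIteration [Nonempty S] [Nonempty A] [Finite A]
    [MeasurableSingletonClass A] (hI : I.Admissible) (hφ1 : ∀ x b, ‖φ x b‖ ≤ 1)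
    (hr1 : ∀ x b, r x b ∈ Set.Icc (0 : ℝ) 1) (hφ : ∀ b, Measurable fun x => φ x b)
    (hr : ∀ b, Measurable fun x => r x b) {X : ℕ → Ω → S} {Y : ℕ → Ω → A} {n : ℕ}
    (hX : ∀ τ, 1 ≤ τ → τ ≤ n + 1 → Measurable (X τ)) (hY : ∀ τ, 1 ≤ τ → τ ≤ n → Measurable (Y τ))
    (j : ℕ) :
    let V := fun ω => valueIteration φ r I (fun t => X t ω) (fun t => Y t ω)
      (gram (featureSeq φ (fun t => X t ω) (fun t => Y t ω)) n) n j
    Measurable (fun q : Ω × S => (V q.1).clipped q.2) ∧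
      Measurable (fun ω => ⨅ x, (V ω).tilde x) := by
  have hf : ∀ τ, 1 ≤ τ → τ ≤ n → ∀ i,
      Measurable fun ω => featureSeq φ (fun t => X t ω) (fun t => Y t ω) τ i :=
    fun τ h1 h2 i => measurable_feature_comp hφ (hX τ h1 (by omega)) (hY τ h1 h2) i
  induction j with
  | zero =>
    exact ⟨measurable_const,
      (measurable_const : Measurable fun _ : Ω => ⨅ _x : S, 1 / (1 - I.gamma))⟩
  | succ j ih =>
    obtain ⟨h1, h2⟩ := ih
    have hw : ∀ i, Measurable fun ω => regressionWeight φ (fun t => X t ω) (fun t => Y t ω)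
        (gram (featureSeq φ (fun t => X t ω) (fun t => Y t ω)) n) n
        (valueIteration φ r I (fun t => X t ω) (fun t => Y t ω)
          (gram (featureSeq φ (fun t => X t ω) (fun t => Y t ω)) n) n j) i := by
      refine measurable_mulVec (measurable_gram_inv
        (x := fun τ ω => featureSeq φ (fun t => X t ω) (fun t => Y t ω) τ) hf) fun i => ?_
      simp only [Finset.sum_apply, Pi.smul_apply, smul_eq_mul]
      refine Finset.measurable_sum _ fun τ hτ => ?_
      rw [Finset.mem_Icc] at hτ
      exact ((h1.comp (measurable_id.prodMk (hX (τ + 1) (by omega) (by omega)))).sub h2).mul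
        (hf τ hτ.1 hτ.2 i)
    have hp : Measurable fun ω => valueParam (regressionWeight φ (fun t => X t ω) (fun t => Y t ω)
        (gram (featureSeq φ (fun t => X t ω) (fun t => Y t ω)) n) n
        (valueIteration φ r I (fun t => X t ω) (fun t => Y t ω)
          (gram (featureSeq φ (fun t => X t ω) (fun t => Y t ω)) n) n j))
        (⨅ x, (valueIteration φ r I (fun t => X t ω) (fun t => Y t ω)
          (gram (featureSeq φ (fun t => X t ω) (fun t => Y t ω)) n) n j).tilde x)
        (gram (featureSeq φ (fun t => X t ω) (fun t => Y t ω)) n)⁻¹ := by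
      refine measurable_pi_lambda _ fun i => ?_
      rcases i with i | i | ⟨i, k⟩
      · exact hw i
      · exact h2
      · exact measurable_gram_inv
          (x := fun τ ω => featureSeq φ (fun t => X t ω) (fun t => Y t ω) τ) hf i k
    have hinf := (continuous_iInf_classTilde (r := r) hI hφ1 hr1).measurable.comp hp
    refine ⟨?_, hinf⟩
    exact (measurable_classTilde hφ hr (hp.comp measurable_fst) measurable_snd).min
      ((hinf.comp measurable_fst).add_const _)

end Measurability

/-! ## Self-normalised concentration, uniformly over the value functions -/

section Noise

variable {S A : Type*} [MeasurableSpace S] [MeasurableSpace A] {d : ℕ}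

/-- `∑_{τ = 1}^n (g(s_{τ+1}) - ∫ g dP(· | s_τ, a_τ)) φ(s_τ, a_τ)`. -/
def noise (M : MDP S A) (φ : S → A → EuclideanSpace ℝ (Fin d)) (s : ℕ → S) (a : ℕ → A)
    (g : S → ℝ) (n : ℕ) : Fin d → ℝ :=
  ∑ τ ∈ Finset.Icc 1 n, (g (s (τ + 1)) - ∫ x, g x ∂(M.P (s τ, a τ))) • featureSeq φ s a τ

/-- A crude triangle inequality. It is used only where the loss disappears in a logarithm or is
beaten by the small grid step. -/
theorem sqrt_quadForm_sum_le {B : Matrix (Fin d) (Fin d) ℝ} (hB : B.PosSemidef) {ι : Type*}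
    (u : Finset ι) (c : ι → ℝ) (x : ι → Fin d → ℝ) {e : ℝ} (hc : ∀ i ∈ u, |c i| ≤ e)
    (hx : ∀ i ∈ u, √(quadForm B (x i)) ≤ 1) :
    √(quadForm B (∑ i ∈ u, c i • x i)) ≤ u.card * e := by
  classical
  induction u using Finset.induction_on with
  | empty => simp [quadForm]
  | insert i u hi ih =>
    rw [Finset.sum_insert hi, Finset.card_insert_of_notMem hi]
    refine (sqrt_quadForm_add_le hB _ _).trans ?_
    have h1 := ih (fun j hj => hc j (Finset.mem_insert_of_mem hj))
      fun j hj => hx j (Finset.mem_insert_of_mem hj)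
    have h2 : √(quadForm B (c i • x i)) ≤ e := by
      rw [quadForm_smul, Real.sqrt_mul (sq_nonneg _), Real.sqrt_sq_eq_abs]
      exact (mul_le_of_le_one_right (abs_nonneg _) (hx i (Finset.mem_insert_self i u))).trans
        (hc i (Finset.mem_insert_self i u))
    push_cast
    linarith

variable {M : MDP S A} {φ : S → A → EuclideanSpace ℝ (Fin d)}

omit [MeasurableSpace S] [MeasurableSpace A] in
theorem sqrt_quadForm_featureSeq_le (hφ : ∀ x b, ‖φ x b‖ ≤ 1) (s : ℕ → S) (a : ℕ → A)
    (n τ : ℕ) :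
    √(quadForm (gram (featureSeq φ s a) n)⁻¹ (featureSeq φ s a τ)) ≤ 1 := by
  rw [Real.sqrt_le_one]
  exact (quadForm_gram_inv_le _ _ _).trans (featureSeq_dotProduct_le hφ s a τ)

theorem sqrt_quadForm_noise_le (hφ : ∀ x b, ‖φ x b‖ ≤ 1) (s : ℕ → S) (a : ℕ → A) {g : S → ℝ}
    (hg : Measurable g) {l c : ℝ} (h : ∀ x, g x ∈ Set.Icc l (l + c)) (n : ℕ) :
    √(quadForm (gram (featureSeq φ s a) n)⁻¹ (noise M φ s a g n)) ≤ n * c := by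
  have := M.markov
  have h1 := sqrt_quadForm_sum_le (posSemidef_gram_inv (featureSeq φ s a) n) (Finset.Icc 1 n)
    (fun τ => g (s (τ + 1)) - ∫ x, g x ∂(M.P (s τ, a τ))) (featureSeq φ s a) (e := c)
    (fun τ _ => by
      have h2 := integral_mem_Icc (μ := M.P (s τ, a τ)) hg h
      have h3 := h (s (τ + 1))
      rw [abs_le]
      constructor <;> linarith [h2.1, h2.2, h3.1, h3.2])
    fun τ _ => sqrt_quadForm_featureSeq_le hφ s a n τ
  simpa [noise] using h1

theorem noise_sub (s : ℕ → S) (a : ℕ → A) {g g' : S → ℝ} (hg : Measurable g)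
    (hg' : Measurable g') {B : ℝ} (h : ∀ x, |g x| ≤ B) (h' : ∀ x, |g' x| ≤ B) (n : ℕ) :
    noise M φ s a (fun x => g x - g' x) n = noise M φ s a g n - noise M φ s a g' n := by
  have := M.markov
  rw [noise, noise, noise, ← Finset.sum_sub_distrib]
  refine Finset.sum_congr rfl fun τ _ => ?_
  rw [integral_sub (integrable_of_abs_le hg h) (integrable_of_abs_le hg' h'), ← sub_smul]
  congr 1
  ring

theorem noise_const_mul (s : ℕ → S) (a : ℕ → A) (g : S → ℝ) (c : ℝ) (n : ℕ) :
    noise M φ s a (fun x => c * g x) n = c • noise M φ s a g n := by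
  rw [noise, noise, Finset.smul_sum]
  refine Finset.sum_congr rfl fun τ _ => ?_
  rw [integral_const_mul, ← mul_sub, mul_smul]

/-- Completing the square: the exponent of the supermartingale at an approximate maximiser. -/
theorem quadForm_inv_le_of_approx {B : Matrix (Fin d) (Fin d) ℝ} (hB : B.PosDef)
    (S z : Fin d → ℝ) {ℓ : ℝ} (hz : z ⬝ᵥ S - quadForm B z / 8 ≤ ℓ)
    (he : quadForm B (z - (4 : ℝ) • (B⁻¹ *ᵥ S)) ≤ 8) : quadForm B⁻¹ S ≤ (ℓ + 1) / 2 := by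
  have hu : IsUnit B.det := hB.det_pos.ne'.isUnit
  set y := B⁻¹ *ᵥ S with hy
  have hBy : B *ᵥ y = S := by
    rw [hy, Matrix.mulVec_mulVec, Matrix.mul_nonsing_inv _ hu, Matrix.one_mulVec]
  set e := z - (4 : ℝ) • y with hedef
  have hze : z = (4 : ℝ) • y + e := by rw [hedef]; abel
  have h1 : quadForm B y = quadForm B⁻¹ S := by
    rw [quadForm, hBy, dotProduct_comm, hy]; rfl
  have h2 : ((4 : ℝ) • y) ⬝ᵥ (B *ᵥ e) = 4 * (e ⬝ᵥ S) := by
    rw [dotProduct_mulVec_comm_of_isSymm hB.isHermitian, Matrix.mulVec_smul, hBy,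
      dotProduct_smul, smul_eq_mul]
  have h3 : z ⬝ᵥ S = 4 * quadForm B⁻¹ S + e ⬝ᵥ S := by
    rw [hze, add_dotProduct, smul_dotProduct, smul_eq_mul, hy, dotProduct_comm (B⁻¹ *ᵥ S) S]; rfl
  -- With `z = 4y + e` the cross terms cancel and the exponent is `2 ‖S‖²_{B⁻¹} - eᵀBe/8`, whose
  -- last term is at most one.
  rw [h3, hze, quadForm_add hB.isHermitian, quadForm_smul, h1, h2] at hz
  linarith

theorem exists_grid_point {R ε : ℝ} (hε : 0 < ε) {N : ℕ} (hN : R + ε ≤ N * ε) {y : ℝ}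
    (hy : |y| ≤ R) : ∃ k : Fin (2 * N + 1), |y - ((k : ℕ) - N : ℝ) * ε| ≤ ε := by
  have hy' := abs_le.1 hy
  have h1 : 0 ≤ y / ε + N := by
    rw [← sub_le_iff_le_add, zero_sub, le_div_iff₀ hε]; linarith
  have h2 := Nat.floor_le h1
  have h3 := Nat.lt_floor_add_one (y / ε + N)
  have h4 : y / ε + N < 2 * N + 1 := by
    have : y / ε ≤ N := by rw [div_le_iff₀ hε]; linarith
    linarith
  refine ⟨⟨⌊y / ε + N⌋₊, by
    rw [Nat.floor_lt h1]; push_cast; exact h4⟩, ?_⟩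
  have e1 : y - ((⌊y / ε + N⌋₊ : ℝ) - N) * ε = (y / ε + N - ⌊y / ε + N⌋₊) * ε := by
    field_simp; ring
  simp only [e1, abs_mul, abs_of_pos hε]
  rw [abs_of_nonneg (by linarith)]
  exact mul_le_of_le_one_left hε.le (by linarith)

end Noise

/-! ### Union bound over a grid of value functions and directions. -/

section Concentration

variable {S A Ω : Type*} [MeasurableSpace S] [MeasurableSpace A] [mΩ : MeasurableSpace Ω]
variable {M : MDP S A} {T : ℕ} {Pr : Measure Ω} {F : Filtration ℕ mΩ}
variable {X : ℕ → Ω → S} {Y : ℕ → Ω → A} {d : ℕ} {φ : S → A → EuclideanSpace ℝ (Fin d)}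

theorem IsInteraction.measurable_featureSeq [Finite A] [MeasurableSingletonClass A]
    (h : IsInteraction M T Pr F X Y) (hφ : ∀ b, Measurable fun x => φ x b) {t : ℕ} (h1 : 1 ≤ t)
    (h2 : t ≤ T) (i : Fin d) :
    Measurable fun ω : Past F t => featureSeq φ (fun t => X t ω) (fun t => Y t ω) t i :=
  measurable_feature_comp (Ω := Past F t) hφ (h.measurable_state t h1 (by omega))
    (h.measurable_action t h1 h2) i

variable [IsProbabilityMeasure Pr] [Finite A] [MeasurableSingletonClass A]

/-- Along a fixed direction the noise is a sum of martingale differences with predictable ranges `|z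
· φ_τ|`. Their compensator is `zᵀΛz/8` without the regulariser, which only helps. -/
theorem IsInteraction.measure_noise_gt_le (h : IsInteraction M T Pr F X Y)
    (hφ : ∀ b, Measurable fun x => φ x b) {g : S → ℝ} (hg : Measurable g)
    (hg1 : ∀ x, g x ∈ Set.Icc (0 : ℝ) 1) (z : Fin d → ℝ) {n : ℕ} (hn : n ≤ T) {p : ℝ}
    (hp : 0 < p) :
    Pr {ω | Real.log (1 / p) ≤ z ⬝ᵥ noise M φ (fun t => X t ω) (fun t => Y t ω) g n -
      quadForm (gram (featureSeq φ (fun t => X t ω) (fun t => Y t ω)) n) z / 8} ≤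
      ENNReal.ofReal p := by
  set c : ℕ → Ω → ℝ := fun t ω => z ⬝ᵥ featureSeq φ (fun t => X t ω) (fun t => Y t ω) t with hc
  have hcm : ∀ t, 1 ≤ t → t ≤ n → Measurable fun ω : Past F t => c t ω := fun t h1 h2 =>
    measurable_dotProduct (fun i => measurable_const)
      fun i => h.measurable_featureSeq hφ h1 (by omega) i
  refine (measure_mono ?_).trans (h.measure_sum_gt_le hn (G := fun t ω x => c t ω * g x)
    (l := fun t ω => min 0 (c t ω)) (c := fun t ω => |c t ω|) ?_ ?_ ?_ hp)
  · intro ω hω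
    rw [Set.mem_ofPred_eq] at hω ⊢
    refine le_trans hω ?_
    have e1 : z ⬝ᵥ noise M φ (fun t => X t ω) (fun t => Y t ω) g n =
        ∑ t ∈ Finset.Icc 1 n, deviation M X Y (fun t ω x => c t ω * g x) t ω := by
      rw [noise, dotProduct_sum]
      refine Finset.sum_congr rfl fun t _ => ?_
      rw [deviation, integral_const_mul, dotProduct_smul, smul_eq_mul]
      simp only [hc]
      ring
    rw [e1, Finset.sum_sub_distrib, quadForm_gram]
    have e2 : ∑ t ∈ Finset.Icc 1 n, |c t ω| ^ 2 / 8 = (∑ t ∈ Finset.Icc 1 n,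
        (featureSeq φ (fun t => X t ω) (fun t => Y t ω) t ⬝ᵥ z) ^ 2) / 8 := by
      rw [Finset.sum_div]
      refine Finset.sum_congr rfl fun t _ => ?_
      rw [sq_abs, dotProduct_comm]
    rw [e2]
    have e3 : 0 ≤ z ⬝ᵥ z := by
      simpa [quadForm] using quadForm_nonneg (B := (1 : Matrix (Fin d) (Fin d) ℝ))
        Matrix.PosSemidef.one z
    linarith
  · intro t h1 h2
    exact ((hcm t h1 h2).comp measurable_fst).mul (hg.comp measurable_snd)
  · intro t h1 h2
    exact (hcm t h1 h2).abs
  · intro t h1 h2 ω x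
    have := hg1 x
    rcases le_total 0 (c t ω) with h0 | h0
    · rw [min_eq_left h0, abs_of_nonneg h0]
      constructor <;> nlinarith [this.1, this.2]
    · rw [min_eq_right h0, abs_of_nonpos h0]
      constructor <;> nlinarith [this.1, this.2]

/-- The union bound over the time steps and a finite family of functions and directions. -/
theorem IsInteraction.measure_exists_noise_gt_le (h : IsInteraction M T Pr F X Y)
    (hφ : ∀ b, Measurable fun x => φ x b) {κ : Type*} [Fintype κ] [Nonempty κ] {g : κ → S → ℝ}
    (hg : ∀ k, Measurable (g k)) (hg1 : ∀ k x, g k x ∈ Set.Icc (0 : ℝ) 1) (z : κ → Fin d → ℝ)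
    (hT : 1 ≤ T) {p : ℝ} (hp : 0 < p) :
    Pr {ω | ∃ n ∈ Finset.Icc 1 T, ∃ k, Real.log (T * Fintype.card κ / p) ≤
      z k ⬝ᵥ noise M φ (fun t => X t ω) (fun t => Y t ω) (g k) n -
      quadForm (gram (featureSeq φ (fun t => X t ω) (fun t => Y t ω)) n) (z k) / 8} ≤
      ENNReal.ofReal p := by
  have hT' : (0 : ℝ) < T := by exact_mod_cast hT
  have hκ : (0 : ℝ) < Fintype.card κ := by exact_mod_cast Fintype.card_pos
  set p' := p / (T * Fintype.card κ) with hp'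
  have hp0 : 0 < p' := by positivity
  have e1 : (T * Fintype.card κ / p : ℝ) = 1 / p' := by rw [hp', one_div_div]
  rw [e1]
  have hsub : {ω | ∃ n ∈ Finset.Icc 1 T, ∃ k, Real.log (1 / p') ≤
      z k ⬝ᵥ noise M φ (fun t => X t ω) (fun t => Y t ω) (g k) n -
      quadForm (gram (featureSeq φ (fun t => X t ω) (fun t => Y t ω)) n) (z k) / 8} =
      ⋃ n ∈ Finset.Icc 1 T, ⋃ k ∈ (Finset.univ : Finset κ), {ω | Real.log (1 / p') ≤
      z k ⬝ᵥ noise M φ (fun t => X t ω) (fun t => Y t ω) (g k) n -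
      quadForm (gram (featureSeq φ (fun t => X t ω) (fun t => Y t ω)) n) (z k) / 8} := by
    ext ω; simp
  rw [hsub]
  calc _ ≤ ∑ _n ∈ Finset.Icc 1 T, ∑ _k : κ, ENNReal.ofReal p' := by
        refine (measure_biUnion_finset_le _ _).trans (Finset.sum_le_sum fun n hn => ?_)
        refine (measure_biUnion_finset_le _ _).trans (Finset.sum_le_sum fun k _ => ?_)
        exact h.measure_noise_gt_le hφ (hg k) (hg1 k) (z k) (Finset.mem_Icc.1 hn).2 hp0
    _ = ENNReal.ofReal p := by
        simp only [Finset.sum_const, Finset.card_univ, Nat.card_Icc, Nat.add_sub_cancel,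
          nsmul_eq_mul]
        rw [← ENNReal.ofReal_natCast, ← ENNReal.ofReal_natCast, ← ENNReal.ofReal_mul (by positivity),
          ← ENNReal.ofReal_mul (by positivity)]
        congr 1
        rw [hp']
        field_simp

omit [MeasurableSpace A] [MeasurableSingletonClass A] [Finite A] in
theorem measurable_spread {H : ℝ} {f : S → ℝ} (hf : Measurable f) : Measurable (spread H f) :=
  (hf.min measurable_const).sub_const _

/-- The uniform bound for the noise, outside of an event of small probability. -/
theorem IsInteraction.measure_uniform_noise_le [Nonempty S] [Nonempty A]
    (h : IsInteraction M T Pr F X Y) {I : Inputs} (hI : I.Admissible)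
    (hφ1 : ∀ x b, ‖φ x b‖ ≤ 1) (hφ : ∀ b, Measurable fun x => φ x b) (hT : 1 ≤ T) {R ε : ℝ}
    (hε : 0 < ε) {N : ℕ} (hN : R + ε ≤ N * ε) (hR : 4 * T ≤ R)
    (hε' : (1 + T) * (d * ε ^ 2) ≤ 8) {p : ℝ} (hp : 0 < p) :
    Pr {ω | ¬ ∀ n ∈ Finset.Icc 1 T, ∀ q : ValueIndex d → ℝ, (∀ i, |q i| ≤ R) →
      √(quadForm (gram (featureSeq φ (fun t => X t ω) (fun t => Y t ω)) n)⁻¹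
        (noise M φ (fun t => X t ω) (fun t => Y t ω) (spread I.H (classTilde φ M.r I q)) n)) ≤
      I.H * √((Real.log (T * (2 * N + 1 : ℝ) ^ (d + (1 + d * d) + d) / p) + 1) / 2) +
        T * (4 * valueModulus d I ε)} ≤ ENNReal.ofReal p := by
  classical
  have hr : ∀ b, Measurable fun x => M.r x b := fun b =>
    M.measurable_r.comp measurable_prodMk_right
  have hP := M.markov
  -- A grid index is a parameter of a value function together with a direction.
  let κ := (ValueIndex d → Fin (2 * N + 1)) × (Fin d → Fin (2 * N + 1))
  let grid : Fin (2 * N + 1) → ℝ := fun k => ((k : ℕ) - N : ℝ) * ε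
  let f : (ValueIndex d → Fin (2 * N + 1)) → S → ℝ := fun k =>
    spread I.H (classTilde φ M.r I fun i => grid (k i))
  have hbdd : ∀ q : ValueIndex d → ℝ, BddBelow (Set.range (classTilde φ M.r I q)) :=
    bddBelow_classTilde hI hφ1 M.r_mem
  have hsm : ∀ q : ValueIndex d → ℝ, Measurable (spread I.H (classTilde φ M.r I q)) := fun q =>
    measurable_spread (measurable_classTilde_right hφ hr q)
  have hsI : ∀ (q : ValueIndex d → ℝ) x, spread I.H (classTilde φ M.r I q) x ∈ Set.Icc 0 I.H :=
    fun q x => spread_mem_Icc hI.H_nonneg (hbdd q) x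
  have hcard : (Fintype.card κ : ℝ) = (2 * N + 1 : ℝ) ^ (d + (1 + d * d) + d) := by
    simp only [κ, ValueIndex, Fintype.card_prod, Fintype.card_fun, Fintype.card_sum,
      Fintype.card_fin, Fintype.card_unit]
    push_cast
    rw [← pow_add]
  -- The functions are scaled to the unit interval; for `H = 0` the inverse is zero and the scaled
  -- function vanishes, as the function itself does.
  have hu := h.measure_exists_noise_gt_le hφ (κ := κ) (g := fun k x => I.H⁻¹ * f k.1 x)
    (fun k => (hsm _).const_mul _) (fun k x => ?_) (fun k i => grid (k.2 i)) hT hp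
  swap
  · have := hsI (fun i => grid (k.1 i)) x
    refine ⟨mul_nonneg (inv_nonneg.2 hI.H_nonneg) this.1, ?_⟩
    exact inv_mul_le_one_of_le₀ this.2 hI.H_nonneg
  refine (measure_mono fun ω hω => ?_).trans hu
  rw [Set.mem_ofPred_eq] at hω ⊢
  by_contra hgood
  push Not at hgood
  apply hω
  intro n hn q hq
  have hnT : (n : ℝ) ≤ T := by exact_mod_cast (Finset.mem_Icc.1 hn).2
  set s : ℕ → S := fun t => X t ω
  set a : ℕ → A := fun t => Y t ω
  set x := featureSeq φ s a
  have hB := posSemidef_gram_inv x n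
  choose k hk using fun i => exists_grid_point hε hN (hq i)
  set g := spread I.H (classTilde φ M.r I q)
  set ρ := valueModulus d I ε
  have hdist : ∀ y, |g y - f k y| ≤ 2 * ρ := fun y =>
    abs_spread_sub_le (hbdd q) (hbdd _) (fun y => abs_classTilde_sub_le hI hφ1 hε.le hk y) y
  have habs : ∀ (q : ValueIndex d → ℝ) y, |spread I.H (classTilde φ M.r I q) y| ≤ I.H :=
    fun q y => by rw [abs_of_nonneg (hsI q y).1]; exact (hsI q y).2
  -- The function is replaced by its neighbour on the grid; the noise of the difference is bounded
  -- trivially.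
  have hsplit : noise M φ s a g n =
      I.H • noise M φ s a (fun y => I.H⁻¹ * f k y) n + noise M φ s a (fun y => g y - f k y) n := by
    have e : (fun y => I.H * (I.H⁻¹ * f k y)) = f k := by
      funext y
      rcases eq_or_ne I.H 0 with h0 | h0
      · have := hsI (fun i => grid (k i)) y
        rw [h0] at this ⊢
        rw [zero_mul]
        change 0 = spread I.H _ y
        rw [h0]
        exact le_antisymm this.1 this.2
      · rw [mul_inv_cancel_left₀ h0]
    rw [← noise_const_mul, e, noise_sub s a (hsm q) (hsm _) (habs q) (habs _)]
    abel
  have hrest : √(quadForm (gram x n)⁻¹ (noise M φ s a (fun y => g y - f k y) n)) ≤ T * (4 * ρ) := by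
    have h1 := sqrt_quadForm_noise_le (M := M) hφ1 s a (g := fun y => g y - f k y)
      ((hsm q).sub (hsm _)) (l := -(2 * ρ)) (c := 4 * ρ)
      (fun y => by have := abs_le.1 (hdist y); constructor <;> linarith [this.1, this.2]) n
    have hρ : 0 ≤ 4 * ρ := by
      have := (abs_nonneg _).trans (hdist (Classical.arbitrary S))
      linarith
    exact h1.trans (mul_le_mul_of_nonneg_right hnT hρ)
  set W := noise M φ s a (fun y => I.H⁻¹ * f k y) n
  have hW1 : √(quadForm (gram x n)⁻¹ W) ≤ T := by
    have h1 := sqrt_quadForm_noise_le (M := M) hφ1 s a (g := fun y => I.H⁻¹ * f k y)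
      ((hsm _).const_mul _) (l := 0) (c := 1)
      (fun y => by
        have := hsI (fun i => grid (k i)) y
        refine ⟨mul_nonneg (inv_nonneg.2 hI.H_nonneg) this.1, ?_⟩
        rw [zero_add]
        exact inv_mul_le_one_of_le₀ this.2 hI.H_nonneg) n
    linarith
  -- The maximising direction has coordinates at most `4T ≤ R`, so it lies within reach of the grid.
  have hz : ∀ i, |((4 : ℝ) • ((gram x n)⁻¹ *ᵥ W)) i| ≤ R := by
    intro i
    have h1 := abs_dotProduct_mulVec_le hB (Pi.single i 1) W
    rw [single_one_dotProduct] at h1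
    have h2 : √(quadForm (gram x n)⁻¹ (Pi.single i 1)) ≤ 1 := by
      rw [Real.sqrt_le_one]
      exact (quadForm_gram_inv_le x n _).trans (by simp)
    rw [Pi.smul_apply, smul_eq_mul, abs_mul, abs_of_pos (by norm_num : (0 : ℝ) < 4)]
    have h3 := Real.sqrt_nonneg (quadForm (gram x n)⁻¹ W)
    nlinarith
  choose k' hk' using fun i => exists_grid_point hε hN (hz i)
  have hg := hgood n hn (k, k')
  -- The rounding error of the direction is at most `ε` in each coordinate, so its form under `Λ ≤ 1
  -- + T` is at most `8`.
  have hmain := quadForm_inv_le_of_approx (posDef_gram x n) W (fun i => grid (k' i)) hg.le (by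
    refine (quadForm_gram_le (fun τ _ _ => featureSeq_dotProduct_le hφ1 s a τ) _).trans ?_
    have h1 : ((fun i => grid (k' i)) - (4 : ℝ) • ((gram x n)⁻¹ *ᵥ W)) ⬝ᵥ
        ((fun i => grid (k' i)) - (4 : ℝ) • ((gram x n)⁻¹ *ᵥ W)) ≤ d * ε ^ 2 := by
      calc _ ≤ ∑ _i : Fin d, ε ^ 2 := Finset.sum_le_sum fun i _ => by
            have := hk' i
            rw [abs_sub_comm] at this
            rw [← sq, ← sq_abs]
            exact pow_le_pow_left₀ (abs_nonneg _) this 2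
        _ = d * ε ^ 2 := by simp
    refine le_trans (mul_le_mul (by linarith) h1 ?_ (by positivity)) hε'
    exact Finset.sum_nonneg fun i _ => mul_self_nonneg _)
  rw [hsplit]
  refine (sqrt_quadForm_add_le hB _ _).trans (add_le_add ?_ hrest)
  rw [quadForm_smul, Real.sqrt_mul (sq_nonneg _), Real.sqrt_sq hI.H_nonneg]
  refine mul_le_mul_of_nonneg_left (Real.sqrt_le_sqrt ?_) hI.H_nonneg
  rw [← hcard]
  exact hmain

end Concentration

/-! ## Accuracy of the regression -/

section Accuracy

variable {S A : Type*} [MeasurableSpace S] [MeasurableSpace A] {d : ℕ} {M : MDP S A}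
variable {φ : S → A → EuclideanSpace ℝ (Fin d)} {θ : EuclideanSpace ℝ (Fin d)}
variable {μ : Fin d → Measure S} {I : Inputs} {s : ℕ → S} {a : ℕ → A} {T n : ℕ}

/-- The value functions computed from the first `n` transitions of a trajectory. -/
def dataValue (φ : S → A → EuclideanSpace ℝ (Fin d)) (r : S → A → ℝ) (I : Inputs) (s : ℕ → S)
    (a : ℕ → A) (n j : ℕ) : ValuePair S :=
  valueIteration φ r I s a (gram (featureSeq φ s a) n) n j

/-- The regression coefficients for these value functions. -/
def dataWeight (φ : S → A → EuclideanSpace ℝ (Fin d)) (r : S → A → ℝ) (I : Inputs) (s : ℕ → S)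
    (a : ℕ → A) (n j : ℕ) : Fin d → ℝ :=
  regressionWeight φ s a (gram (featureSeq φ s a) n) n (dataValue φ r I s a n j)

/-- The parameter of the value function after `j + 1` iterations. -/
def dataParam (φ : S → A → EuclideanSpace ℝ (Fin d)) (r : S → A → ℝ) (I : Inputs) (s : ℕ → S)
    (a : ℕ → A) (n j : ℕ) : ValueIndex d → ℝ :=
  valueParam (dataWeight φ r I s a n j) (⨅ x, (dataValue φ r I s a n j).tilde x)
    (gram (featureSeq φ s a) n)⁻¹

omit [MeasurableSpace S] [MeasurableSpace A] in
theorem dataValue_succ_tilde (r : S → A → ℝ) (j : ℕ) :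
    (dataValue φ r I s a n (j + 1)).tilde = classTilde φ r I (dataParam φ r I s a n j) := rfl

omit [MeasurableSpace S] [MeasurableSpace A] in
theorem dataValue_succ_clipped_sub (r : S → A → ℝ) (j : ℕ) :
    (fun x => (dataValue φ r I s a n (j + 1)).clipped x -
      ⨅ y, (dataValue φ r I s a n (j + 1)).tilde y) =
      spread I.H (classTilde φ r I (dataParam φ r I s a n j)) := rfl

theorem dataValue_clipped_sub_mem_Icc [Nonempty S] [Nonempty A] [Finite A] (hI : I.Admissible)
    (hφ : ∀ x b, ‖φ x b‖ ≤ 1) (j : ℕ) (x : S) :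
    (dataValue φ M.r I s a n j).clipped x - (⨅ y, (dataValue φ M.r I s a n j).tilde y) ∈
      Set.Icc 0 I.H := by
  cases j with
  | zero => simp [dataValue, valueIteration, hI.H_nonneg]
  | succ j =>
    have h := congrFun (dataValue_succ_clipped_sub (φ := φ) (I := I) (s := s) (a := a) (n := n)
      M.r j) x
    refine Set.mem_of_eq_of_mem h ?_
    exact spread_mem_Icc hI.H_nonneg (bddBelow_classTilde hI hφ M.r_mem _) x

theorem measurable_dataValue_clipped [Nonempty S] [Nonempty A] [Finite A]
    [MeasurableSingletonClass A] (hI : I.Admissible) (hφ1 : ∀ x b, ‖φ x b‖ ≤ 1)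
    (hφ : ∀ b, Measurable fun x => φ x b) (j : ℕ) :
    Measurable (dataValue φ M.r I s a n j).clipped := by
  have h := (measurable_valueIteration (Ω := Unit) (r := M.r) (X := fun t _ => s t)
    (Y := fun t _ => a t) (n := n) hI hφ1 M.r_mem hφ
    (fun b => M.measurable_r.comp measurable_prodMk_right) (fun _ _ _ => measurable_const)
    (fun _ _ _ => measurable_const) j).1
  exact h.comp (measurable_const.prodMk measurable_id : Measurable fun x : S => ((), x))

theorem abs_dataValue_clipped_le [Nonempty S] [Nonempty A] [Finite A] (hI : I.Admissible)
    (hφ : ∀ x b, ‖φ x b‖ ≤ 1) (j : ℕ) : ∃ B : ℝ, ∀ x,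
    |(dataValue φ M.r I s a n j).clipped x| ≤ B := by
  refine ⟨|⨅ y, (dataValue φ M.r I s a n j).tilde y| + I.H, fun x => ?_⟩
  have h := dataValue_clipped_sub_mem_Icc (M := M) (s := s) (a := a) (n := n) hI hφ j x
  have h1 := neg_abs_le (⨅ y, (dataValue φ M.r I s a n j).tilde y)
  have h2 := le_abs_self (⨅ y, (dataValue φ M.r I s a n j).tilde y)
  rw [abs_le]
  constructor <;> linarith [h.1, h.2, hI.H_nonneg]

/-- The error of the regression in terms of the noise. -/
theorem abs_regression_sub_integral_le (hM : IsLinearMDP M φ θ μ) {V : ValuePair S} {m H K : ℝ}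
    (hm : m = ⨅ x, V.tilde x) (hV : Measurable V.clipped)
    (hH : ∀ x, V.clipped x - m ∈ Set.Icc 0 H)
    (hK : √(quadForm (gram (featureSeq φ s a) n)⁻¹
      (noise M φ s a (fun x => V.clipped x - m) n)) ≤ K) (x : S) (b : A) :
    |(φ x b).ofLp ⬝ᵥ regressionWeight φ s a (gram (featureSeq φ s a) n) n V + m -
      ∫ y, V.clipped y ∂(M.P (x, b))| ≤
      weightedNorm (gram (featureSeq φ s a) n)⁻¹ (φ x b) * (K + H * √d) := by
  have := M.markov
  have hH0 : 0 ≤ H := (hH x).1.trans (hH x).2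
  set Λ := gram (featureSeq φ s a) n with hΛ
  set g : S → ℝ := fun x => V.clipped x - m
  have hg : Measurable g := hV.sub_const m
  have hgabs : ∀ x, |g x| ≤ H := fun x => by rw [abs_of_nonneg (hH x).1]; exact (hH x).2
  set ϑ := integralVector μ g
  have hu : IsUnit Λ.det := (det_gram_pos _ n).ne'.isUnit
  have hB := posSemidef_gram_inv (featureSeq φ s a) n
  -- By linearity the conditional mean of the target is `φ_τ · ϑ`, so the data sum is the noise plus
  -- `(Λ - 1) ϑ`: the regulariser is the only source of bias.
  have e1 : ∑ τ ∈ Finset.Icc 1 n, (V.clipped (s (τ + 1)) - ⨅ x, V.tilde x) • (φ (s τ) (a τ)).ofLp =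
      noise M φ s a g n + (Λ *ᵥ ϑ - ϑ) := by
    rw [gram_mulVec, add_sub_cancel_left, noise, ← Finset.sum_add_distrib]
    refine Finset.sum_congr rfl fun τ _ => ?_
    rw [hM.integral_eq (s τ) (a τ) hg hgabs, ← add_smul, ← hm]
    congr 1
    change _ = g (s (τ + 1)) - _ + featureSeq φ s a τ ⬝ᵥ ϑ
    simp only [featureSeq, ϑ, g]
    ring
  have e2 : regressionWeight φ s a Λ n V = Λ⁻¹ *ᵥ noise M φ s a g n + (ϑ - Λ⁻¹ *ᵥ ϑ) := by
    rw [regressionWeight, e1, Matrix.mulVec_add, Matrix.mulVec_sub, Matrix.mulVec_mulVec,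
      Matrix.nonsing_inv_mul _ hu, Matrix.one_mulVec]
  have e3 : ∫ y, V.clipped y ∂(M.P (x, b)) = (φ x b).ofLp ⬝ᵥ ϑ + m := by
    have h1 := hM.integral_eq x b hg hgabs
    rw [← h1]
    have h2 : ∀ y, V.clipped y = g y + m := fun y => by simp [g]
    simp only [h2]
    rw [integral_add (integrable_of_abs_le hg hgabs) (integrable_const m)]
    simp
  have e4 : (φ x b).ofLp ⬝ᵥ regressionWeight φ s a Λ n V + m - ∫ y, V.clipped y ∂(M.P (x, b)) =
      (φ x b).ofLp ⬝ᵥ (Λ⁻¹ *ᵥ noise M φ s a g n) - (φ x b).ofLp ⬝ᵥ (Λ⁻¹ *ᵥ ϑ) := by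
    rw [e2, e3, dotProduct_add, dotProduct_sub]; ring
  rw [e4, weightedNorm_eq_sqrt_quadForm, mul_add]
  refine (abs_sub _ _).trans (add_le_add ?_ ?_)
  · exact (abs_dotProduct_mulVec_le hB _ _).trans
      (mul_le_mul_of_nonneg_left hK (Real.sqrt_nonneg _))
  · refine (abs_dotProduct_mulVec_le hB _ _).trans
      (mul_le_mul_of_nonneg_left ?_ (Real.sqrt_nonneg _))
    have h1 := (quadForm_gram_inv_le (featureSeq φ s a) n ϑ).trans
      (hM.integralVector_dotProduct_self_le hgabs)
    refine (Real.sqrt_le_sqrt h1).trans ?_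
    rw [Real.sqrt_mul (sq_nonneg _), Real.sqrt_sq hH0]

/-- The weights of the regression are bounded. -/
theorem sqrt_quadForm_regression_le [Nonempty S] [Nonempty A] [Finite A] (hI : I.Admissible)
    (hφ : ∀ x b, ‖φ x b‖ ≤ 1) (j : ℕ) (z : Fin d → ℝ)
    (hz : √(quadForm (gram (featureSeq φ s a) n)⁻¹ z) ≤ 1) :
    |z ⬝ᵥ dataWeight φ M.r I s a n j| ≤ n * I.H := by
  have hB := posSemidef_gram_inv (featureSeq φ s a) n
  refine (abs_dotProduct_mulVec_le hB _ _).trans ?_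
  have h1 := sqrt_quadForm_sum_le hB (Finset.Icc 1 n)
    (fun τ => (dataValue φ M.r I s a n j).clipped (s (τ + 1)) -
      ⨅ x, (dataValue φ M.r I s a n j).tilde x) (featureSeq φ s a) (e := I.H)
    (fun τ _ => by
      have h := dataValue_clipped_sub_mem_Icc (M := M) (s := s) (a := a) (n := n) hI hφ j
        (s (τ + 1))
      rw [abs_of_nonneg h.1]; exact h.2)
    fun τ _ => sqrt_quadForm_featureSeq_le hφ s a n τ
  simp only [Nat.card_Icc, Nat.add_sub_cancel] at h1
  exact (mul_le_of_le_one_left (Real.sqrt_nonneg _) hz).trans h1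

theorem sqrt_quadForm_single_le (x : ℕ → Fin d → ℝ) (n : ℕ) (i : Fin d) :
    √(quadForm (gram x n)⁻¹ (Pi.single i 1)) ≤ 1 := by
  rw [Real.sqrt_le_one]
  exact (quadForm_gram_inv_le x n _).trans (by simp)

/-- The regression term is at least `-n H`, so one iteration lowers the minimum by no more than
this. -/
theorem iInf_dataValue_tilde_mem_Icc [Nonempty S] [Nonempty A] [Finite A] (hI : I.Admissible)
    (hφ : ∀ x b, ‖φ x b‖ ≤ 1) (j : ℕ) :
    (⨅ x, (dataValue φ M.r I s a n j).tilde x) ∈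
      Set.Icc (-(j * (n * I.H))) (1 / (1 - I.gamma)) := by
  have hH := hI.H_nonneg
  induction j with
  | zero =>
    have := hI.cap_pos
    simp only [dataValue, valueIteration, ciInf_const, Set.mem_Icc, le_refl, and_true]
    push_cast
    linarith
  | succ j ih =>
    rw [dataValue_succ_tilde]
    constructor
    · refine le_ciInf fun x => ?_
      have h := le_classTilde (r := M.r) (φ := φ) hI M.r_mem (p := dataParam φ M.r I s a n j)
        (N := n * I.H) (m := -(j * (n * I.H)))
        (fun x b => sqrt_quadForm_regression_le (M := M) hI hφ j _ (by
          rw [Real.sqrt_le_one]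
          exact (quadForm_gram_inv_le _ _ _).trans (by
            rw [dotProduct_self_eq_norm_sq]; exact pow_le_one₀ (norm_nonneg _) (hφ _ _))))
        (by positivity) (by rw [neg_nonpos]; positivity) ih.1 x
      push_cast
      linarith
    · exact (ciInf_le (bddBelow_classTilde hI hφ M.r_mem _) (Classical.arbitrary S)).trans
        (classTilde_le I _ _)

/-- A bound polynomial in `T` is good enough, because the size of the parameter box enters the final
estimate only through a logarithm. -/
theorem abs_dataParam_le [Nonempty S] [Nonempty A] [Finite A] (hI : I.Admissible)
    (hφ : ∀ x b, ‖φ x b‖ ≤ 1) {j : ℕ} (hj : j ≤ T) (hn : n ≤ T) {R : ℝ} (hR1 : 1 ≤ R)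
    (hR : 1 / (1 - I.gamma) + T * (T * I.H) ≤ R) (hT : 1 ≤ T) (i : ValueIndex d) :
    |dataParam φ M.r I s a n j i| ≤ R := by
  have hH := hI.H_nonneg
  have hcap := hI.cap_pos
  have hn' : (n : ℝ) ≤ T := by exact_mod_cast hn
  have hj' : (j : ℝ) ≤ T := by exact_mod_cast hj
  have hT' : (1 : ℝ) ≤ T := by exact_mod_cast hT
  have h1 : (n : ℝ) * I.H ≤ T * I.H := by gcongr
  rcases i with i | i | ⟨i, k⟩
  · have h2 := sqrt_quadForm_regression_le (M := M) hI hφ j (Pi.single i 1)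
      (sqrt_quadForm_single_le (featureSeq φ s a) n i)
    rw [single_one_dotProduct] at h2
    refine h2.trans ?_
    nlinarith [mul_nonneg (by linarith : (0 : ℝ) ≤ T) hH]
  · have h2 := iInf_dataValue_tilde_mem_Icc (M := M) (s := s) (a := a) (n := n) hI hφ j
    have h3 : (j : ℝ) * (n * I.H) ≤ T * (T * I.H) := by gcongr
    refine abs_le.2 ⟨?_, ?_⟩
    · exact le_trans (by linarith) h2.1
    · refine h2.2.trans ?_
      nlinarith [mul_nonneg (by linarith : (0 : ℝ) ≤ T)
        (mul_nonneg (by linarith : (0 : ℝ) ≤ T) hH)]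
  · have h2 := abs_dotProduct_mulVec_le (posSemidef_gram_inv (featureSeq φ s a) n)
      (Pi.single i 1) (Pi.single k 1)
    rw [single_one_dotProduct, Matrix.mulVec_single_one] at h2
    have h3 := sqrt_quadForm_single_le (featureSeq φ s a) n i
    have h4 := sqrt_quadForm_single_le (featureSeq φ s a) n k
    refine le_trans ?_ (h2.trans ((mul_le_one₀ h3 (Real.sqrt_nonneg _) h4).trans hR1))
    exact le_rfl

/-- The regression is accurate, up to the bonus and a small constant. -/
def IsAccurate (M : MDP S A) (φ : S → A → EuclideanSpace ℝ (Fin d)) (I : Inputs) (T : ℕ)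
    (s : ℕ → S) (a : ℕ → A) (e : ℝ) : Prop :=
  ∀ n ∈ Finset.Icc 1 T, ∀ j ≤ T, ∀ x b,
    |(φ x b).ofLp ⬝ᵥ dataWeight φ M.r I s a n j + (⨅ y, (dataValue φ M.r I s a n j).tilde y) -
      ∫ y, (dataValue φ M.r I s a n j).clipped y ∂(M.P (x, b))| ≤
      I.beta * weightedNorm (gram (featureSeq φ s a) n)⁻¹ (φ x b) + e

theorem isAccurate_of_noise_le [Nonempty S] [Nonempty A] [Finite A] [MeasurableSingletonClass A]
    (hM : IsLinearMDP M φ θ μ) (hI : I.Admissible) {R κ e : ℝ} (hR1 : 1 ≤ R)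
    (hR : 1 / (1 - I.gamma) + T * (T * I.H) ≤ R) (he : 0 ≤ e) (hκ0 : 0 ≤ κ)
    (hκ : I.H * (κ + √d) ≤ I.beta)
    (hnoise : ∀ n ∈ Finset.Icc 1 T, ∀ q : ValueIndex d → ℝ, (∀ i, |q i| ≤ R) →
      √(quadForm (gram (featureSeq φ s a) n)⁻¹
        (noise M φ s a (spread I.H (classTilde φ M.r I q)) n)) ≤ I.H * κ + e) :
    IsAccurate M φ I T s a e := by
  intro n hn j hj x b
  have hφ := hM.norm_feature_le
  have hn' := Finset.mem_Icc.1 hn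
  have hH := hI.H_nonneg
  have hK : √(quadForm (gram (featureSeq φ s a) n)⁻¹ (noise M φ s a
      (fun x => (dataValue φ M.r I s a n j).clipped x -
        ⨅ y, (dataValue φ M.r I s a n j).tilde y) n)) ≤ I.H * κ + e := by
    cases j with
    | zero =>
      -- The initial value function is constant, so its noise vanishes; it does not come from a
      -- parameter.
      have h0 : noise M φ s a (fun x => (dataValue φ M.r I s a n 0).clipped x -
          ⨅ y, (dataValue φ M.r I s a n 0).tilde y) n = 0 := by
        simp [noise, dataValue, valueIteration]
      rw [h0]
      simp only [quadForm, Matrix.mulVec_zero, dotProduct_zero, Real.sqrt_zero]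
      positivity
    | succ j =>
      rw [dataValue_succ_clipped_sub]
      exact hnoise n hn _ fun i => abs_dataParam_le hI hφ (by omega) hn'.2 hR1 hR (by omega) i
  refine (abs_regression_sub_integral_le hM rfl
    (measurable_dataValue_clipped hI hφ hM.measurable_feature j)
    (dataValue_clipped_sub_mem_Icc hI hφ j) hK x b).trans ?_
  -- As the weighted norm is at most one, the additive part `e` of the noise bound stays an additive
  -- error `e`.
  have hw : weightedNorm (gram (featureSeq φ s a) n)⁻¹ (φ x b) ≤ 1 := by
    rw [weightedNorm_eq_sqrt_quadForm, Real.sqrt_le_one]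
    refine (quadForm_gram_inv_le _ _ _).trans ?_
    rw [dotProduct_self_eq_norm_sq]
    exact pow_le_one₀ (norm_nonneg _) (hφ _ _)
  have hw0 : 0 ≤ weightedNorm (gram (featureSeq φ s a) n)⁻¹ (φ x b) := Real.sqrt_nonneg _
  nlinarith

end Accuracy

/-! ## Optimism -/

section Optimism

variable {S A : Type*} [MeasurableSpace S] [MeasurableSpace A] {d : ℕ} {M : MDP S A}
variable {φ : S → A → EuclideanSpace ℝ (Fin d)} {I : Inputs} {s : ℕ → S} {a : ℕ → A} {T n : ℕ}
variable {J : ℝ} {v : S → ℝ} {q : S → A → ℝ}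

/-- Optimism. A backup along a Bellman-optimal action reproduces the comparison function:
discounting `J/(1-γ)` loses exactly `J`, discounting `e/(1-γ)` releases the error of one regression,
and the bonus covers the rest. -/
theorem le_dataValue_clipped [Nonempty S] [Nonempty A] [Finite A] [MeasurableSingletonClass A]
    (hv : SolvesBellman M J v q) (hI : I.Admissible) (hH : span v ≤ I.H)
    (hφ1 : ∀ x b, ‖φ x b‖ ≤ 1) (hφ : ∀ b, Measurable fun x => φ x b) {e : ℝ} (he : 0 ≤ e)
    (hacc : IsAccurate M φ I T s a e) (hn : n ∈ Finset.Icc 1 T) {j : ℕ} (hj : j ≤ T) (x : S) :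
    J / (1 - I.gamma) + v x - (⨆ y, v y) - e / (1 - I.gamma) ≤
      (dataValue φ M.r I s a n j).clipped x := by
  have := M.markov
  have hγ : 0 < 1 - I.gamma := by linarith [hI.gamma_lt_one]
  have hJ1 := hv.gain_le_one
  have hcap : ∀ x, J / (1 - I.gamma) + v x - (⨆ y, v y) - e / (1 - I.gamma) ≤
      1 / (1 - I.gamma) := fun x => by
    have h1 : J / (1 - I.gamma) ≤ 1 / (1 - I.gamma) := by gcongr
    have h2 : 0 ≤ e / (1 - I.gamma) := by positivity
    linarith [(hv.mem_Icc x).2]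
  induction j generalizing x with
  | zero => exact hcap x
  | succ j ih =>
    have htilde : ∀ x, J / (1 - I.gamma) + v x - (⨆ y, v y) - e / (1 - I.gamma) ≤
        (dataValue φ M.r I s a n (j + 1)).tilde x := by
      intro x
      obtain ⟨b, hb⟩ := hv.exists_reward_add_eq x
      have hQ : classQ φ M.r I (dataParam φ M.r I s a n j) x b ≤
          (dataValue φ M.r I s a n (j + 1)).tilde x :=
        le_ciSup (f := fun b => classQ φ M.r I (dataParam φ M.r I s a n j) x b)
          (Set.finite_range _).bddAbove b
      refine le_trans (le_min ?_ (hcap x)) hQ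
      have h1 := (abs_le.1 (hacc n hn j (by omega) x b)).1
      obtain ⟨B, hB⟩ := abs_dataValue_clipped_le (M := M) (s := s) (a := a) (n := n) hI hφ1 j
      obtain ⟨B', hB'⟩ := hv.bounded_v
      have hvi : Integrable v (M.P (x, b)) := integrable_of_abs_le hv.measurable_v hB'
      have h2 : ∫ y, (v y + (J / (1 - I.gamma) - (⨆ y, v y) - e / (1 - I.gamma))) ∂(M.P (x, b)) ≤
          ∫ y, (dataValue φ M.r I s a n j).clipped y ∂(M.P (x, b)) :=
        integral_mono (hvi.add (integrable_const _)) (integrable_of_abs_le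
          (measurable_dataValue_clipped hI hφ1 hφ j) hB) fun y => by
            have := ih (by omega) y
            simp only
            linarith
      rw [integral_add hvi (integrable_const _)] at h2
      simp only [integral_const, probReal_univ, smul_eq_mul, one_mul] at h2
      have h3 := (integral_mem_Icc (μ := M.P (x, b)) hv.measurable_v hv.mem_Icc).2
      set Ev := ∫ y, v y ∂(M.P (x, b))
      set sv := ⨆ y, v y
      set z := (φ x b).ofLp ⬝ᵥ (fun i => dataParam φ M.r I s a n j (Sum.inl i)) +
        dataParam φ M.r I s a n j (Sum.inr (Sum.inl ())) + I.beta *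
          weightedNorm (paramMatrix (dataParam φ M.r I s a n j)) (φ x b)
      have h4 : J / (1 - I.gamma) + Ev - sv - e / (1 - I.gamma) - e ≤ z := by
        have h5 : z = (φ x b).ofLp ⬝ᵥ dataWeight φ M.r I s a n j +
          (⨅ y, (dataValue φ M.r I s a n j).tilde y) + I.beta *
          weightedNorm (gram (featureSeq φ s a) n)⁻¹ (φ x b) := rfl
        rw [h5]
        linarith
      have h6 := mul_le_mul_of_nonneg_left h4 hI.gamma_nonneg
      have h7 : I.gamma * (J / (1 - I.gamma)) = J / (1 - I.gamma) - J := by field_simp; ring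
      have h8 : I.gamma * (e / (1 - I.gamma)) = e / (1 - I.gamma) - e := by field_simp; ring
      -- This is why `v` is shifted by its supremum: a nonpositive quantity increases when it is
      -- discounted.
      have h9 : I.gamma * (Ev - sv) ≥ Ev - sv := by nlinarith [hI.gamma_lt_one]
      have h10 : I.gamma * e ≤ e := by nlinarith [hI.gamma_lt_one]
      linarith
    refine le_min (htilde x) ?_
    -- Clipping is harmless: the comparison function varies by at most `sp(v) ≤ H`, so even at `x`
    -- it lies below the minimum plus `H`.
    have h1 : J / (1 - I.gamma) + v x - (⨆ y, v y) - e / (1 - I.gamma) - I.H ≤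
        ⨅ y, (dataValue φ M.r I s a n (j + 1)).tilde y := by
      refine le_ciInf fun y => ?_
      have := htilde y
      linarith [hv.sub_le_span x y]
    exact sub_le_iff_le_add.1 h1

end Optimism

/-! ## The regret along a trajectory -/

section Regret

variable {S A : Type*} [MeasurableSpace S] [MeasurableSpace A] {d : ℕ} {M : MDP S A}
variable {φ : S → A → EuclideanSpace ℝ (Fin d)} {θ : EuclideanSpace ℝ (Fin d)}
variable {μ : Fin d → Measure S} {I : Inputs} {s : ℕ → S} {a : ℕ → A} {T : ℕ}
variable {J : ℝ} {v : S → ℝ} {q : S → A → ℝ} {e : ℝ}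

/-- The number of transitions from which the plan after time step `t` has been computed. -/
def dataSize (φ : S → A → EuclideanSpace ℝ (Fin d)) (r : S → A → ℝ) (I : Inputs) (T : ℕ)
    (s : ℕ → S) (a : ℕ → A) (t : ℕ) : ℕ := (learnerState φ r I T s a t).start - 1

/-- The planned (clipped) value function for time step `u`, computed from `n` transitions. -/
def planValue (φ : S → A → EuclideanSpace ℝ (Fin d)) (r : S → A → ℝ) (I : Inputs) (T : ℕ)
    (s : ℕ → S) (a : ℕ → A) (n u : ℕ) : S → ℝ :=
  if n = 0 then fun _ => 1 / (1 - I.gamma) else (dataValue φ r I s a n (T + 1 - u)).clipped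

/-- The difference of the expected and the actual planned value after time step `t`. -/
def valueNoise (M : MDP S A) (φ : S → A → EuclideanSpace ℝ (Fin d)) (I : Inputs) (T : ℕ)
    (s : ℕ → S) (a : ℕ → A) (t : ℕ) : ℝ :=
  ∫ y, planValue φ M.r I T s a (dataSize φ M.r I T s a (t - 1)) (t + 1) y ∂(M.P (s t, a t)) -
    planValue φ M.r I T s a (dataSize φ M.r I T s a (t - 1)) (t + 1) (s (t + 1))

omit [MeasurableSpace S] [MeasurableSpace A] in
theorem dataSize_le (φ : S → A → EuclideanSpace ℝ (Fin d)) (r : S → A → ℝ) (hI : I.lam = 1)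
    (T : ℕ) (s : ℕ → S) (a : ℕ → A) (t : ℕ) : dataSize φ r I T s a t ≤ t :=
  Nat.sub_le_iff_le_add.2 (episodeInvariant φ r hI T s a t).start_le

omit [MeasurableSpace S] [MeasurableSpace A] in
theorem planValue_le_cap [Nonempty S] [Nonempty A] [Finite A] (φ : S → A → EuclideanSpace ℝ (Fin d))
    (r : S → A → ℝ) (I : Inputs) (T : ℕ) (s : ℕ → S) (a : ℕ → A) (n u : ℕ) (x : S) :
    planValue φ r I T s a n u x ≤ 1 / (1 - I.gamma) := by
  rw [planValue]
  split_ifs with h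
  · exact le_rfl
  · rcases h : T + 1 - u with _ | j
    · exact le_rfl
    · refine (min_le_left _ _).trans ?_
      exact classTilde_le I (dataParam φ r I s a n j) x

theorem le_planValue [Nonempty S] [Nonempty A] [Finite A] [MeasurableSingletonClass A]
    (hv : SolvesBellman M J v q) (hI : I.Admissible) (hH : span v ≤ I.H)
    (hφ1 : ∀ x b, ‖φ x b‖ ≤ 1) (hφ : ∀ b, Measurable fun x => φ x b) (he : 0 ≤ e)
    (hacc : IsAccurate M φ I T s a e) {n u : ℕ} (hn : n ≤ T) (hu : 1 ≤ u) (x : S) :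
    J / (1 - I.gamma) - span v - e / (1 - I.gamma) ≤ planValue φ M.r I T s a n u x := by
  have hγ : 0 < 1 - I.gamma := by linarith [hI.gamma_lt_one]
  have h0 : 0 ≤ e / (1 - I.gamma) := by positivity
  rw [planValue]
  split_ifs with h
  · have h1 : J / (1 - I.gamma) ≤ 1 / (1 - I.gamma) := by
      gcongr
      exact hv.gain_le_one
    linarith [span_nonneg v]
  · have h1 := le_dataValue_clipped hv hI hH hφ1 hφ he hacc
      (Finset.mem_Icc.2 ⟨Nat.one_le_iff_ne_zero.2 h, hn⟩) (j := T + 1 - u) (by omega) x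
    linarith [hv.iSup_sub_le_span x]

/-- The regret of one time step, when a plan has been computed. -/
theorem planned_step_le [Nonempty S] [Nonempty A] [Finite A] [MeasurableSingletonClass A]
    (hv : SolvesBellman M J v q) (hI : I.Admissible) (hlam : I.lam = 1) (hH : span v ≤ I.H)
    (hφ1 : ∀ x b, ‖φ x b‖ ≤ 1) (hφ : ∀ b, Measurable fun x => φ x b) (he : 0 ≤ e)
    (hacc : IsAccurate M φ I T s a e) (hfol : FollowsAlgorithm φ M.r I T s a) {t : ℕ}
    (ht1 : 1 ≤ t) (htT : t ≤ T) {n : ℕ} (hn : dataSize φ M.r I T s a (t - 1) = n) (hn0 : n ≠ 0) :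
    J - M.r (s t) (a t) ≤ (1 - I.gamma) * span v + 2 * e +
      (planValue φ M.r I T s a n (t + 1) (s (t + 1)) - planValue φ M.r I T s a n t (s t)) +
      I.gamma * valueNoise M φ I T s a t +
      2 * I.beta * weightedNorm (gram (featureSeq φ s a) n)⁻¹ (φ (s t) (a t)) := by
  have hγ : 0 < 1 - I.gamma := by linarith [hI.gamma_lt_one]
  have hnT : n ≤ T := by
    have := dataSize_le φ M.r hlam T s a (t - 1)
    omega
  -- Optimism at the next state: `J ≤ (1-γ) V(s_{t+1}) + (1-γ) sp(v) + e`. Together with the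
  -- discounted backup this leaves an undiscounted difference `V(s_{t+1}) - V(s_t)`, which can
  -- telescope.
  have hlow := le_planValue hv hI hH hφ1 hφ he hacc hnT (u := t + 1) (by omega) (s (t + 1))
  have hlow' := mul_le_mul_of_nonneg_left hlow hγ.le
  have e1 : (1 - I.gamma) * (J / (1 - I.gamma) - span v - e / (1 - I.gamma)) =
      J - (1 - I.gamma) * span v - e := by field_simp
  rw [e1] at hlow'
  rw [valueNoise, hn]
  have hj : T + 1 - t = (T - t) + 1 := by omega
  have hj' : T + 1 - (t + 1) = T - t := by omega
  simp only [planValue, hn0, if_false, hj, hj'] at hlow' ⊢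
  set p := dataParam φ M.r I s a n (T - t)
  have hQ : (learnerState φ M.r I T s a (t - 1)).Q t = classQ φ M.r I p := by
    have hinv := episodeInvariant φ M.r hlam T s a (t - 1)
    have hne : (learnerState φ M.r I T s a (t - 1)).start ≠ 1 := by
      intro h
      rw [dataSize, h] at hn
      exact hn0 hn.symm
    rw [hinv.Q_eq_planned hne]
    change plannedQ φ M.r I T s a (gram (featureSeq φ s a) (dataSize φ M.r I T s a (t - 1)))
      (dataSize φ M.r I T s a (t - 1)) t = _
    rw [hn]
    rfl
  have h1 : (dataValue φ M.r I s a n (T - t + 1)).clipped (s t) ≤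
      classQ φ M.r I p (s t) (a t) := by
    refine (min_le_left _ _).trans (ciSup_le fun b => ?_)
    have := hfol t ht1 htT b
    rw [hQ] at this
    exact this
  have h2 : classQ φ M.r I p (s t) (a t) ≤ M.r (s t) (a t) + I.gamma *
      ((φ (s t) (a t)).ofLp ⬝ᵥ dataWeight φ M.r I s a n (T - t) +
        (⨅ y, (dataValue φ M.r I s a n (T - t)).tilde y) + I.beta *
          weightedNorm (gram (featureSeq φ s a) n)⁻¹ (φ (s t) (a t))) := min_le_left _ _
  have h3 := (abs_le.1 (hacc n (Finset.mem_Icc.2 ⟨Nat.one_le_iff_ne_zero.2 hn0, hnT⟩) (T - t)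
    (by omega) (s t) (a t))).2
  set w := weightedNorm (gram (featureSeq φ s a) n)⁻¹ (φ (s t) (a t))
  have hw : 0 ≤ I.beta * w := mul_nonneg hI.beta_nonneg (Real.sqrt_nonneg _)
  set EV := ∫ y, (dataValue φ M.r I s a n (T - t)).clipped y ∂(M.P (s t, a t))
  have h4 : I.gamma * ((φ (s t) (a t)).ofLp ⬝ᵥ dataWeight φ M.r I s a n (T - t) +
        (⨅ y, (dataValue φ M.r I s a n (T - t)).tilde y) + I.beta * w) ≤
      I.gamma * EV + (2 * (I.beta * w) + e) := by
    have h5 := mul_le_mul_of_nonneg_left (by linarith : _ ≤ EV + (2 * (I.beta * w) + e))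
      hI.gamma_nonneg (b := (φ (s t) (a t)).ofLp ⬝ᵥ dataWeight φ M.r I s a n (T - t) +
        (⨅ y, (dataValue φ M.r I s a n (T - t)).tilde y) + I.beta * w)
    have h6 : I.gamma * (2 * (I.beta * w) + e) ≤ 2 * (I.beta * w) + e :=
      mul_le_of_le_one_left (by positivity) hI.gamma_lt_one.le
    linarith
  linarith

theorem weightedNorm_nonneg (B : Matrix (Fin d) (Fin d) ℝ) (x : EuclideanSpace ℝ (Fin d)) :
    0 ≤ weightedNorm B x := Real.sqrt_nonneg _

/-- The regret of one time step. -/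
theorem step_le [Nonempty S] [Nonempty A] [Finite A] [MeasurableSingletonClass A]
    (hv : SolvesBellman M J v q) (hI : I.Admissible) (hlam : I.lam = 1) (hH : span v ≤ I.H)
    (hφ1 : ∀ x b, ‖φ x b‖ ≤ 1) (hφ : ∀ b, Measurable fun x => φ x b) (he : 0 ≤ e)
    (hacc : IsAccurate M φ I T s a e) (hfol : FollowsAlgorithm φ M.r I T s a) {t : ℕ}
    (ht1 : 1 ≤ t) (htT : t ≤ T) :
    J - M.r (s t) (a t) ≤ (if dataSize φ M.r I T s a (t - 1) = 0 then 1 else 0) +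
      ((1 - I.gamma) * span v + 2 * e) +
      (planValue φ M.r I T s a (dataSize φ M.r I T s a (t - 1)) (t + 1) (s (t + 1)) -
        planValue φ M.r I T s a (dataSize φ M.r I T s a (t - 1)) t (s t)) +
      I.gamma * valueNoise M φ I T s a t +
      2 * I.beta * weightedNorm (gram (featureSeq φ s a) (dataSize φ M.r I T s a (t - 1)))⁻¹
        (φ (s t) (a t)) := by
  have hγ : 0 < 1 - I.gamma := by linarith [hI.gamma_lt_one]
  split_ifs with h0
  -- Before the first plan all values equal the cap, so the value differences vanish and the step
  -- costs at most one.
  · have := M.markov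
    rw [valueNoise, h0]
    have h1 := hv.gain_le_one
    have h2 := (M.r_mem (s t) (a t)).1
    have h3 : 0 ≤ (1 - I.gamma) * span v := mul_nonneg hγ.le (span_nonneg v)
    have h4 := mul_nonneg hI.beta_nonneg
      (weightedNorm_nonneg (gram (featureSeq φ s a) 0)⁻¹ (φ (s t) (a t)))
    simp only [planValue, if_true, integral_const, probReal_univ, smul_eq_mul, one_mul, sub_self,
      mul_zero]
    linarith
  · have := planned_step_le hv hI hlam hH hφ1 hφ he hacc hfol ht1 htT rfl h0
    linarith

/-- There are few time steps before the first plan. -/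
theorem sum_no_plan_le (hM : IsLinearMDP M φ θ μ) [Nonempty S] [Nonempty A] (hlam : I.lam = 1) :
    ∑ t ∈ Finset.Icc 1 T, (if dataSize φ M.r I T s a (t - 1) = 0 then (1 : ℝ) else 0) ≤
      2 * d := by
  have hd := hM.one_le_dim
  have hd0 : (0 : ℝ) < d := by exact_mod_cast hd
  rw [Finset.sum_ite, Finset.sum_const_zero, add_zero, Finset.sum_const, nsmul_one]
  have hsub : (Finset.Icc 1 T).filter (fun t => dataSize φ M.r I T s a (t - 1) = 0) ⊆
      Finset.Icc 1 (d + 1) := by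
    intro t ht
    rw [Finset.mem_filter, Finset.mem_Icc] at ht
    -- During the first episode the determinant stays at most `2`, whereas short features are
    -- excluded and it grows by `1/d` per step; hence `t ≤ d + 1 ≤ 2d`.
    have h1 := (episodeInvariant φ M.r hlam T s a (t - 1)).det_le
    change _ ≤ 2 * (gram _ (dataSize φ M.r I T s a (t - 1))).det at h1
    rw [ht.2, det_gram_zero] at h1
    have h2 := one_add_mul_le_det_gram (x := featureSeq φ s a) (c := 1 / d) (t - 1)
      fun τ _ _ => by
        rw [div_le_iff₀ hd0, mul_comm]
        exact hM.one_le_mul_dotProduct_self (s τ) (a τ)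
    have h3 : ((t - 1 : ℕ) : ℝ) * (1 / d) ≤ 1 := by linarith
    rw [mul_one_div, div_le_one hd0] at h3
    have h4 : t - 1 ≤ d := by exact_mod_cast h3
    rw [Finset.mem_Icc]
    omega
  have h5 := Finset.card_le_card hsub
  rw [Nat.card_Icc] at h5
  have h6 : ((Finset.Icc 1 T).filter
    (fun t => dataSize φ M.r I T s a (t - 1) = 0)).card ≤ 2 * d := by omega
  exact_mod_cast h6

/-- Within an episode the sum telescopes. At a change of plan the old value is below the cap and the
new one is bounded below by optimism with `J ≥ 0`, so the jump is at most `D`. -/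
theorem sum_planValue_sub_le [Nonempty S] [Nonempty A] [Finite A] [MeasurableSingletonClass A]
    (hv : SolvesBellman M J v q) (hI : I.Admissible) (hlam : I.lam = 1) (hH : span v ≤ I.H)
    (hφ1 : ∀ x b, ‖φ x b‖ ≤ 1) (hφ : ∀ b, Measurable fun x => φ x b) (he : 0 ≤ e)
    (hacc : IsAccurate M φ I T s a e) :
    ∑ t ∈ Finset.Icc 1 T,
      (planValue φ M.r I T s a (dataSize φ M.r I T s a (t - 1)) (t + 1) (s (t + 1)) -
        planValue φ M.r I T s a (dataSize φ M.r I T s a (t - 1)) t (s t)) ≤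
      (1 / (1 - I.gamma) + span v + e / (1 - I.gamma)) * (d * Real.logb 2 (1 + T)) := by
  have hγ : 0 < 1 - I.gamma := by linarith [hI.gamma_lt_one]
  have hJ : 0 ≤ J / (1 - I.gamma) := div_nonneg hv.gain_nonneg hγ.le
  set D := 1 / (1 - I.gamma) + span v + e / (1 - I.gamma) with hD
  have hD0 : 0 ≤ D := by
    have := span_nonneg v
    positivity
  set α : ℕ → ℝ := fun t => planValue φ M.r I T s a (dataSize φ M.r I T s a (t - 1)) t (s t)
  set ep : ℕ → ℝ := fun t => ((learnerState φ M.r I T s a t).episode : ℝ)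
  have hstep : ∀ t, 1 ≤ t → t ≤ T →
      planValue φ M.r I T s a (dataSize φ M.r I T s a (t - 1)) (t + 1) (s (t + 1)) ≤
        α (t + 1) + D * (ep t - ep (t - 1)) := by
    intro t h1 h2
    obtain ⟨m, rfl⟩ := Nat.exists_eq_add_of_le' h1
    simp only [α, ep, Nat.add_sub_cancel]
    rcases start_eq_or_episode_lt φ M.r I T s a m with h | h
    · have h3 : dataSize φ M.r I T s a (m + 1) = dataSize φ M.r I T s a m := by
        simp only [dataSize, h]
      have h4 : (0 : ℝ) ≤ (learnerState φ M.r I T s a (m + 1)).episode -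
          (learnerState φ M.r I T s a m).episode := by
        rw [sub_nonneg]
        exact_mod_cast episode_le_succ φ M.r I T s a m
      rw [h3]
      linarith [mul_nonneg hD0 h4]
    · have h3 := planValue_le_cap φ M.r I T s a (dataSize φ M.r I T s a m) (m + 1 + 1)
        (s (m + 1 + 1))
      have h4 := le_planValue hv hI hH hφ1 hφ he hacc
        ((dataSize_le φ M.r hlam T s a (m + 1)).trans h2) (u := m + 1 + 1) (by omega)
        (s (m + 1 + 1))
      rw [← h]
      push_cast
      linarith
  have htel : ∀ n ≤ T, ∑ t ∈ Finset.Icc 1 n,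
      (planValue φ M.r I T s a (dataSize φ M.r I T s a (t - 1)) (t + 1) (s (t + 1)) - α t) ≤
        α (n + 1) - α 1 + D * (ep n - ep 0) := by
    intro n
    induction n with
    | zero => simp
    | succ n ih =>
      intro hn
      rw [Finset.sum_Icc_succ_top (by omega)]
      have h1 := ih (by omega)
      have h2 := hstep (n + 1) (by omega) hn
      simp only [Nat.add_sub_cancel] at h2 ⊢
      linarith
  refine (htel T le_rfl).trans ?_
  -- The sum starts at the cap, the largest possible value, so its boundary terms do not contribute.
  have h1 : α 1 = 1 / (1 - I.gamma) := by
    simp [α, dataSize, learnerState, planValue]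
  have h2 : α (T + 1) ≤ 1 / (1 - I.gamma) := planValue_le_cap φ M.r I T s a _ _ _
  have h3 : ep T - ep 0 ≤ d * Real.logb 2 (1 + T) := by
    refine le_trans (le_of_eq ?_) (episode_sub_one_le hφ1 M.r hlam T s a T)
    rw [Nat.cast_sub (episodeInvariant φ M.r hlam T s a T).one_le_episode]
    simp [ep, learnerState]
  have h4 := mul_le_mul_of_nonneg_left h3 hD0
  linarith

-- Cauchy-Schwarz over time, the factor `2` for the stale matrix, and the elliptical potential.
omit [MeasurableSpace S] [MeasurableSpace A] in
theorem sum_bonus_le (hφ1 : ∀ x b, ‖φ x b‖ ≤ 1) (r : S → A → ℝ) (hlam : I.lam = 1) :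
    ∑ t ∈ Finset.Icc 1 T, weightedNorm
      (gram (featureSeq φ s a) (dataSize φ r I T s a (t - 1)))⁻¹ (φ (s t) (a t)) ≤
      √(4 * (d * T * Real.log (1 + T))) := by
  refine Real.le_sqrt_of_sq_le ?_
  refine (sq_sum_le_card_mul_sum_sq).trans ?_
  have h1 : ∀ t ∈ Finset.Icc 1 T, weightedNorm
      (gram (featureSeq φ s a) (dataSize φ r I T s a (t - 1)))⁻¹ (φ (s t) (a t)) ^ 2 ≤
      2 * quadForm (gram (featureSeq φ s a) (t - 1))⁻¹ (featureSeq φ s a t) := by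
    intro t _
    rw [weightedNorm_eq_sqrt_quadForm,
      Real.sq_sqrt (quadForm_nonneg (posSemidef_gram_inv _ _) _)]
    exact quadForm_inv_le_two_mul (dataSize_le φ r hlam T s a (t - 1))
      (episodeInvariant φ r hlam T s a (t - 1)).det_le _
  have h2 := Finset.sum_le_sum h1
  rw [← Finset.mul_sum] at h2
  have h3 := sum_quadForm_gram_inv_le (x := featureSeq φ s a) (n := T)
    fun τ _ _ => featureSeq_dotProduct_le hφ1 s a τ
  have h4 : Real.log (gram (featureSeq φ s a) T).det ≤ d * Real.log (1 + T) := by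
    rw [← Real.log_pow]
    exact Real.log_le_log (det_gram_pos _ _) (det_gram_le
      fun τ _ _ => featureSeq_dotProduct_le hφ1 s a τ)
  rw [Nat.card_Icc, Nat.add_sub_cancel]
  calc (T : ℝ) * _ ≤ T * (2 * (2 * (d * Real.log (1 + T)))) := by
        gcongr
        exact h2.trans (by linarith)
    _ = _ := by ring

/-- The regret of the algorithm along a trajectory on which the regression is accurate. -/
theorem regret_le [Nonempty S] [Nonempty A] [Finite A] [MeasurableSingletonClass A]
    (hv : SolvesBellman M J v q) (hM : IsLinearMDP M φ θ μ) (hI : I.Admissible)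
    (hlam : I.lam = 1) (hH : span v ≤ I.H) (he : 0 ≤ e)
    (hacc : IsAccurate M φ I T s a e) (hfol : FollowsAlgorithm φ M.r I T s a) :
    regret M T s a ≤ 2 * d + T * ((1 - I.gamma) * span v + 2 * e) +
      (1 / (1 - I.gamma) + span v + e / (1 - I.gamma)) * (d * Real.logb 2 (1 + T)) +
      I.gamma * ∑ t ∈ Finset.Icc 1 T, valueNoise M φ I T s a t +
      2 * I.beta * √(4 * (d * T * Real.log (1 + T))) := by
  have hφ1 := hM.norm_feature_le
  have hφ := hM.measurable_feature
  have h1 : regret M T s a ≤ ∑ t ∈ Finset.Icc 1 T, _ :=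
    Finset.sum_le_sum fun t ht => (sub_le_sub_right (hv.optimalGain_le (s 1)) _).trans
      (step_le hv hI hlam hH hφ1 hφ he hacc hfol (Finset.mem_Icc.1 ht).1 (Finset.mem_Icc.1 ht).2)
  simp only [Finset.sum_add_distrib, ← Finset.mul_sum, Finset.sum_const, Nat.card_Icc,
    Nat.add_sub_cancel, nsmul_eq_mul] at h1
  have h2 := sum_no_plan_le (T := T) (s := s) (a := a) hM hlam
  have h3 := sum_planValue_sub_le (T := T) hv hI hlam hH hφ1 hφ he hacc
  have h4 := mul_le_mul_of_nonneg_left (sum_bonus_le (T := T) (s := s) (a := a) hφ1 M.r hlam)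
    (mul_nonneg zero_le_two hI.beta_nonneg)
  linarith

end Regret

/-! ## The sum of the deviations of the planned values -/

section PlanMeasurability

variable {S A Ω : Type*} [MeasurableSpace S] [MeasurableSpace A] [MeasurableSpace Ω] {d : ℕ}
variable {φ : S → A → EuclideanSpace ℝ (Fin d)} {r : S → A → ℝ} {I : Inputs} {T : ℕ}
variable {X : ℕ → Ω → S} {Y : ℕ → Ω → A}

/-- For substituting the random number of data points used by the current plan. -/
theorem measurable_apply_nat {N : Ω → ℕ} (hN : Measurable N) {m : ℕ} (hm : ∀ ω, N ω ≤ m)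
    {f : ℕ → Ω → ℝ} (hf : ∀ n ≤ m, Measurable (f n)) : Measurable fun ω => f (N ω) ω := by
  have h : Measurable fun q : ℕ × Ω => if q.1 ≤ m then f q.1 q.2 else 0 :=
    measurable_from_prod_countable_right fun n => by
      by_cases hn : n ≤ m
      · simpa [hn] using hf n hn
      · simp [hn]
  have h2 := h.comp (hN.prodMk measurable_id)
  simpa [Function.comp_def, hm] using h2

-- A recursion in terms of determinants alone, from which measurability is read off.
omit [MeasurableSpace S] [MeasurableSpace A] in
theorem dataSize_succ (hlam : I.lam = 1) (s : ℕ → S) (a : ℕ → A) (t : ℕ) :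
    dataSize φ r I T s a (t + 1) =
      if 2 * (gram (featureSeq φ s a) (dataSize φ r I T s a t)).det <
        (gram (featureSeq φ s a) (t + 1)).det then t + 1 else dataSize φ r I T s a t := by
  have hinv := episodeInvariant φ r hlam T s a t
  have h1 : (learnerState φ r I T s a t).LamBar +
      Matrix.vecMulVec (φ (s (t + 1)) (a (t + 1))).ofLp (φ (s (t + 1)) (a (t + 1))).ofLp =
        gram (featureSeq φ s a) (t + 1) := by rw [hinv.lamBar_eq]; rfl
  have h2 : (learnerState φ r I T s a t).Lam =
      gram (featureSeq φ s a) (dataSize φ r I T s a t) := hinv.lam_eq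
  rw [dataSize, learnerState]
  simp only [h1, h2]
  split_ifs <;> rfl

theorem measurable_dataSize [Finite A] [MeasurableSingletonClass A] (hlam : I.lam = 1)
    (hφ : ∀ b, Measurable fun x => φ x b) {t : ℕ} (hX : ∀ τ, 1 ≤ τ → τ ≤ t → Measurable (X τ))
    (hY : ∀ τ, 1 ≤ τ → τ ≤ t → Measurable (Y τ)) :
    Measurable fun ω => dataSize φ r I T (fun t => X t ω) (fun t => Y t ω) t := by
  induction t with
  | zero => exact measurable_const
  | succ t ih =>
    have ih' := ih (fun τ h1 h2 => hX τ h1 (by omega)) fun τ h1 h2 => hY τ h1 (by omega)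
    have hdet : ∀ n ≤ t + 1, Measurable fun ω =>
        (gram (featureSeq φ (fun t => X t ω) (fun t => Y t ω)) n).det := fun n hn =>
      measurable_gram_det (x := fun τ ω => featureSeq φ (fun t => X t ω) (fun t => Y t ω) τ)
        fun τ h1 h2 i => measurable_feature_comp hφ (hX τ h1 (by omega)) (hY τ h1 (by omega)) i
    simp only [dataSize_succ hlam]
    refine Measurable.ite (measurableSet_lt ?_ (hdet _ le_rfl)) measurable_const ih'
    exact (measurable_apply_nat ih' (fun ω => dataSize_le φ r hlam T _ _ t)
      (f := fun n ω => (gram (featureSeq φ (fun t => X t ω) (fun t => Y t ω)) n).det)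
      fun n hn => hdet n (by omega)).const_mul 2

theorem measurable_planValue [Nonempty S] [Nonempty A] [Finite A]
    [MeasurableSingletonClass A] (hI : I.Admissible) (hlam : I.lam = 1)
    (hφ1 : ∀ x b, ‖φ x b‖ ≤ 1)
    (hr1 : ∀ x b, r x b ∈ Set.Icc (0 : ℝ) 1) (hφ : ∀ b, Measurable fun x => φ x b)
    (hr : ∀ b, Measurable fun x => r x b) {t : ℕ} (hX : ∀ τ, 1 ≤ τ → τ ≤ t + 1 → Measurable (X τ))
    (hY : ∀ τ, 1 ≤ τ → τ ≤ t → Measurable (Y τ)) (u : ℕ) :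
    Measurable fun p : Ω × S => planValue φ r I T (fun t => X t p.1) (fun t => Y t p.1)
      (dataSize φ r I T (fun t => X t p.1) (fun t => Y t p.1) t) u p.2 := by
  have hN := measurable_dataSize (r := r) (I := I) (T := T) hlam hφ
    (fun τ h1 h2 => hX τ h1 (by omega)) hY
  refine measurable_apply_nat (hN.comp measurable_fst) (fun p => dataSize_le φ r hlam T _ _ t)
    (f := fun n (p : Ω × S) => planValue φ r I T (fun t => X t p.1) (fun t => Y t p.1) n u p.2)
    fun n hn => ?_
  unfold planValue
  by_cases h0 : n = 0
  · simp [h0]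
  · simp only [h0, if_false]
    exact (measurable_valueIteration hI hφ1 hr1 hφ hr
      (fun τ h1 h2 => hX τ h1 (by omega)) (fun τ h1 h2 => hY τ h1 (by omega)) _).1

end PlanMeasurability

/-! ### Azuma-Hoeffding for the planned values. -/

section PlanNoise

variable {S A Ω : Type*} [MeasurableSpace S] [MeasurableSpace A] [mΩ : MeasurableSpace Ω]
variable {M : MDP S A} {T : ℕ} {Pr : Measure Ω} {F : Filtration ℕ mΩ}
variable {X : ℕ → Ω → S} {Y : ℕ → Ω → A} {d : ℕ} {φ : S → A → EuclideanSpace ℝ (Fin d)}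
variable [Finite A] {I : Inputs}

/-- The effect of clipping: the range is `H`, although the values themselves are of order `1/(1-γ)`.
-/
theorem exists_planValue_mem_Icc [Nonempty S] [Nonempty A] (hI : I.Admissible)
    (hφ : ∀ x b, ‖φ x b‖ ≤ 1) (s : ℕ → S) (a : ℕ → A) (n u : ℕ) :
    ∃ m : ℝ, ∀ x, planValue φ M.r I T s a n u x ∈ Set.Icc m (m + I.H) := by
  unfold planValue
  by_cases h0 : n = 0
  · exact ⟨1 / (1 - I.gamma), fun x => by simp [h0, hI.H_nonneg]⟩
  · simp only [h0, if_false]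
    refine ⟨⨅ y, (dataValue φ M.r I s a n (T + 1 - u)).tilde y, fun x => ?_⟩
    have h := dataValue_clipped_sub_mem_Icc (M := M) (s := s) (a := a) (n := n) hI hφ
      (T + 1 - u) x
    constructor <;> linarith [h.1, h.2]

theorem IsInteraction.measure_sum_valueNoise_le [Nonempty S] [Nonempty A]
    [IsProbabilityMeasure Pr] [MeasurableSingletonClass A]
    (h : IsInteraction M T Pr F X Y) (hI : I.Admissible) (hlam : I.lam = 1)
    (hφ1 : ∀ x b, ‖φ x b‖ ≤ 1) (hφ : ∀ b, Measurable fun x => φ x b) (hT : 1 ≤ T)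
    {p : ℝ} (hp : 0 < p) (hp1 : p < 1) :
    Pr {ω | ¬ ∑ t ∈ Finset.Icc 1 T, valueNoise M φ I T (fun t => X t ω) (fun t => Y t ω) t ≤
      2 * I.H * √(Real.log (1 / p) * T)} ≤ ENNReal.ofReal p := by
  have hP := M.markov
  have hr : ∀ b, Measurable fun x => M.r x b := fun b =>
    M.measurable_r.comp measurable_prodMk_right
  set V : ℕ → Ω → S → ℝ := fun t ω => planValue φ M.r I T (fun t => X t ω) (fun t => Y t ω)
    (dataSize φ M.r I T (fun t => X t ω) (fun t => Y t ω) (t - 1)) (t + 1)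
  have hVm : ∀ t, 1 ≤ t → t ≤ T → Measurable fun p : Past F t × S => V t p.1 p.2 := by
    intro t h1 h2
    refine measurable_planValue (Ω := Past F t) hI hlam hφ1 M.r_mem hφ hr
      (fun τ h3 h4 => ?_) (fun τ h3 h4 => ?_) _
    · exact (h.measurable_state τ h3 (by omega)).mono (F.mono (by omega)) le_rfl
    · exact (h.measurable_action τ h3 (by omega)).mono (F.mono (by omega)) le_rfl
  choose m hm using fun t ω => exists_planValue_mem_Icc (M := M) (T := T) hI hφ1
    (fun t => X t ω) (fun t => Y t ω)
    (dataSize φ M.r I T (fun t => X t ω) (fun t => Y t ω) (t - 1)) (t + 1)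
  have hV : ∀ t ω x, V t ω x ∈ Set.Icc (m t ω) (m t ω + I.H) := hm
  have hnoise : ∀ t ω, valueNoise M φ I T (fun t => X t ω) (fun t => Y t ω) t =
      ∫ y, V t ω y ∂(M.P (X t ω, Y t ω)) - V t ω (X (t + 1) ω) := fun _ _ => rfl
  simp only [hnoise]
  have hT0 : (0 : ℝ) < T := by exact_mod_cast hT
  have hL : 0 < Real.log (1 / p) := Real.log_pos (by rw [lt_div_iff₀ hp]; linarith)
  set L := Real.log (1 / p) with hLdef
  -- For `H = 0` the planned values are constant in the state, and the scaling by `1/H` below is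
  -- unavailable.
  rcases hI.H_nonneg.eq_or_lt with hH | hH
  · have hconst : ∀ t ω x, V t ω x = m t ω := fun t ω x =>
      le_antisymm (by have := (hV t ω x).2; rwa [← hH, add_zero] at this) (hV t ω x).1
    have : {ω | ¬ ∑ t ∈ Finset.Icc 1 T, (∫ y, V t ω y ∂(M.P (X t ω, Y t ω)) -
        V t ω (X (t + 1) ω)) ≤ 2 * I.H * √(L * T)} = ∅ := by
      ext ω
      simp [hconst, ← hH]
    rw [this, measure_empty]
    exact zero_le
  -- Scaled to range `η`, a sum above `2H√(LT)` becomes at least `2L`, while the compensator is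
  -- `Tη²/8 = L/8`; the difference still exceeds `L`.
  set η := √(L / T) with hη
  have hη0 : 0 < η := Real.sqrt_pos.2 (by positivity)
  have hη2 : η ^ 2 = L / T := Real.sq_sqrt (by positivity)
  have hηT : η * T = √(L * T) := by
    have e : L * T = (L / T) * T ^ 2 := by field_simp
    rw [e, Real.sqrt_mul (by positivity), Real.sqrt_sq hT0.le]
  refine (measure_mono fun ω hω => ?_).trans (h.measure_sum_gt_le le_rfl
    (G := fun t ω x => -(η / I.H) * V t ω x) (l := fun t ω => -(η / I.H) * (m t ω + I.H))
    (c := fun _ _ => η) (fun t h1 h2 => (hVm t h1 h2).const_mul _)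
    (fun t h1 h2 => measurable_const) (fun t h1 h2 ω x => ?_) hp)
  · rw [Set.mem_ofPred_eq] at hω ⊢
    push Not at hω
    have e1 : ∀ t, deviation M X Y (fun t ω x => -(η / I.H) * V t ω x) t ω =
        (η / I.H) * (∫ y, V t ω y ∂(M.P (X t ω, Y t ω)) - V t ω (X (t + 1) ω)) := by
      intro t
      rw [deviation, integral_const_mul]
      ring
    simp only [e1]
    rw [Finset.sum_sub_distrib, ← Finset.mul_sum, Finset.sum_const, Nat.card_Icc,
      Nat.add_sub_cancel, nsmul_eq_mul, hη2]
    have h2 := mul_le_mul_of_nonneg_left hω.le (by positivity : 0 ≤ η / I.H)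
    have e3 : η / I.H * (2 * I.H * √(L * T)) = 2 * L := by
      rw [← hηT]
      have : η / I.H * (2 * I.H * (η * T)) = 2 * η ^ 2 * T := by field_simp
      rw [this, hη2]
      field_simp
    have e4 : (T : ℝ) * (L / T / 8) = L / 8 := by field_simp
    rw [e3] at h2
    rw [e4]
    linarith
  · have := hV t ω x
    have hc : 0 ≤ η / I.H := by positivity
    have e : -(η / I.H) * (m t ω + I.H) + η = -(η / I.H) * m t ω := by field_simp; ring
    rw [Set.mem_Icc, e]
    constructor <;> nlinarith [this.1, this.2]

end PlanNoise

/-! ## The choice of the constants -/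

section Constants

variable {d T : ℕ} {δ : ℝ}

theorem mul_le_div_delta (hδ : 0 < δ) (hδ1 : δ < 1) : (d * T : ℝ) ≤ d * T / δ := by
  rw [le_div_iff₀ hδ]
  exact mul_le_of_le_one_right (by positivity) hδ1.le

theorem two_le_div_delta (hd : 1 ≤ d) (hT : 2 ≤ T) (hδ : 0 < δ) (hδ1 : δ < 1) :
    (2 : ℝ) ≤ d * T / δ := by
  refine le_trans ?_ (mul_le_div_delta hδ hδ1)
  have : 2 ≤ d * T := by nlinarith
  exact_mod_cast this

theorem log_bound {x : ℝ} (hx : 2 ≤ x) : 2 / 3 ≤ Real.log x := by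
  have := Real.log_two_gt_d9
  have h2 := Real.log_le_log (by norm_num) hx
  linarith

theorem four_fifths_le_sqrt {y : ℝ} (hy : 2 / 3 ≤ y) : 4 / 5 ≤ √y :=
  Real.le_sqrt_of_sq_le (by norm_num; linarith)

/-- The precision of the covering. -/
def gridStep (x : ℝ) : ℝ := 1 / (2 ^ 18 * x ^ 10)

theorem gridStep_pos {x : ℝ} (hx : 2 ≤ x) : 0 < gridStep x := by
  unfold gridStep; positivity

theorem gridStep_mul_le {x : ℝ} (hx : 2 ≤ x) : gridStep x * x ^ 2 ≤ 1 / 2 ^ 18 := by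
  have h0 : (1 : ℝ) ≤ x := by linarith
  have h : x ^ 2 ≤ x ^ 10 := pow_le_pow_right₀ h0 (by norm_num)
  unfold gridStep
  rw [div_mul_eq_mul_div, one_mul, div_le_div_iff₀ (by positivity) (by positivity)]
  nlinarith

/-- The grid step is a perfect square, because the modulus of continuity involves its root. -/
theorem sqrt_gridStep {x : ℝ} (hx : 2 ≤ x) : √(gridStep x) = 1 / (2 ^ 9 * x ^ 5) := by
  have e : gridStep x = (1 / (2 ^ 9 * x ^ 5)) ^ 2 := by
    unfold gridStep; field_simp
  rw [e, Real.sqrt_sq (by positivity)]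

/-- The number of grid points on one side of zero. -/
def gridSize (T : ℕ) (x : ℝ) : ℕ := ⌈(4 * (T : ℝ) ^ 3 + gridStep x) / gridStep x⌉₊

theorem le_gridSize_mul (T : ℕ) {x : ℝ} (hx : 2 ≤ x) :
    4 * (T : ℝ) ^ 3 + gridStep x ≤ gridSize T x * gridStep x :=
  (div_le_iff₀ (gridStep_pos hx)).1 (Nat.le_ceil _)

/-- The grid is polynomial in `x`. Since `x ≥ 2`, the numerical factor is absorbed into further
powers of `x`, so the logarithm is at most `35 log x`. -/
theorem two_mul_gridSize_le {x : ℝ} (hx : 2 ≤ x) (hTx : (T : ℝ) ≤ x) :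
    (2 * gridSize T x + 1 : ℝ) ≤ x ^ 35 := by
  have hε := gridStep_pos hx
  have h1 : (gridSize T x : ℝ) < (4 * (T : ℝ) ^ 3 + gridStep x) / gridStep x + 1 :=
    Nat.ceil_lt_add_one (by positivity)
  have h2 : (4 * (T : ℝ) ^ 3 + gridStep x) / gridStep x = 4 * T ^ 3 * (2 ^ 18 * x ^ 10) + 1 := by
    rw [add_div, div_self hε.ne']
    unfold gridStep
    field_simp
  have h3 : (T : ℝ) ^ 3 ≤ x ^ 3 := by gcongr
  have h4 : 4 * (T : ℝ) ^ 3 * (2 ^ 18 * x ^ 10) ≤ 4 * x ^ 3 * (2 ^ 18 * x ^ 10) := by gcongr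
  have h5 : (2 : ℝ) ^ 22 ≤ x ^ 22 := by gcongr
  have h6 : (1 : ℝ) ≤ x ^ 13 := one_le_pow₀ (by linarith)
  have h7 : (2 : ℝ) ^ 22 * x ^ 13 ≤ x ^ 22 * x ^ 13 := by gcongr
  have e1 : x ^ 22 * x ^ 13 = x ^ 35 := by ring
  have e2 : 4 * x ^ 3 * (2 ^ 18 * x ^ 10) = 2 ^ 20 * x ^ 13 := by ring
  rw [e1] at h7
  rw [e2] at h4
  norm_num at h7 h4
  linarith

/-- There are `(d+1)² ≤ 4d²` grid coordinates, each contributing at most `35 log x`. The square root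
is therefore of order `d √(log x)`, and this fixes the constant `32`. -/
theorem noise_level_le (hd : 1 ≤ d) (hT : 2 ≤ T) (hδ : 0 < δ) (hδ1 : δ < 1) :
    √((Real.log (T * (2 * gridSize T (d * T / δ) + 1 : ℝ) ^ (d + (1 + d * d) + d) / (δ / 2)) + 1) /
      2) + √d ≤ 32 * (d * √(Real.log (d * T / δ))) := by
  set x : ℝ := d * T / δ with hxdef
  have hx := two_le_div_delta hd hT hδ hδ1
  rw [← hxdef] at hx
  have hd' : (1 : ℝ) ≤ d := by exact_mod_cast hd
  have hT' : (2 : ℝ) ≤ T := by exact_mod_cast hT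
  have hTδ : (T : ℝ) / δ ≤ x := by
    rw [hxdef]; gcongr; nlinarith
  have hTx : (T : ℝ) ≤ x := le_trans (by rw [le_div_iff₀ hδ]; nlinarith) hTδ
  set L := Real.log x
  have hL : 2 / 3 ≤ L := log_bound hx
  have hsL := four_fifths_le_sqrt hL
  set G : ℝ := 2 * gridSize T x + 1 with hG
  have hG1 : 1 ≤ G := by
    have : (0 : ℝ) ≤ gridSize T x := Nat.cast_nonneg _
    linarith
  have hlogG : Real.log G ≤ 35 * L := by
    have := Real.log_le_log (by linarith) (two_mul_gridSize_le hx hTx)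
    rwa [Real.log_pow] at this
  have hlogG0 : 0 ≤ Real.log G := Real.log_nonneg hG1
  have e1 : Real.log (T * G ^ (d + (1 + d * d) + d) / (δ / 2)) =
      Real.log (2 * (T / δ)) + (d + (1 + d * d) + d : ℕ) * Real.log G := by
    rw [← Real.log_pow, ← Real.log_mul (by positivity) (by positivity)]
    congr 1
    field_simp
  have h1 : Real.log (2 * (T / δ)) ≤ 2 * L := by
    have : Real.log (x ^ 2) = 2 * L := by rw [Real.log_pow]; norm_num; rfl
    rw [← this]
    refine Real.log_le_log (by positivity) ?_
    rw [sq]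
    exact mul_le_mul hx hTδ (by positivity) (by linarith)
  have h2 : ((d + (1 + d * d) + d : ℕ) : ℝ) ≤ 4 * d ^ 2 := by push_cast; nlinarith
  have h3 : ((d + (1 + d * d) + d : ℕ) : ℝ) * Real.log G ≤ 4 * d ^ 2 * (35 * L) := by gcongr
  have hd2 : (1 : ℝ) ≤ d ^ 2 := one_le_pow₀ hd'
  have hdL : L ≤ d ^ 2 * L := le_mul_of_one_le_left (by linarith) hd2
  have h4 : √((Real.log (T * G ^ (d + (1 + d * d) + d) / (δ / 2)) + 1) / 2) ≤
      10 * (d * √L) := by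
    refine Real.sqrt_le_iff.2 ⟨by positivity, ?_⟩
    rw [e1, mul_pow, mul_pow, Real.sq_sqrt (by linarith)]
    linarith
  have h5 : √(d : ℝ) ≤ d := by
    refine Real.sqrt_le_iff.2 ⟨by positivity, ?_⟩
    nlinarith
  have h6 : (d : ℝ) * (4 / 5) ≤ d * √L := by gcongr
  linarith

/-- The polynomially small grid step beats `β`, which is polynomial in `x` once `sp ≤ √T`. -/
theorem valueModulus_le (hd : 1 ≤ d) (hT : 2 ≤ T) (hδ : 0 < δ) (hδ1 : δ < 1) {I : Inputs} {sp : ℝ}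
    (hsp : sp ≤ √T) (hβ : I.beta = 64 * sp * d * √(Real.log (d * T / δ))) :
    T * (4 * valueModulus d I (gridStep (d * T / δ))) ≤ 1 / T := by
  have hdT := mul_le_div_delta (d := d) (T := T) hδ hδ1
  set x : ℝ := d * T / δ with hxdef
  have hx := two_le_div_delta hd hT hδ hδ1
  rw [← hxdef] at hx
  have hd' : (1 : ℝ) ≤ d := by exact_mod_cast hd
  have hT' : (2 : ℝ) ≤ T := by exact_mod_cast hT
  have hx0 : 0 < x := by linarith
  have hε := gridStep_pos hx
  have h1 : √(T : ℝ) * √(Real.log x) ≤ x := by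
    have h2 : √(T : ℝ) ≤ √x := Real.sqrt_le_sqrt (by nlinarith)
    have h3 : √(Real.log x) ≤ √x := Real.sqrt_le_sqrt (Real.log_le_self (by linarith))
    calc _ ≤ √x * √x := by gcongr
      _ = x := Real.mul_self_sqrt hx0.le
  have h2 : I.beta * (d * √(gridStep x)) ≤ 64 * d ^ 2 * x * (1 / (2 ^ 9 * x ^ 5)) := by
    rw [hβ, sqrt_gridStep hx]
    calc 64 * sp * d * √(Real.log x) * (d * (1 / (2 ^ 9 * x ^ 5)))
        ≤ 64 * √T * d * √(Real.log x) * (d * (1 / (2 ^ 9 * x ^ 5))) := by gcongr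
      _ = 64 * d ^ 2 * (√T * √(Real.log x)) * (1 / (2 ^ 9 * x ^ 5)) := by ring
      _ ≤ _ := by gcongr
  have h3 : 4 * (T : ℝ) ^ 2 * (I.beta * (d * √(gridStep x))) ≤ 1 / 2 := by
    calc _ ≤ 4 * (T : ℝ) ^ 2 * (64 * d ^ 2 * x * (1 / (2 ^ 9 * x ^ 5))) := by gcongr
      _ = (d * T) ^ 2 * (1 / (2 * x ^ 4)) := by field_simp; norm_num
      _ ≤ x ^ 2 * (1 / (2 * x ^ 4)) := by gcongr
      _ = 1 / 2 * (1 / x ^ 2) := by field_simp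
      _ ≤ 1 / 2 * 1 := by
          gcongr
          rw [div_le_one (by positivity)]
          exact one_le_pow₀ (by linarith)
      _ = 1 / 2 := by ring
  have h4 : 4 * (T : ℝ) ^ 2 * (d * gridStep x + gridStep x) ≤ 1 / 2 := by
    have h5 : (T : ℝ) ^ 2 * (d + 1) ≤ 2 * x ^ 2 := by
      have h6 : (d * T : ℝ) ^ 2 ≤ x ^ 2 := by gcongr
      have h7 : (d : ℝ) + 1 ≤ 2 * d ^ 2 := by nlinarith
      calc (T : ℝ) ^ 2 * (d + 1) ≤ T ^ 2 * (2 * d ^ 2) := by gcongr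
        _ = 2 * (d * T : ℝ) ^ 2 := by ring
        _ ≤ _ := by gcongr
    have h8 := mul_le_mul_of_nonneg_right h5 hε.le
    have h9 := gridStep_mul_le hx
    norm_num at h9
    nlinarith
  rw [le_div_iff₀ (by linarith), valueModulus]
  nlinarith

theorem log_one_add_le {y : ℝ} (hy : 2 ≤ y) : Real.log (1 + y) ≤ 2 * Real.log y := by
  have : Real.log (y ^ 2) = 2 * Real.log y := by rw [Real.log_pow]; norm_num
  rw [← this]
  exact Real.log_le_log (by linarith) (by nlinarith)

theorem inv_sqrt_log_div_le {y : ℝ} (hy : 2 ≤ y) : 1 / √(Real.log y / y) ≤ y := by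
  have hl := log_bound hy
  have h0 : 0 < Real.log y / y := by positivity
  rw [div_le_iff₀ (Real.sqrt_pos.2 h0)]
  have h1 : 1 / y ≤ √(Real.log y / y) := by
    refine Real.le_sqrt_of_sq_le ?_
    rw [div_pow, one_pow, div_le_div_iff₀ (by positivity) (by positivity)]
    nlinarith
  calc (1 : ℝ) = y * (1 / y) := by field_simp
    _ ≤ _ := by gcongr

/-- The balance behind the choice of `γ`: this quantity and `T(1-γ)` are both `√(T log T)`. -/
theorem inv_sqrt_log_div_mul_log {y : ℝ} (hy : 2 ≤ y) :
    1 / √(Real.log y / y) * Real.log y = √(y * Real.log y) := by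
  have hl := log_bound hy
  have hs := Real.sq_sqrt (by linarith : 0 ≤ Real.log y)
  rw [Real.sqrt_div (by linarith), Real.sqrt_mul (by linarith)]
  have : 0 < √(Real.log y) := Real.sqrt_pos.2 (by linarith)
  have : 0 < √y := Real.sqrt_pos.2 (by linarith)
  field_simp
  rw [hs]

theorem mul_sqrt_log_div {y : ℝ} (hy : 2 ≤ y) : y * √(Real.log y / y) = √(y * Real.log y) := by
  have hl := log_bound hy
  have e : y * Real.log y = y ^ 2 * (Real.log y / y) := by field_simp
  rw [e, Real.sqrt_mul (by positivity), Real.sqrt_sq (by linarith)]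

/-- The final estimate of the regret. -/
theorem regret_bound_le (hd : 1 ≤ d) (hT : 2 ≤ T) (hδ : 0 < δ) (hδ1 : δ < 1) {sp N : ℝ}
    (hsp : 0 ≤ sp) (hN : N ≤ 2 * (2 * sp) * √(Real.log (1 / (δ / 2)) * T)) {γ : ℝ} (hγ0 : 0 ≤ γ)
    (hγ : γ = 1 - √(Real.log T / T)) :
    2 * d + T * ((1 - γ) * sp + 2 * (1 / T)) +
      (1 / (1 - γ) + sp + (1 / T) / (1 - γ)) * (d * Real.logb 2 (1 + T)) + γ * N +
      2 * (64 * sp * d * √(Real.log (d * T / δ))) * √(4 * (d * T * Real.log (1 + T))) ≤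
    1000 * (sp * √(d ^ 3 * T * Real.log T * Real.log (d * T / δ)) + d * √(T * Real.log T)) := by
  have hx := two_le_div_delta hd hT hδ hδ1
  have hdT := mul_le_div_delta (d := d) (T := T) hδ hδ1
  set x : ℝ := d * T / δ with hxdef
  have hd' : (1 : ℝ) ≤ d := by exact_mod_cast hd
  have hT' : (2 : ℝ) ≤ T := by exact_mod_cast hT
  have hL := log_bound hx
  have hl := log_bound hT'
  have hsL := four_fifths_le_sqrt hL
  have hsl := four_fifths_le_sqrt hl
  set L := Real.log x
  set l := Real.log (T : ℝ)
  have hu : 1 - γ = √(l / T) := by rw [hγ]; ring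
  have hu0 : 0 < √(l / T) := Real.sqrt_pos.2 (by positivity)
  rw [hu]
  have hlT : l ≤ T := Real.log_le_self (by linarith)
  -- the two scales of the bound
  set Y := √(T * l) with hY
  have hY1 : 1 ≤ Y := Real.le_sqrt_of_sq_le (by nlinarith)
  set W := √(d ^ 3 * T * l * L) with hW
  have hWs : W = d * √d * √T * √l * √L := by
    have e : (d : ℝ) ^ 3 * T * l * L = d ^ 2 * (d * (T * (l * L))) := by ring
    rw [hW, e, Real.sqrt_mul (by positivity), Real.sqrt_mul (by positivity),
      Real.sqrt_mul (by positivity), Real.sqrt_mul (by linarith), Real.sqrt_sq (by positivity)]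
    ring
  have hsd : 1 ≤ √(d : ℝ) := Real.one_le_sqrt.2 hd'
  have hYs : Y = √T * √l := Real.sqrt_mul (by positivity) _
  have hdd : (d : ℝ) ≤ d * √d := le_mul_of_one_le_right (by linarith) hsd
  have hdY : d * Y * (4 / 5) ≤ W := by
    rw [hWs, hYs]
    calc (d : ℝ) * (√T * √l) * (4 / 5) ≤ d * √d * (√T * √l) * √L := by gcongr
      _ = _ := by ring
  have hdTL : √(L * T) * (4 / 5) ≤ W := by
    rw [hWs, Real.sqrt_mul (by linarith)]
    calc √L * √T * (4 / 5) ≤ √L * √T * √l := by gcongr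
      _ = 1 * (√T * √l * √L) := by ring
      _ ≤ (d * √d) * (√T * √l * √L) := by gcongr; linarith
      _ = _ := by ring
  have hlY : l ≤ Y := Real.le_sqrt_of_sq_le (by nlinarith)
  -- the terms of the sum
  have t2 : T * (√(l / T) * sp + 2 * (1 / T)) = Y * sp + 2 := by
    have h1 : T * √(l / T) = Y := mul_sqrt_log_div hT'
    rw [mul_add, ← mul_assoc, h1]
    field_simp
  have hlogb : Real.logb 2 (1 + T) ≤ 3 * l := by
    have h1 := log_one_add_le hT'
    have h2 := Real.log_two_gt_d9
    rw [Real.logb, div_le_iff₀ (by linarith)]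
    nlinarith
  have hlogb0 : 0 ≤ Real.logb 2 (1 + T) := Real.logb_nonneg one_lt_two (by linarith)
  have t3 : (1 / √(l / T) + sp + (1 / T) / √(l / T)) * (d * Real.logb 2 (1 + T)) ≤
      6 * (d * Y) + 3 * (sp * (d * Y)) := by
    have h1 : (1 / (T : ℝ)) / √(l / T) ≤ 1 / √(l / T) := by
      gcongr
      rw [div_le_one (by linarith)]
      linarith
    have h2 := inv_sqrt_log_div_mul_log hT'
    calc _ ≤ (1 / √(l / T) + sp + 1 / √(l / T)) * (d * (3 * l)) := by gcongr
      _ = 6 * (d * (1 / √(l / T) * l)) + 3 * (sp * (d * l)) := by ring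
      _ = 6 * (d * Y) + 3 * (sp * (d * l)) := by rw [h2]
      _ ≤ _ := by gcongr
  have t4 : γ * N ≤ 5 * (sp * W) := by
    have hlog : Real.log (1 / (δ / 2)) ≤ L := by
      refine Real.log_le_log (by positivity) ?_
      rw [hxdef, one_div_div]
      gcongr
      nlinarith
    have hlog0 : 0 ≤ Real.log (1 / (δ / 2)) :=
      Real.log_nonneg (by rw [one_div_div, le_div_iff₀ hδ]; linarith)
    have h1 : N ≤ 4 * (sp * √(L * T)) := by
      calc N ≤ _ := hN
        _ ≤ 2 * (2 * sp) * √(L * T) := by gcongr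
        _ = _ := by ring
    have h2 : γ ≤ 1 := by rw [hγ]; linarith
    calc γ * N ≤ γ * (4 * (sp * √(L * T))) := by gcongr
      _ ≤ 1 * (4 * (sp * √(L * T))) := by gcongr
      _ = 5 * (sp * (√(L * T) * (4 / 5))) := by ring
      _ ≤ _ := by gcongr
  have t5 : 2 * (64 * sp * d * √L) * √(4 * (d * T * Real.log (1 + T))) ≤ 384 * (sp * W) := by
    have h1 := log_one_add_le hT'
    have h2 : √(4 * (d * T * Real.log (1 + T))) ≤ 3 * (√d * √T * √l) := by
      refine Real.sqrt_le_iff.2 ⟨by positivity, ?_⟩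
      rw [mul_pow, mul_pow, mul_pow, Real.sq_sqrt (by positivity), Real.sq_sqrt (by positivity),
        Real.sq_sqrt (by linarith)]
      have h3 : (d * T : ℝ) * Real.log (1 + T) ≤ d * T * (2 * l) := by gcongr
      have h4 : 0 ≤ (d * T : ℝ) * l := by positivity
      linarith
    calc _ ≤ 2 * (64 * sp * d * √L) * (3 * (√d * √T * √l)) := by gcongr
      _ = 384 * (sp * W) := by rw [hWs]; ring
  have hspW : sp * (d * Y * (4 / 5)) ≤ sp * W := by gcongr
  have hspY : Y * sp ≤ sp * (d * Y) := by
    rw [mul_comm]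
    gcongr
    exact le_mul_of_one_le_left (by linarith) hd'
  have hdY1 : (d : ℝ) ≤ d * Y := le_mul_of_one_le_right (by linarith) hY1
  have hsW : 0 ≤ sp * W := by positivity
  rw [t2]
  linarith

end Constants

/-! ## The regret bound -/

section RegretBound

variable {S A Ω : Type*} [MeasurableSpace S] [MeasurableSpace A] [mΩ : MeasurableSpace Ω]
variable {M : MDP S A} {T : ℕ} {Pr : Measure Ω} {F : Filtration ℕ mΩ}
variable {X : ℕ → Ω → S} {Y : ℕ → Ω → A} {d : ℕ} {φ : S → A → EuclideanSpace ℝ (Fin d)}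
variable {θ : EuclideanSpace ℝ (Fin d)} {μ : Fin d → Measure S}
variable {J : ℝ} {v : S → ℝ} {q : S → A → ℝ} {δ : ℝ}

theorem one_sub_le_real_of_compl_le [IsProbabilityMeasure Pr] {s : Set Ω} (hδ : 0 ≤ δ)
    (h : Pr sᶜ ≤ ENNReal.ofReal δ) : 1 - δ ≤ Pr.real s := by
  have h1 : Pr.real sᶜ ≤ δ := ENNReal.toReal_le_of_le_ofReal hδ h
  have h2 := measureReal_union_le (μ := Pr) s sᶜ
  rw [Set.union_compl_self, probReal_univ] at h2
  linarith

/-- The inputs of the algorithm in the regret bound. -/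
def regretInputs (T d : ℕ) (δ sp : ℝ) : Inputs where
  gamma := 1 - √(Real.log T / T)
  lam := 1
  H := 2 * sp
  beta := 2 * 32 * sp * d * √(Real.log (d * T / δ))

theorem regretInputs_admissible (hT : 2 ≤ T) (d : ℕ) (δ : ℝ) {sp : ℝ} (hsp : 0 ≤ sp) :
    (regretInputs T d δ sp).Admissible := by
  have hT' : (2 : ℝ) ≤ T := by exact_mod_cast hT
  have hl := log_bound hT'
  have h1 : √(Real.log T / T) ≤ 1 := by
    rw [Real.sqrt_le_one, div_le_one (by linarith)]
    exact Real.log_le_self (by linarith)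
  have h2 : 0 < √(Real.log T / T) := Real.sqrt_pos.2 (by positivity)
  refine ⟨?_, ?_, ?_, ?_⟩ <;> simp only [regretInputs]
  · linarith
  · linarith
  · positivity
  · positivity

theorem SolvesBellman.regret_le_length (hv : SolvesBellman M J v q) [Nonempty S] [Nonempty A]
    (s : ℕ → S) (a : ℕ → A) : regret M T s a ≤ T := by
  calc regret M T s a ≤ ∑ t ∈ Finset.Icc 1 T, (1 : ℝ) := Finset.sum_le_sum fun t _ => by
        linarith [hv.optimalGain_le (s 1), hv.gain_le_one, (M.r_mem (s t) (a t)).1]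
    _ = T := by simp

/-- For such a large span the bound is trivial, as the regret never exceeds the number of steps. The
covering argument can then assume `sp ≤ √T`. -/
theorem length_le_of_sqrt_le (hd : 1 ≤ d) (hT : 2 ≤ T) (hδ : 0 < δ) (hδ1 : δ < 1) {sp : ℝ}
    (hsp : √T ≤ sp) : (T : ℝ) ≤
      1000 * (sp * √(d ^ 3 * T * Real.log T * Real.log (d * T / δ)) + d * √(T * Real.log T)) := by
  have hd' : (1 : ℝ) ≤ d := by exact_mod_cast hd
  have hT' : (2 : ℝ) ≤ T := by exact_mod_cast hT
  have hL := log_bound (two_le_div_delta hd hT hδ hδ1)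
  have hl := log_bound hT'
  set L := Real.log (d * T / δ)
  set l := Real.log (T : ℝ)
  have h1 : √(T : ℝ) * (1 / 2) ≤ √(d ^ 3 * T * l * L) := by
    have h2 : (1 : ℝ) ≤ d ^ 3 := one_le_pow₀ hd'
    have h3 : (1 / 2) ^ 2 ≤ l * L := by nlinarith
    have e : √(T : ℝ) * (1 / 2) = √(T * (1 / 2) ^ 2) := by
      rw [Real.sqrt_mul (by positivity), Real.sqrt_sq (by norm_num)]
    rw [e]
    refine Real.sqrt_le_sqrt ?_
    calc (T : ℝ) * (1 / 2) ^ 2 ≤ T * (l * L) := by gcongr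
      _ ≤ d ^ 3 * (T * (l * L)) := le_mul_of_one_le_left (by positivity) h2
      _ = _ := by ring
  have h2 : √(T : ℝ) * (√(T : ℝ) * (1 / 2)) ≤ sp * √(d ^ 3 * T * l * L) :=
    mul_le_mul hsp h1 (by positivity) ((Real.sqrt_nonneg _).trans hsp)
  have h3 : √(T : ℝ) * √(T : ℝ) = T := Real.mul_self_sqrt (by linarith)
  have h4 : 0 ≤ d * √(T * l) := by positivity
  nlinarith

theorem IsInteraction.regret_bound [Nonempty S] [Nonempty A] [IsProbabilityMeasure Pr] [Finite A]
    [MeasurableSingletonClass A] (h : IsInteraction M T Pr F X Y) (hv : SolvesBellman M J v q)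
    (hM : IsLinearMDP M φ θ μ) (hT : 2 ≤ T) (hδ : 0 < δ) (hδ1 : δ < 1)
    (hfol : ∀ᵐ ω ∂Pr, FollowsAlgorithm φ M.r (regretInputs T d δ (span v)) T
      (fun t => X t ω) (fun t => Y t ω)) :
    1 - δ ≤ Pr.real {ω | regret M T (fun t => X t ω) (fun t => Y t ω) ≤
      1000 * (span v * √(d ^ 3 * T * Real.log T * Real.log (d * T / δ))
        + d * √(T * Real.log T))} := by
  have hd := hM.one_le_dim
  have hd' : (1 : ℝ) ≤ d := by exact_mod_cast hd
  have hT' : (2 : ℝ) ≤ T := by exact_mod_cast hT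
  have hsp0 := span_nonneg v
  refine one_sub_le_real_of_compl_le hδ.le ?_
  rcases le_total (√(T : ℝ)) (span v) with hsp | hsp
  · have hempty : {ω | regret M T (fun t => X t ω) (fun t => Y t ω) ≤
        1000 * (span v * √(d ^ 3 * T * Real.log T * Real.log (d * T / δ))
          + d * √(T * Real.log T))}ᶜ = ∅ := by
      rw [Set.compl_empty_iff]
      exact Set.eq_univ_of_forall fun ω => (hv.regret_le_length _ _).trans
        (length_le_of_sqrt_le hd hT hδ hδ1 hsp)
    rw [hempty, measure_empty]
    exact zero_le
  have hI := regretInputs_admissible hT d δ hsp0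
  set I := regretInputs T d δ (span v) with hIdef
  have hx := two_le_div_delta hd hT hδ hδ1
  have hcap : 1 / (1 - I.gamma) ≤ T := by
    have := inv_sqrt_log_div_le hT'
    simpa [hIdef, regretInputs] using this
  have hsT : √(T : ℝ) ≤ T := by
    refine Real.sqrt_le_iff.2 ⟨by positivity, ?_⟩
    nlinarith
  have hH : I.H = 2 * span v := rfl
  have hT1 : (T : ℝ) ≤ T ^ 3 := le_self_pow₀ (by linarith) (by norm_num)
  have hR : 1 / (1 - I.gamma) + T * (T * I.H) ≤ 4 * (T : ℝ) ^ 3 := by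
    have : (T : ℝ) * (T * I.H) ≤ T * (T * (2 * T)) := by
      rw [hH]; gcongr; exact hsp.trans hsT
    have e : (T : ℝ) * (T * (2 * T)) = 2 * T ^ 3 := by ring
    linarith
  have hρ := valueModulus_le hd hT hδ hδ1 hsp (I := I) (by rw [hIdef, regretInputs]; norm_num)
  have hκ := noise_level_le hd hT hδ hδ1
  have hgrid := gridStep_mul_le hx
  have hgrid0 := gridStep_pos hx
  have hsize := le_gridSize_mul T hx
  have hdTx := mul_le_div_delta (d := d) (T := T) hδ hδ1
  set x : ℝ := d * T / δ
  have hε : (1 + T : ℝ) * (d * gridStep x ^ 2) ≤ 8 := by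
    have h1 : (1 + T : ℝ) * d ≤ x ^ 2 := by nlinarith
    have h2 : gridStep x ≤ 1 := by
      have : gridStep x * 1 ≤ gridStep x * x ^ 2 := by
        gcongr
        exact one_le_pow₀ (by linarith)
      norm_num at hgrid
      linarith
    calc (1 + T : ℝ) * (d * gridStep x ^ 2) = gridStep x * ((1 + T : ℝ) * d) * gridStep x := by ring
      _ ≤ gridStep x * x ^ 2 * 1 := by gcongr
      _ ≤ 8 := by norm_num at hgrid ⊢; linarith
  -- The failure probability is split evenly between the uniform noise bound and the sum of the
  -- value noises.
  have hbad1 := h.measure_uniform_noise_le hI hM.norm_feature_le hM.measurable_feature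
    (by omega) hgrid0 hsize (by linarith) hε (half_pos hδ)
  have hbad2 := h.measure_sum_valueNoise_le (φ := φ) hI rfl hM.norm_feature_le
    hM.measurable_feature (by omega) (half_pos hδ) (by linarith)
  have hbad3 : Pr {ω | ¬ FollowsAlgorithm φ M.r I T (fun t => X t ω) (fun t => Y t ω)} = 0 := hfol
  have hsum := (measure_union_le (μ := Pr) _ _).trans
    (add_le_add ((measure_union_le (μ := Pr) _ _).trans (add_le_add hbad1 hbad2)) hbad3.le)
  rw [add_zero, ← ENNReal.ofReal_add (by linarith) (by linarith), add_halves] at hsum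
  refine (measure_mono fun ω hω => ?_).trans hsum
  by_contra hgood
  simp only [Set.mem_union, Set.mem_ofPred_eq, not_or, not_not] at hgood
  obtain ⟨⟨h1, h2⟩, h3⟩ := hgood
  refine hω ?_
  -- The covering error is `1/T`, so it adds only a constant to the regret over `T` steps.
  have hacc : IsAccurate M φ I T (fun t => X t ω) (fun t => Y t ω) (1 / T) :=
    isAccurate_of_noise_le hM hI (R := 4 * (T : ℝ) ^ 3) (by linarith) hR (by positivity)
      (Real.sqrt_nonneg _)
      ((mul_le_mul_of_nonneg_left hκ hI.H_nonneg).trans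
        (le_of_eq (by rw [hIdef, regretInputs]; ring)))
      fun n hn q hq => (h1 n hn q hq).trans (by gcongr)
  have hfin := regret_le hv hM hI rfl (by rw [hH]; linarith) (by positivity) hacc h3
  refine hfin.trans (le_trans (le_of_eq ?_) (regret_bound_le hd hT hδ hδ1 hsp0
    (γ := I.gamma) h2 hI.gamma_nonneg rfl))
  have hβ : I.beta = 64 * span v * d * √(Real.log x) := by
    change 2 * 32 * span v * d * √(Real.log x) = _
    ring
  rw [hβ]

end RegretBound

end GammaLSCVI

end

theorem mainTheorem1 :
    ∃ cβ : ℝ, 0 < cβ ∧ ∃ C : ℝ, 0 < C ∧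
      -- the regret bound
      (∀ (S A : Type*) [MeasurableSpace S] [Fintype A] [Nonempty A] [MeasurableSpace A]
          [MeasurableSingletonClass A] (d : ℕ) (M : GammaLSCVI.MDP S A)
          (φ : S → A → EuclideanSpace ℝ (Fin d)) (θ : EuclideanSpace ℝ (Fin d))
          (μ : Fin d → Measure S) (J : ℝ) (v : S → ℝ) (q : S → A → ℝ)
          (Ω : Type*) [mΩ : MeasurableSpace Ω] (Pr : Measure Ω) [IsProbabilityMeasure Pr]
          (F : Filtration ℕ mΩ) (X : ℕ → Ω → S) (Y : ℕ → Ω → A) (T : ℕ) (δ : ℝ),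
          GammaLSCVI.SolvesBellman M J v q →
          GammaLSCVI.IsLinearMDP M φ θ μ →
          2 ≤ T → 0 < δ → δ < 1 →
          GammaLSCVI.IsInteraction M T Pr F X Y →
          (∀ᵐ ω ∂Pr, GammaLSCVI.FollowsAlgorithm φ M.r
            { gamma := 1 - √(Real.log T / T)
              lam := 1
              H := 2 * GammaLSCVI.span v
              beta := 2 * cβ * GammaLSCVI.span v * d * √(Real.log (d * T / δ)) }
            T (fun t => X t ω) (fun t => Y t ω)) →
          1 - δ ≤ Pr.real {ω | GammaLSCVI.regret M T (fun t => X t ω) (fun t => Y t ω) ≤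
            C * (GammaLSCVI.span v * √(d ^ 3 * T * Real.log T * Real.log (d * T / δ))
              + d * √(T * Real.log T))}) ∧
      -- the running time, for finitely many states and actions
      (∀ (d nS nA : ℕ) [NeZero nS] [NeZero nA]
          (φ : Fin nS → Fin nA → EuclideanSpace ℝ (Fin d)) (r : Fin nS → Fin nA → ℝ)
          (gamma H beta : ℝ) (T : ℕ) (s : ℕ → Fin nS),
          1 ≤ d → 2 ≤ T → (∀ x b, ‖φ x b‖ ≤ 1) →
          GammaLSCVI.FollowsAlgorithm φ r ⟨gamma, 1, H, beta⟩ T s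
            (GammaLSCVI.runT φ r ⟨gamma, 1, H, beta⟩ T s).val ∧
          ((GammaLSCVI.runT φ r ⟨gamma, 1, H, beta⟩ T s).cost : ℝ) ≤
            C * (Real.logb 2 T * d ^ 3 * nS * nA * T ^ 2)) := by
  refine ⟨32, by norm_num, 1000, by norm_num, ?_, ?_⟩
  · intro S A _ _ _ _ _ d M φ θ μ J v q Ω _ Pr _ F X Y T δ hv hM hT hδ hδ1 h hfol
    -- A probability space has a point, and the first state there shows that the state space is
    -- nonempty.
    obtain ⟨ω⟩ := Measure.nonempty_of_neZero Pr
    have : Nonempty S := ⟨X 1 ω⟩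
    exact h.regret_bound hv hM hT hδ hδ1 hfol
  · intro d nS nA _ _ φ r gamma H beta T s hd hT hφ
    obtain ⟨h1, h2⟩ := GammaLSCVI.runT_spec φ r ⟨gamma, 1, H, beta⟩ T s rfl hd hT hφ
    refine ⟨h1, h2.trans ?_⟩
    have h3 : 0 ≤ Real.logb 2 T := Real.logb_nonneg one_lt_two (by exact_mod_cast (by omega : 1 ≤ T))
    have : 0 ≤ Real.logb 2 T * d ^ 3 * nS * nA * T ^ 2 := by positivity
    linarith
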